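/- **Conventions.** A monoid is a commutative cancellative monoid. For a set $P$, $\mathcal F(P)$ is the free abelian monoid with basis $P$. A divisor theory for a monoid $H$ is a homomorphism $\varphi\colon H\to\mathcal F(P)$ such that $\varphi(a)\mid\varphi(b)$ implies $a\mid b$, and such that each $p\in P$ is the greatest common divisor of $\varphi(X)$ for some finite non-empty $X\subset H$; $H$ is a Krull monoid if it has a divisor theory. Its class group is $G=\mathsf q(\mathcal F(P))/\mathsf q(\varphi(H))$ (with $\mathsf q$ denoting quotient groups), and the prime divisors in a class $g$ are the $p\in P$ with $[p]=g$. Let $\mathsf Z(H)$ be the free abelian monoid on the atoms of the reduced monoid $H_{\mathrm{red}}=H/H^\times$, and for $a\in H$ let $\mathsf Z(a)\subset\mathsf Z(H)$ be the set of factorizations of $a$, i.e. of those $z$ whose product is $aH^\times$. Put $\mathsf d(z,z')=\max\{|z\gcd(z,z')^{-1}|,|z'\gcd(z,z')^{-1}|\}$. For $a\in H$ and an atom $u$ of $H_{\mathrm{red}}$, let $\mathsf t(a,u)$ be the smallest $N\in\mathbb N_0\cup\{\infty\}$ such that, if $\mathsf Z(a)\cap u\mathsf Z(H)\neq\emptyset$,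 then for every $z\in\mathsf Z(a)$ there is $z'\in\mathsf Z(a)\cap u\mathsf Z(H)$ with $\mathsf d(z,z')\le N$. The tame degree $\mathsf t(H)$ is the supremum of all $\mathsf t(a,u)$. For a finite abelian group $G$, let $\mathcal B(G)\subset\mathcal F(G)$ be the monoid of zero-sum sequences over $G$ (those whose terms, with multiplicity, add up to $0$), let $\mathsf t(G)=\mathsf t(\mathcal B(G))$, and let the Davenport constant $\mathsf D(G)$ be the supremum of the lengths of the atoms of $\mathcal B(G)$. If $G\cong C_{n_1}\oplus\dots\oplus C_{n_r}$ with $1<n_1\mid\dots\mid n_r$, then $\mathsf r(G)=r$ is the rank of $G$ and $\mathsf D^*(G)=1+\sum_{i=1}^r(n_i-1)$ (so $\mathsf r(G)=0$ and $\mathsf D^*(G)=1$ if $|G|=1$). **Theorem.** Let $H$ be a Krull monoid with finite class group $G$ such that every class contains a prime divisor. 1. $\mathsf t(G)=\mathsf D^*(G)$ if and only if $G$ is isomorphic to one of $C_3$, $C_4$, $C_2^2$, $C_2^3$. 2. If some nontrivial class contains at least two distinct prime divisors, then $\mathsf t(H)=\mathsf D^*(G)$ if and only if $G$ is isomorphic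 to one of $C_2$, $C_3$, $C_4$, $C_2^2$. 3. For every integer $n\ge 2$ there are positive real constants $M_1,\dots,M_5$, depending only on $n$, such that for all such $H$ whose class group $G$ has exponent $n$, the values $\mathsf D(G)$ and $\mathsf t(H)$ are finite and, with $r=\mathsf r(G)$, $$M_1r\le\mathsf D(G)\le M_2r,\qquad M_3r^2\le\mathsf t(H)\le M_4r^2,$$ $$M_5\Bigl(1+\tfrac{\mathsf D(G)(\mathsf D(G)-1)}2\Bigr)\le\mathsf t(H)\le 1+\tfrac{\mathsf D(G)(\mathsf D(G)-1)}2 .$$ -/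

import Mathlib

namespace Krull

/-! ### Factorizations and the tame degree of a monoid -/

section Factorizations

variable (M : Type*) [CommMonoid M]

/-- The atoms (irreducible elements) of the associated reduced monoid `M_red`. -/
abbrev RedAtom : Type _ := {u : Associates M // Irreducible u}

variable {M}

/-- The set of factorizations `Z(a)` of `a`: the elements of the free abelian monoid on the atoms
of `M_red` (written as multisets of atoms) whose product in `M_red` is the class of `a`. -/
def factorizations (a : M) : Set (Multiset (RedAtom M)) :=
  {z | (z.map Subtype.val).prod = Associates.mk a}

open Classical in
/-- The distance `d(z, z') = max {|z gcd(z, z')⁻¹|, |z' gcd(z, z')⁻¹|}`; the gcd of two elements of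
a free abelian monoid is the intersection of the multisets. -/
noncomputable def factorizationDist (z z' : Multiset (RedAtom M)) : ℕ :=
  max (z - z ∩ z').card (z' - z ∩ z').card

/-- `t(a, x)`: the smallest `N ∈ ℕ ∪ {∞}` such that, if `a` has a factorization divisible by `x`,
then every factorization `z` of `a` has distance at most `N` from some factorization of `a` that is
divisible by `x`. (Divisibility in the free abelian monoid is the order `≤` on multisets.) -/
noncomputable def tameDegreeAt (a : M) (x : Multiset (RedAtom M)) : ℕ∞ :=
  sInf {N : ℕ∞ | (∃ y ∈ factorizations a, x ≤ y) → ∀ z ∈ factorizations a,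
    ∃ z' ∈ factorizations a, x ≤ z' ∧ (factorizationDist z z' : ℕ∞) ≤ N}

variable (M)

/-- The (global) tame degree `t(M)`: the supremum of `t(a, u)` over all `a` in `M` and all
atoms `u` of `M_red`. -/
noncomputable def tameDegree : ℕ∞ :=
  ⨆ (u : RedAtom M) (a : M), tameDegreeAt a {u}

end Factorizations

/-! ### Divisor theories and class groups -/

section DivisorTheory

/-- `d` is a greatest common divisor of the set `X`. -/
def IsGreatestCommonDivisor {D : Type*} [CommMonoid D] (X : Set D) (d : D) : Prop :=
  (∀ x ∈ X, d ∣ x) ∧ ∀ e, (∀ x ∈ X, e ∣ x) → e ∣ d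

/-- The free abelian monoid with basis `P`, written multiplicatively. -/
abbrev FreeAbMonoid (P : Type*) : Type _ := Multiplicative (Multiset P)

/-- A divisor theory `φ : H → F(P)`: a divisor homomorphism into a free abelian monoid such that
every `p ∈ P` is the greatest common divisor of the image of a finite non-empty subset of `H`.
A (commutative, cancellative) monoid is a Krull monoid if and only if it has a divisor theory;
the elements of `P` are its prime divisors. -/
structure IsDivisorTheory {H P : Type*} [CommMonoid H] (φ : H →* FreeAbMonoid P) : Prop where
  dvd_of_map_dvd : ∀ a b : H, φ a ∣ φ b → a ∣ b
  exists_gcd : ∀ p : P, ∃ X : Finset H, X.Nonempty ∧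
    IsGreatestCommonDivisor (φ '' (X : Set H)) (Multiplicative.ofAdd {p})

/-- The class group `q(F(P)) / q(φ(H))`, written additively. -/
abbrev DivisorClassGroup {H P : Type*} [CommMonoid H] (φ : H →* FreeAbMonoid P) : Type _ :=
  Algebra.GrothendieckAddGroup (Multiset P) ⧸
    AddSubgroup.closure (Set.range fun a : H =>
      Algebra.GrothendieckAddGroup.of (Multiplicative.toAdd (φ a)))

/-- The class `[p]` of a prime divisor `p ∈ P`. -/
def primeClass {H P : Type*} [CommMonoid H] (φ : H →* FreeAbMonoid P) (p : P) :
    DivisorClassGroup φ :=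
  QuotientAddGroup.mk (Algebra.GrothendieckAddGroup.of ({p} : Multiset P))

end DivisorTheory

/-! ### Zero-sum sequences and invariants of finite abelian groups -/

section ZeroSum

variable (G : Type*) [AddCommGroup G]

/-- The monoid `B(G)` of zero-sum sequences over `G`, a submonoid of the free abelian monoid
with basis `G`. -/
def zeroSumMonoid : Submonoid (FreeAbMonoid G) where
  carrier := {S | (Multiplicative.toAdd S).sum = 0}
  one_mem' := by simp
  mul_mem' := by
    intro S T hS hT
    simp only [Set.mem_ofPred_eq, toAdd_mul, Multiset.sum_add] at *
    rw [hS, hT, add_zero]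

/-- The Davenport constant `D(G)`: the supremum of the lengths of the atoms of `B(G)`. -/
noncomputable def davenport : ℕ∞ :=
  ⨆ (U : zeroSumMonoid G) (_ : Irreducible U),
    ((Multiplicative.toAdd (U : FreeAbMonoid G)).card : ℕ∞)

/-- `G ≅ C_{n_1} ⊕ ⋯ ⊕ C_{n_r}` with `1 < n_1 ∣ ⋯ ∣ n_r`. -/
def IsInvariantFactors {r : ℕ} (n : Fin r → ℕ) : Prop :=
  (∀ i, 1 < n i) ∧ (∀ i j, i ≤ j → n i ∣ n j) ∧ Nonempty (G ≃+ ((i : Fin r) → ZMod (n i)))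

/-- The rank `r(G)` of a finite abelian group: the number of its invariant factors `n_1, …, n_r`
(these are uniquely determined by `G`, so that the set below has exactly one element; the trivial
group has rank `0`). -/
noncomputable def rank : ℕ :=
  sInf {r | ∃ n : Fin r → ℕ, IsInvariantFactors G n}

/-- `D*(G) = 1 + ∑ (n_i - 1)` for a finite abelian group with invariant factors `n_1, …, n_r`
(these are uniquely determined by `G`, so that the set below has exactly one element). -/
noncomputable def dStar : ℕ :=
  sInf {d | ∃ (r : ℕ) (n : Fin r → ℕ), IsInvariantFactors G n ∧ d = 1 + ∑ i, (n i - 1)}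

end ZeroSum

end Krull

universe u v

/-! The reduced monoid of `H` is the monoid of sequences of prime divisors whose classes add up to
zero, and B(G) is the case of one prime per class. Both tame degrees thus become statements `TameLE
c N` about sequences over a set `Q` with weights `c : Q → G` (`tameDegree_le_iff`). Below, |S| is
the length of a sequence and D the Davenport constant.

Upper bounds. To bring an atom U into a factorization it suffices to exchange a minimal subfamily Z
whose product contains U (`tameLE_of_isMinCover`). Such a Z has at most |U| members. If W is the
cofactor of U in the product of Z, the cost is at most the maximum of |Z| and one plus the length of
some factorization of W. As W has at most D(D-1) terms, none of value zero, and atoms of such terms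
have length at least two, this gives 1 + D(D-1)/2 (`tameLE_of_card_le`). For C_3, C_4, C_2^2 and
C_2^3 the longest possible W are factored by hand, which lowers the bound to D*.

Lower bounds. Let U consist of x_1, ..., x_k, and cover it by atoms x_j T_j, with T_j a zero-sum
free sequence of terms ±e_i for a basis (e_i). If the product W of the T_j has fewer than n_i terms
-e_i for each i, its only possible atoms are e_i(-e_i) and n_i times e_i. Both have weight one under
the sum of the g_i/n_i, so the length of every factorization of W is the weight of W. An integer
matrix with rows T_j encodes the data (`not_tameLE_of_matrix`). Four rows already force more than
D*, except when G is trivial or one of C_2, C_3, C_4, C_2^2, C_2^3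
(`classification_of_tameLE_dStar`). For C_2^3 the four-row pattern needs a basis class both inside W
and as some x_j, which becomes possible once a nontrivial class has two primes
(`not_tameLE_dStar_of_two_primes`); this separates parts 1 and 2. That D* is reached in the listed
cases is seen from squares of elements of order two, or from the atoms n times e and n times -e
covering e(-e).

Growth. The atom e_1, ..., e_r, -(e_1 + ... + e_r) gives D ≥ r + 1, and an argument with characters
gives D ≤ kr with k depending only on the exponent (`IsAtomOver.card_le_mul`). A matrix with about
r/2 rows and a block of ones gives a tame degree of order r² (`not_tameLE_quadratic`). The general
upper bound supplies the remaining inequalities. -/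

namespace Krull

/-! ### Zero-sum sequences over a weighted set. -/

section ZeroSumModel

variable {Q G : Type*} [AddCommGroup G]

/-- A sequence over `Q` whose values under `c` add up to zero. -/
def ZeroSumOver (c : Q → G) (S : Multiset Q) : Prop := (S.map c).sum = 0

/-- The minimal zero-sum sequences over `Q` with respect to the weight `c`. -/
structure IsAtomOver (c : Q → G) (A : Multiset Q) : Prop where
  ne_zero : A ≠ 0
  zeroSum : ZeroSumOver c A
  minimal : ∀ B ≤ A, ZeroSumOver c B → B = 0 ∨ B = A

open Classical in
/-- The tame degree of the monoid of zero-sum sequences over `Q` is at most `N`. -/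
def TameLE (c : Q → G) (N : ℕ) : Prop :=
  ∀ Z : Multiset (Multiset Q), (∀ A ∈ Z, IsAtomOver c A) → ∀ U, IsAtomOver c U → U ≤ Z.sum →
    ∃ Z' : Multiset (Multiset Q), (∀ A ∈ Z', IsAtomOver c A) ∧ Z'.sum = Z.sum ∧ U ∈ Z' ∧
      (Z - Z').card ≤ N ∧ (Z' - Z).card ≤ N

variable {c : Q → G} {S T A B : Multiset Q}

lemma ZeroSumOver.zero : ZeroSumOver c 0 := by simp [ZeroSumOver]

lemma ZeroSumOver.add (hS : ZeroSumOver c S) (hT : ZeroSumOver c T) : ZeroSumOver c (S + T) := by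
  simp only [ZeroSumOver, Multiset.map_add, Multiset.sum_add] at *
  rw [hS, hT, add_zero]

lemma ZeroSumOver.of_add_left (h : ZeroSumOver c (S + T)) (hS : ZeroSumOver c S) :
    ZeroSumOver c T := by
  simp only [ZeroSumOver, Multiset.map_add, Multiset.sum_add] at *
  rwa [hS, zero_add] at h

lemma ZeroSumOver.sum {Z : Multiset (Multiset Q)} (h : ∀ A ∈ Z, ZeroSumOver c A) :
    ZeroSumOver c Z.sum := by
  induction Z using Multiset.induction with
  | empty => simpa using ZeroSumOver.zero
  | cons A Z ih =>
    rw [Multiset.sum_cons]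
    exact (h A (by simp)).add (ih fun B hB => h B (by simp [hB]))

lemma zeroSumOver_sum_of_atoms {Z : Multiset (Multiset Q)} (h : ∀ A ∈ Z, IsAtomOver c A) :
    ZeroSumOver c Z.sum :=
  ZeroSumOver.sum fun A hA => (h A hA).zeroSum

lemma ZeroSumOver.comp {G' : Type*} [AddCommGroup G'] (f : G →+ G') (h : ZeroSumOver c S) :
    ZeroSumOver (fun q => f (c q)) S := by
  have := congrArg f h
  rw [map_multiset_sum, Multiset.map_map, map_zero] at this
  exact this

lemma zeroSumOver_comp_iff {G' : Type*} [AddCommGroup G'] {f : G →+ G'}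
    (hf : Function.Injective f) : ZeroSumOver (fun q => f (c q)) S ↔ ZeroSumOver c S := by
  refine ⟨fun h => hf ?_, ZeroSumOver.comp f⟩
  rw [map_multiset_sum, Multiset.map_map, map_zero]
  exact h

lemma isAtomOver_comp_iff {G' : Type*} [AddCommGroup G'] {f : G →+ G'}
    (hf : Function.Injective f) : IsAtomOver (fun q => f (c q)) A ↔ IsAtomOver c A :=
  ⟨fun h => ⟨h.1, (zeroSumOver_comp_iff hf).1 h.2, fun B hB h' =>
      h.3 B hB ((zeroSumOver_comp_iff hf).2 h')⟩,
    fun h => ⟨h.1, (zeroSumOver_comp_iff hf).2 h.2, fun B hB h' =>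
      h.3 B hB ((zeroSumOver_comp_iff hf).1 h')⟩⟩

lemma tameLE_comp_iff {G' : Type*} [AddCommGroup G'] {f : G →+ G'}
    (hf : Function.Injective f) {N : ℕ} : TameLE (fun q => f (c q)) N ↔ TameLE c N := by
  simp only [TameLE, isAtomOver_comp_iff hf]

lemma zeroSumOver_map_iff {R : Type*} {ι : R → Q} {S : Multiset R} :
    ZeroSumOver c (S.map ι) ↔ ZeroSumOver (fun r => c (ι r)) S := by
  simp [ZeroSumOver, Multiset.map_map]

lemma exists_le_of_le_map {R : Type*} {f : R → Q} {S : Multiset R} {B : Multiset Q}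
    (h : B ≤ S.map f) : ∃ B' ≤ S, B'.map f = B := by
  obtain ⟨C, hC⟩ := Multiset.le_iff_exists_add.1 h
  clear h
  induction S using Multiset.induction generalizing B C with
  | empty =>
    simp only [Multiset.map_zero] at hC
    have := congrArg Multiset.card hC
    rw [Multiset.card_zero, Multiset.card_add] at this
    exact ⟨0, le_rfl, by rw [Multiset.map_zero, eq_comm, ← Multiset.card_eq_zero]; omega⟩
  | cons a S ih =>
    classical
    rw [Multiset.map_cons] at hC
    have hm : f a ∈ B + C := hC ▸ Multiset.mem_cons_self _ _
    rcases Multiset.mem_add.1 hm with hm | hm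
    · obtain ⟨B₁, rfl⟩ := Multiset.exists_cons_of_mem hm
      rw [Multiset.cons_add, Multiset.cons_inj_right] at hC
      obtain ⟨B', hB', h⟩ := ih C hC
      exact ⟨a ::ₘ B', (Multiset.cons_le_cons_iff a).2 hB', by simp [h]⟩
    · obtain ⟨C₁, rfl⟩ := Multiset.exists_cons_of_mem hm
      rw [Multiset.add_cons, Multiset.cons_inj_right] at hC
      obtain ⟨B', hB', h⟩ := ih C₁ hC
      exact ⟨B', hB'.trans (Multiset.le_cons_self _ _), h⟩

/-- Subsequences of an image lift to subsequences of the source, so being an atom depends only on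
the values. This is how facts about atoms of B(G) reach sequences of prime divisors. -/
lemma isAtomOver_map_iff {R : Type*} {ι : R → Q} {A : Multiset R} :
    IsAtomOver c (A.map ι) ↔ IsAtomOver (fun r => c (ι r)) A := by
  constructor
  · intro h
    refine ⟨fun h0 => h.1 (by simp [h0]), zeroSumOver_map_iff.1 h.2, fun B hB hz => ?_⟩
    rcases h.3 (B.map ι) (Multiset.map_le_map hB) (zeroSumOver_map_iff.2 hz) with h1 | h1
    · exact Or.inl (Multiset.map_eq_zero.1 h1)
    · refine Or.inr (Multiset.eq_of_le_of_card_le hB ?_)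
      simpa using (congrArg Multiset.card h1).ge
  · intro h
    refine ⟨fun h0 => h.1 (Multiset.map_eq_zero.1 h0), zeroSumOver_map_iff.2 h.2, fun B hB hz => ?_⟩
    obtain ⟨B', hB', rfl⟩ := exists_le_of_le_map hB
    rcases h.3 B' hB' (zeroSumOver_map_iff.1 hz) with rfl | rfl <;> simp

/-- Induction on the length: either `S` is itself minimal, or it splits into two shorter zero-sum
pieces, one of which contains `q`. -/
lemma exists_isAtomOver_le (hS : ZeroSumOver c S) {q : Q} (hq : q ∈ S) :
    ∃ A ≤ S, IsAtomOver c A ∧ q ∈ A := by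
  classical
  induction h : S.card using Nat.strong_induction_on generalizing S with
  | _ n ih =>
    by_cases hm : ∀ B ≤ S, ZeroSumOver c B → B = 0 ∨ B = S
    · exact ⟨S, le_rfl, ⟨by rintro rfl; simp at hq, hS, hm⟩, hq⟩
    · push Not at hm
      obtain ⟨B, hB, hz, h0, h1⟩ := hm
      obtain ⟨C, rfl⟩ := Multiset.le_iff_exists_add.1 hB
      have hC : ZeroSumOver c C := hS.of_add_left hz
      have h0' : 0 < B.card := Multiset.card_pos.2 h0
      have h1' : 0 < C.card := Multiset.card_pos.2 (by rintro rfl; simp at h1)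
      rw [Multiset.card_add] at h
      rcases Multiset.mem_add.1 hq with hq | hq
      · obtain ⟨A, hA, h⟩ := ih B.card (by omega) hz hq rfl
        exact ⟨A, hA.trans (Multiset.le_add_right _ _), h⟩
      · obtain ⟨A, hA, h⟩ := ih C.card (by omega) hC hq rfl
        exact ⟨A, hA.trans (Multiset.le_add_left _ _), h⟩

lemma exists_atoms_sum_eq (hS : ZeroSumOver c S) :
    ∃ Z : Multiset (Multiset Q), (∀ A ∈ Z, IsAtomOver c A) ∧ Z.sum = S := by
  classical
  induction h : S.card using Nat.strong_induction_on generalizing S with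
  | _ n ih =>
    rcases S.empty_or_exists_mem with rfl | ⟨q, hq⟩
    · exact ⟨0, by simp, by simp⟩
    obtain ⟨A, hA, hA', hqA⟩ := exists_isAtomOver_le hS hq
    obtain ⟨C, rfl⟩ := Multiset.le_iff_exists_add.1 hA
    have h1 : 0 < A.card := Multiset.card_pos.2 hA'.1
    obtain ⟨Z, hZ, rfl⟩ := ih C.card (by rw [← h, Multiset.card_add]; omega)
      (hS.of_add_left hA'.2) rfl
    refine ⟨A ::ₘ Z, ?_, by simp⟩
    simpa using ⟨hA', hZ⟩

end ZeroSumModel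

/-! ### Translating the tame degree into `TameLE`. -/

section Transfer

variable {M Q G : Type*} [CommMonoid M] [AddCommGroup G]

/-- `θ` identifies the reduced monoid of `M` with the monoid of zero-sum sequences over `Q`. -/
structure IsZeroSumModel (θ : M →* FreeAbMonoid Q) (c : Q → G) : Prop where
  dvd_iff : ∀ a b, a ∣ b ↔ (θ a).toAdd ≤ (θ b).toAdd
  associated_of_eq : ∀ a b, θ a = θ b → Associated a b
  zeroSum_iff : ∀ S, ZeroSumOver c S ↔ ∃ a, (θ a).toAdd = S

/-- The sequence over `Q` attached to an element of the reduced monoid. -/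
def content {θ : M →* FreeAbMonoid Q} {c : Q → G} (h : IsZeroSumModel θ c) (x : Associates M) :
    Multiset Q :=
  Quotient.liftOn x (fun a => (θ a).toAdd) fun a b hab =>
    le_antisymm ((h.dvd_iff a b).1 (Associated.dvd hab)) ((h.dvd_iff b a).1 (Associated.dvd' hab))

variable {θ : M →* FreeAbMonoid Q} {c : Q → G} (h : IsZeroSumModel θ c)

@[simp] lemma content_mk (a : M) : content h (Associates.mk a) = (θ a).toAdd := rfl

lemma content_mul (x y : Associates M) : content h (x * y) = content h x + content h y := by
  induction x using Quotient.inductionOn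
  induction y using Quotient.inductionOn
  simp [Associates.mk_mul_mk]

lemma content_one : content h 1 = 0 := by
  rw [Associates.one_eq_mk_one, content_mk]; simp

lemma zeroSumOver_content (x : Associates M) : ZeroSumOver c (content h x) := by
  induction x using Quotient.inductionOn with
  | _ a => exact (h.zeroSum_iff _).2 ⟨a, rfl⟩

lemma exists_content_eq {S : Multiset Q} (hS : ZeroSumOver c S) : ∃ x, content h x = S := by
  obtain ⟨a, ha⟩ := (h.zeroSum_iff S).1 hS
  exact ⟨Associates.mk a, ha⟩

lemma content_dvd_iff (x y : Associates M) : x ∣ y ↔ content h x ≤ content h y := by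
  induction x using Quotient.inductionOn
  induction y using Quotient.inductionOn
  simp only [Associates.quotient_mk_eq_mk, Associates.mk_dvd_mk, content_mk]
  exact h.dvd_iff _ _

lemma content_injective : Function.Injective (content h) := by
  intro x y hxy
  induction x using Quotient.inductionOn with | _ a
  induction y using Quotient.inductionOn with | _ b
  exact Associates.mk_eq_mk_iff_associated.2
    (h.associated_of_eq a b (Multiplicative.toAdd.injective hxy))

/-- Divisibility is inclusion of contents and every zero-sum sequence is a content, so the divisors
of `x` correspond to the zero-sum subsequences of its content. -/
lemma irreducible_iff_isAtomOver (x : Associates M) :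
    Irreducible x ↔ IsAtomOver c (content h x) := by
  constructor
  · intro hx
    refine ⟨fun h0 => hx.1 ?_, zeroSumOver_content h x, fun B hB hz => ?_⟩
    · rw [← content_one h] at h0
      rw [content_injective h h0]
      exact isUnit_one
    · obtain ⟨y, rfl⟩ := exists_content_eq h hz
      obtain ⟨z, rfl⟩ := (content_dvd_iff h _ _).2 hB
      rcases hx.2 rfl with hu | hu
      · rw [Associates.isUnit_iff_eq_one] at hu
        exact Or.inl (by rw [hu, content_one])
      · rw [Associates.isUnit_iff_eq_one] at hu
        exact Or.inr (by rw [hu, mul_one])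
  · intro hx
    refine ⟨fun hu => hx.1 ?_, fun {y z} hyz => ?_⟩
    · rw [Associates.isUnit_iff_eq_one] at hu
      rw [hu, content_one]
    · subst hyz
      rcases hx.3 _ ((content_dvd_iff h _ _).1 (Dvd.intro _ rfl)) (zeroSumOver_content h y)
        with h0 | h0
      · left
        rw [← content_one h] at h0
        rw [content_injective h h0]
        exact isUnit_one
      · right
        rw [content_mul, left_eq_add, ← content_one h] at h0
        rw [content_injective h h0]
        exact isUnit_one

/-- The sequence of atoms over `Q` attached to a factorization. -/
def contents (z : Multiset (RedAtom M)) : Multiset (Multiset Q) :=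
  z.map fun u => content h u.1

lemma contents_isAtomOver (z : Multiset (RedAtom M)) : ∀ A ∈ contents h z, IsAtomOver c A := by
  intro A hA
  obtain ⟨u, -, rfl⟩ := Multiset.mem_map.1 hA
  exact (irreducible_iff_isAtomOver h u.1).1 u.2

lemma content_prod (z : Multiset (RedAtom M)) :
    content h (z.map Subtype.val).prod = (contents h z).sum := by
  induction z using Multiset.induction with
  | empty => simp [contents, content_one]
  | cons u z ih => simp [contents, content_mul] at *; exact ih

lemma mem_factorizations_iff {a : M} {z : Multiset (RedAtom M)} :
    z ∈ factorizations a ↔ (contents h z).sum = (θ a).toAdd := by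
  rw [← content_prod, ← content_mk h, (content_injective h).eq_iff]
  rfl

lemma exists_contents_eq {Z : Multiset (Multiset Q)} (hZ : ∀ A ∈ Z, IsAtomOver c A) :
    ∃ z, contents h z = Z := by
  induction Z using Multiset.induction with
  | empty => exact ⟨0, rfl⟩
  | cons A Z ih =>
    obtain ⟨z, rfl⟩ := ih fun B hB => hZ B (by simp [hB])
    have hA := hZ A (by simp)
    obtain ⟨x, rfl⟩ := exists_content_eq h hA.2
    exact ⟨⟨x, (irreducible_iff_isAtomOver h x).2 hA⟩ ::ₘ z, by simp [contents]⟩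

lemma contentAtom_injective :
    Function.Injective fun u : RedAtom M => content h u.1 :=
  (content_injective h).comp Subtype.val_injective

open Classical in
lemma card_contents_sub (z z' : Multiset (RedAtom M)) :
    (contents h z - contents h z').card = (z - z').card := by
  have : contents h (z - z') = contents h z - contents h z' := by
    ext A
    rw [Multiset.count_sub]
    by_cases hA : ∃ u : RedAtom M, content h u.1 = A
    · obtain ⟨u, rfl⟩ := hA
      have hinj := contentAtom_injective h
      have key (w : Multiset (RedAtom M)) :
          Multiset.count (content h u.1) (contents h w) = Multiset.count u w :=
        Multiset.count_map_eq_count' (fun u : RedAtom M => content h u.1) w hinj u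
      rw [key, key, key, Multiset.count_sub]
    · have key (w : Multiset (RedAtom M)) : Multiset.count A (contents h w) = 0 := by
        rw [Multiset.count_eq_zero]
        intro hm
        obtain ⟨u, -, hu⟩ := Multiset.mem_map.1 hm
        exact hA ⟨u, hu⟩
      rw [key, key, key]
  rw [← this, contents, Multiset.card_map]

open Classical in
lemma factorizationDist_le_iff (z z' : Multiset (RedAtom M)) (N : ℕ) :
    factorizationDist z z' ≤ N ↔ (contents h z - contents h z').card ≤ N ∧
      (contents h z' - contents h z).card ≤ N := by
  rw [factorizationDist, max_le_iff, card_contents_sub, card_contents_sub]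
  have key (s t : Multiset (RedAtom M)) : s - s ∩ t = s - t := by
    ext u
    simp only [Multiset.count_sub, Multiset.count_inter]
    omega
  rw [key, Multiset.inter_comm, key]

lemma tameDegreeAt_le_iff (a : M) (x : Multiset (RedAtom M)) (N : ℕ∞) :
    tameDegreeAt a x ≤ N ↔ ((∃ y ∈ factorizations a, x ≤ y) → ∀ z ∈ factorizations a,
      ∃ z' ∈ factorizations a, x ≤ z' ∧ (factorizationDist z z' : ℕ∞) ≤ N) := by
  constructor
  · intro hN
    have hmem : tameDegreeAt a x ∈ {N : ℕ∞ | (∃ y ∈ factorizations a, x ≤ y) →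
        ∀ z ∈ factorizations a, ∃ z' ∈ factorizations a, x ≤ z' ∧
          (factorizationDist z z' : ℕ∞) ≤ N} := by
      -- The order on `ℕ∞` is a well-order, so the infimum is attained once the set is non-empty;
      -- `⊤` always belongs to it.
      refine csInf_mem ⟨⊤, ?_⟩
      rintro ⟨y, hy, hxy⟩ z -
      exact ⟨y, hy, hxy, le_top⟩
    intro hy z hz
    obtain ⟨z', hz', hx, hd⟩ := hmem hy z hz
    exact ⟨z', hz', hx, hd.trans hN⟩
  · intro hN
    exact csInf_le (OrderBot.bddBelow _) hN

-- Factorizations correspond to families of atoms over `Q`, with distances preserved. The condition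
-- that `a` has a factorization containing `u` turns into inclusion of the content of `u` in the
-- sum, because the cofactor is again zero-sum and hence factors.
include h in
theorem tameDegree_le_iff (N : ℕ) : tameDegree M ≤ N ↔ TameLE c N := by
  classical
  simp only [tameDegree, iSup_le_iff, tameDegreeAt_le_iff, Nat.cast_le,
    factorizationDist_le_iff h]
  constructor
  · intro H Z hZ U hU hUZ
    obtain ⟨z, rfl⟩ := exists_contents_eq h hZ
    obtain ⟨x, rfl⟩ := exists_content_eq h hU.2
    obtain ⟨a, ha⟩ := (h.zeroSum_iff _).1 (zeroSumOver_sum_of_atoms hZ)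
    let u : RedAtom M := ⟨x, (irreducible_iff_isAtomOver h x).2 hU⟩
    obtain ⟨R, hR⟩ := Multiset.le_iff_exists_add.1 hUZ
    have hRz : ZeroSumOver c R := by
      refine ZeroSumOver.of_add_left (S := content h x) ?_ hU.2
      rw [← hR]
      exact zeroSumOver_sum_of_atoms hZ
    obtain ⟨Y, hY, hYR⟩ := exists_atoms_sum_eq hRz
    obtain ⟨y, rfl⟩ := exists_contents_eq h hY
    have hy : u ::ₘ y ∈ factorizations a := by
      rw [mem_factorizations_iff h, ha, hR, ← hYR]
      simp [contents, u]
    obtain ⟨z', hz', huz, hd⟩ := H u a ⟨u ::ₘ y, hy, by simp⟩ z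
      ((mem_factorizations_iff h).2 ha.symm)
    refine ⟨contents h z', contents_isAtomOver h z', ?_, ?_, hd⟩
    · rw [(mem_factorizations_iff h).1 hz', ha]
    · exact Multiset.mem_map.2 ⟨u, by simpa using huz, rfl⟩
  · rintro H u a ⟨y, hy, huy⟩ z hz
    rw [mem_factorizations_iff h] at hy hz
    obtain ⟨Z', hZ', hs, hu, hd⟩ := H (contents h z) (contents_isAtomOver h z) (content h u.1)
      ((irreducible_iff_isAtomOver h u.1).1 u.2) (by
        rw [hz, ← hy]
        refine Multiset.single_le_sum (fun _ _ => Multiset.zero_le _) _ ?_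
        exact Multiset.mem_map.2 ⟨u, by simpa using huy, rfl⟩)
    obtain ⟨z', rfl⟩ := exists_contents_eq h hZ'
    refine ⟨z', (mem_factorizations_iff h).2 (hs.trans hz), ?_, hd⟩
    obtain ⟨v, hv, hvu⟩ := Multiset.mem_map.1 hu
    rw [contentAtom_injective h hvu] at hv
    simpa using hv

end Transfer

/-! ### B(G) and Krull monoids as monoids of zero-sum sequences. -/

section Models

/-- The zero-sum sequences over `G`, with their terms mapped along an isomorphism. -/
def zeroSumEmbedding {G K : Type*} [AddCommGroup G] [AddCommGroup K] (e : G ≃+ K) :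
    zeroSumMonoid G →* FreeAbMonoid K :=
  (AddMonoidHom.toMultiplicative (Multiset.mapAddMonoidHom e)).comp (zeroSumMonoid G).subtype

lemma toAdd_zeroSumEmbedding {G K : Type*} [AddCommGroup G] [AddCommGroup K] (e : G ≃+ K)
    (a : zeroSumMonoid G) :
    (zeroSumEmbedding e a).toAdd = (a : FreeAbMonoid G).toAdd.map e := rfl

lemma isZeroSumModel_zeroSumEmbedding {G K : Type*} [AddCommGroup G] [AddCommGroup K]
    (e : G ≃+ K) : IsZeroSumModel (zeroSumEmbedding e) (id : K → K) where
  dvd_iff a b := by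
    rw [toAdd_zeroSumEmbedding, toAdd_zeroSumEmbedding, Multiset.map_le_map_iff e.injective]
    constructor
    · rintro ⟨d, rfl⟩
      simp
    · intro hab
      obtain ⟨R, hR⟩ := Multiset.le_iff_exists_add.1 hab
      have ha : ((a : FreeAbMonoid G).toAdd).sum = 0 := a.2
      have hb : ((b : FreeAbMonoid G).toAdd).sum = 0 := b.2
      refine ⟨⟨Multiplicative.ofAdd R, ?_⟩, Subtype.ext (Multiplicative.toAdd.injective hR)⟩
      have := congrArg Multiset.sum hR
      simp only [Multiset.sum_add, ha, hb, zero_add] at this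
      exact this.symm
  associated_of_eq a b hab := by
    have h : a = b := Subtype.ext (Multiplicative.toAdd.injective
      (Multiset.map_injective e.injective (congrArg Multiplicative.toAdd hab)))
    exact h ▸ Associated.refl a
  zeroSum_iff S := by
    simp only [ZeroSumOver, Multiset.map_id, toAdd_zeroSumEmbedding]
    constructor
    · intro hS
      refine ⟨⟨Multiplicative.ofAdd (S.map e.symm), ?_⟩, ?_⟩
      · change (S.map e.symm).sum = 0
        rw [← map_multiset_sum, hS, map_zero]
      · change (S.map e.symm).map e = S
        simp
    · rintro ⟨a, rfl⟩
      have ha : ((a : FreeAbMonoid G).toAdd).sum = 0 := a.2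
      rw [← map_multiset_sum, ha, map_zero]

lemma mk_of_eq_sum {H P : Type*} [CommMonoid H] (φ : H →* FreeAbMonoid P) (S : Multiset P) :
    (QuotientAddGroup.mk (Algebra.GrothendieckAddGroup.of S) : DivisorClassGroup φ) =
      (S.map (primeClass φ)).sum := by
  induction S using Multiset.induction with
  | empty => simp
  | cons p S ih =>
    rw [← Multiset.singleton_add, map_add, QuotientAddGroup.mk_add, ih]
    simp [primeClass]

/-- If `S` has trivial class, then `S + φ a = φ b` for some `a`, `b`. Hence `φ a` divides `φ b`, so
`b = a * d`, and cancellation gives `S = φ d`. -/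
lemma IsDivisorTheory.isZeroSumModel {H P : Type*} [CancelCommMonoid H] {φ : H →* FreeAbMonoid P}
    (hφ : IsDivisorTheory φ) : IsZeroSumModel φ (primeClass φ) where
  dvd_iff a b := by
    constructor
    · rintro ⟨d, rfl⟩
      simp
    · intro hab
      obtain ⟨R, hR⟩ := Multiset.le_iff_exists_add.1 hab
      exact hφ.dvd_of_map_dvd a b ⟨Multiplicative.ofAdd R, Multiplicative.toAdd.injective hR⟩
  associated_of_eq a b hab := by
    obtain ⟨d, rfl⟩ := hφ.dvd_of_map_dvd a b hab.dvd
    obtain ⟨e, he⟩ := hφ.dvd_of_map_dvd (a * d) a hab.symm.dvd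
    rw [mul_assoc, left_eq_mul] at he
    exact ⟨⟨d, e, he, by rwa [mul_comm]⟩, rfl⟩
  zeroSum_iff S := by
    rw [ZeroSumOver, ← mk_of_eq_sum]
    constructor
    · intro hS
      rw [QuotientAddGroup.eq_zero_iff] at hS
      -- The image of `φ` is closed under products, so the subgroup it generates consists of
      -- differences of two images.
      have key : ∀ x ∈ AddSubgroup.closure (Set.range fun a : H =>
          Algebra.GrothendieckAddGroup.of (Multiplicative.toAdd (φ a))), ∃ a b : H,
          x + Algebra.GrothendieckAddGroup.of (φ a).toAdd =
            Algebra.GrothendieckAddGroup.of (φ b).toAdd := by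
        intro x hx
        induction hx using AddSubgroup.closure_induction with
        | mem x hx =>
          obtain ⟨b, rfl⟩ := hx
          exact ⟨1, b, by simp⟩
        | zero => exact ⟨1, 1, by simp⟩
        | add x y _ _ hx hy =>
          obtain ⟨a, b, h1⟩ := hx
          obtain ⟨a', b', h2⟩ := hy
          refine ⟨a * a', b * b', ?_⟩
          rw [map_mul φ, map_mul φ, toAdd_mul, toAdd_mul, map_add, map_add, ← h1, ← h2]
          abel
        | neg x _ hx =>
          obtain ⟨a, b, h1⟩ := hx
          exact ⟨b, a, by rw [← h1]; abel⟩
      obtain ⟨a, b, hab⟩ := key _ hS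
      rw [← map_add] at hab
      have hab' : S + (φ a).toAdd = (φ b).toAdd :=
        Algebra.GrothendieckAddGroup.of_injective hab
      obtain ⟨d, rfl⟩ := hφ.dvd_of_map_dvd a b ⟨Multiplicative.ofAdd S, by
        apply Multiplicative.toAdd.injective
        rw [← hab', toAdd_mul, add_comm]; rfl⟩
      refine ⟨d, ?_⟩
      rw [map_mul, toAdd_mul, add_comm] at hab'
      exact (add_left_cancel hab').symm
    · rintro ⟨a, rfl⟩
      rw [QuotientAddGroup.eq_zero_iff]
      exact AddSubgroup.subset_closure ⟨a, rfl⟩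

end Models

end Krull

namespace Krull

/-! ### Minimal covers and upper bounds. -/

section Covers

variable {Q G : Type*} [AddCommGroup G] {c : Q → G}

lemma IsAtomOver.eq_singleton {A : Multiset Q} (hA : IsAtomOver c A) {q : Q} (hq : q ∈ A)
    (h0 : c q = 0) : A = {q} := by
  rcases hA.3 {q} (Multiset.singleton_le.2 hq) (by simpa [ZeroSumOver] using h0) with h | h
  · simp at h
  · exact h.symm

lemma IsAtomOver.eq_of_le {A B : Multiset Q} (hA : IsAtomOver c A) (hB : IsAtomOver c B)
    (h : A ≤ B) : A = B :=
  (hB.3 A h hA.2).resolve_left hA.1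

lemma IsAtomOver.two_le_card {A : Multiset Q} (hA : IsAtomOver c A) (h0 : ∀ q ∈ A, c q ≠ 0) :
    2 ≤ A.card := by
  by_contra hlt
  rcases Nat.lt_or_ge A.card 1 with h | h
  · exact hA.1 (Multiset.card_eq_zero.1 (by omega))
  · obtain ⟨q, rfl⟩ := Multiset.card_eq_one.1 (show A.card = 1 by omega)
    exact h0 q (by simp) (by simpa [ZeroSumOver] using hA.2)

lemma mem_sum_iff {Z : Multiset (Multiset Q)} {q : Q} : q ∈ Z.sum ↔ ∃ A ∈ Z, q ∈ A :=
  Multiset.mem_join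

lemma two_mul_card_le_card_sum {Y : Multiset (Multiset Q)} (hY : ∀ A ∈ Y, IsAtomOver c A)
    (h0 : ∀ q ∈ Y.sum, c q ≠ 0) : 2 * Y.card ≤ Y.sum.card := by
  induction Y using Multiset.induction with
  | empty => simp
  | cons A Y ih =>
    have h1 := ih (fun B hB => hY B (by simp [hB])) (fun q hq => h0 q (by simp [hq]))
    have h2 := (hY A (by simp)).two_le_card (fun q hq => h0 q (by simp [hq]))
    simp only [Multiset.card_cons, Multiset.sum_cons, Multiset.card_add]
    omega

/-- `S` is a sum of at most `k` minimal zero-sum sequences. -/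
def HasShortFact (c : Q → G) (S : Multiset Q) (k : ℕ) : Prop :=
  ∃ Y : Multiset (Multiset Q), (∀ A ∈ Y, IsAtomOver c A) ∧ Y.sum = S ∧ Y.card ≤ k

lemma HasShortFact.mono {S : Multiset Q} {k l : ℕ} (h : HasShortFact c S k) (hkl : k ≤ l) :
    HasShortFact c S l := by
  obtain ⟨Y, h1, h2, h3⟩ := h
  exact ⟨Y, h1, h2, h3.trans hkl⟩

lemma HasShortFact.add {S T : Multiset Q} {k l : ℕ} (hS : HasShortFact c S k)
    (hT : HasShortFact c T l) : HasShortFact c (S + T) (k + l) := by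
  obtain ⟨Y, h1, h2, h3⟩ := hS
  obtain ⟨Y', h1', h2', h3'⟩ := hT
  refine ⟨Y + Y', fun A hA => ?_, by simp [h2, h2'], by rw [Multiset.card_add]; omega⟩
  rcases Multiset.mem_add.1 hA with hA | hA
  exacts [h1 A hA, h1' A hA]

lemma IsAtomOver.hasShortFact {A : Multiset Q} (hA : IsAtomOver c A) : HasShortFact c A 1 :=
  ⟨{A}, by simpa using hA, by simp, by simp⟩

lemma hasShortFact_zero : HasShortFact c (0 : Multiset Q) 0 := ⟨0, by simp, by simp, by simp⟩

lemma hasShortFact_half {S : Multiset Q} (hS : ZeroSumOver c S) (h0 : ∀ q ∈ S, c q ≠ 0) :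
    HasShortFact c S (S.card / 2) := by
  obtain ⟨Y, hY, rfl⟩ := exists_atoms_sum_eq hS
  have := two_mul_card_le_card_sum hY h0
  exact ⟨Y, hY, rfl, by omega⟩

/-- A factorization of the sequence of values is lifted one atom at a time, choosing preimages
inside what is left of `S`. -/
lemma HasShortFact.of_map {S : Multiset Q} {k : ℕ} (h : HasShortFact (id : G → G) (S.map c) k) :
    HasShortFact c S k := by
  obtain ⟨Y, hY, hs, hk⟩ := h
  induction Y using Multiset.induction generalizing S k with
  | empty =>
    simp only [Multiset.sum_zero] at hs
    rw [Multiset.map_eq_zero.1 hs.symm]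
    exact hasShortFact_zero.mono (Nat.zero_le k)
  | cons A Y ih =>
    rw [Multiset.sum_cons] at hs
    obtain ⟨A', hA', rfl⟩ := exists_le_of_le_map (hs ▸ Multiset.le_add_right A Y.sum)
    obtain ⟨T, rfl⟩ := Multiset.le_iff_exists_add.1 hA'
    rw [Multiset.map_add, add_right_inj] at hs
    rw [Multiset.card_cons] at hk
    have hT : HasShortFact c T Y.card := ih (fun B hB => hY B (by simp [hB])) hs le_rfl
    have hA : IsAtomOver c A' := (isAtomOver_map_iff (c := id) (ι := c)).1 (hY _ (Multiset.mem_cons_self _ _))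
    exact (hA.hasShortFact.add hT).mono (by omega)

/-- Replace `Z₀` by `U ::ₘ Y` and keep the rest of `Z`; the common rest cancels in both differences.
-/
lemma exists_exchange [DecidableEq Q] {Z Z₀ Y : Multiset (Multiset Q)} {U : Multiset Q} {N : ℕ}
    (hZ : ∀ A ∈ Z, IsAtomOver c A) (hZ₀ : Z₀ ≤ Z) (hU : IsAtomOver c U)
    (hY : ∀ A ∈ Y, IsAtomOver c A) (hs : U + Y.sum = Z₀.sum) (h1 : Z₀.card ≤ N)
    (h2 : Y.card + 1 ≤ N) :
    ∃ Z' : Multiset (Multiset Q), (∀ A ∈ Z', IsAtomOver c A) ∧ Z'.sum = Z.sum ∧ U ∈ Z' ∧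
      (Z - Z').card ≤ N ∧ (Z' - Z).card ≤ N := by
  obtain ⟨R, rfl⟩ := Multiset.le_iff_exists_add.1 hZ₀
  refine ⟨(U ::ₘ Y) + R, ?_, ?_, by simp, ?_, ?_⟩
  · intro A hA
    rcases Multiset.mem_add.1 hA with hA | hA
    · rcases Multiset.mem_cons.1 hA with rfl | hA
      exacts [hU, hY A hA]
    · exact hZ A (by simp [hA])
  · simp only [Multiset.sum_add, Multiset.sum_cons, hs]
  · rw [add_tsub_add_eq_tsub_right]
    exact (Multiset.card_le_card tsub_le_self).trans h1
  · rw [add_tsub_add_eq_tsub_right]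
    exact (Multiset.card_le_card tsub_le_self).trans (by simpa using h2)

/-- Run through `Z`, keeping only members that meet the part of `U` not yet covered. Each one kept
removes at least one term of it. -/
lemma exists_cover [DecidableEq Q] (Z : Multiset (Multiset Q)) (U : Multiset Q)
    (h : U ≤ Z.sum) : ∃ Z₀ ≤ Z, U ≤ Z₀.sum ∧ Z₀.card ≤ U.card := by
  induction Z using Multiset.induction generalizing U with
  | empty => exact ⟨0, le_rfl, h, by simp⟩
  | cons A Z ih =>
    rw [Multiset.sum_cons] at h
    by_cases hA : U ∩ A = 0
    · have hU : U ≤ Z.sum := by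
        rw [Multiset.le_iff_count] at h ⊢
        intro q
        have h1 := h q
        have h2 := congrArg (Multiset.count q) hA
        rw [Multiset.count_add] at h1
        rw [Multiset.count_inter, Multiset.count_zero] at h2
        omega
      obtain ⟨Z₀, h1, h2, h3⟩ := ih U hU
      exact ⟨Z₀, h1.trans (Multiset.le_cons_self _ _), h2, h3⟩
    · obtain ⟨Z₀, h1, h2, h3⟩ := ih (U - A) (tsub_le_iff_left.2 h)
      refine ⟨A ::ₘ Z₀, (Multiset.cons_le_cons_iff A).2 h1, ?_, ?_⟩
      · rw [Multiset.sum_cons]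
        exact tsub_le_iff_left.1 h2
      · have h4 := congrArg Multiset.card (Multiset.sub_add_inter U A)
        have h5 := Multiset.card_pos.2 hA
        rw [Multiset.card_add] at h4
        rw [Multiset.card_cons]
        omega

/-- An atom `U` together with a minimal family of atoms, different from `U` and without terms of
value zero, whose sum contains `U`. -/
structure IsMinCover (c : Q → G) (Z : Multiset (Multiset Q)) (U : Multiset Q) : Prop where
  atoms : ∀ A ∈ Z, IsAtomOver c A
  atom : IsAtomOver c U
  le_sum : U ≤ Z.sum
  minimal : ∀ Z₁ ≤ Z, U ≤ Z₁.sum → Z₁ = Z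
  notMem : U ∉ Z
  ne_zero : ∀ A ∈ Z, ∀ q ∈ A, c q ≠ 0
  ne_zero' : ∀ q ∈ U, c q ≠ 0

namespace IsMinCover

variable {Z : Multiset (Multiset Q)} {U : Multiset Q}

lemma card_le (h : IsMinCover c Z U) : Z.card ≤ U.card := by
  classical
  obtain ⟨Z₀, h1, h2, h3⟩ := exists_cover Z U h.le_sum
  rwa [h.minimal Z₀ h1 h2] at h3

/-- A member that covers two terms of `U` leaves at most `U.card - 2` terms for the other members.
-/
lemma card_lt [DecidableEq Q] (h : IsMinCover c Z U) {A : Multiset Q} (hA : A ∈ Z)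
    (h2 : 2 ≤ (U ∩ A).card) : Z.card + 1 ≤ U.card := by
  obtain ⟨Z₁, rfl⟩ := Multiset.exists_cons_of_mem hA
  have hle := h.le_sum
  rw [Multiset.sum_cons] at hle
  obtain ⟨Z₀, h3, h4, h5⟩ := exists_cover Z₁ (U - A) (tsub_le_iff_left.2 hle)
  have h6 := h.minimal (A ::ₘ Z₀) ((Multiset.cons_le_cons_iff A).2 h3) (by
    rw [Multiset.sum_cons]
    exact tsub_le_iff_left.1 h4)
  have h7 := congrArg Multiset.card (Multiset.sub_add_inter U A)
  rw [Multiset.card_add] at h7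
  rw [← h6, Multiset.card_cons]
  omega

lemma two_le_card (h : IsMinCover c Z U) : 2 ≤ Z.card := by
  by_contra hlt
  rcases Nat.lt_or_ge Z.card 1 with h1 | h1
  · have : Z = 0 := Multiset.card_eq_zero.1 (by omega)
    have h2 := h.le_sum
    rw [this, Multiset.sum_zero] at h2
    exact h.atom.1 (Multiset.le_zero.1 h2)
  · obtain ⟨A, rfl⟩ := Multiset.card_eq_one.1 (show Z.card = 1 by omega)
    have h2 := h.le_sum
    rw [Multiset.sum_singleton] at h2
    exact h.notMem (by rw [h.atom.eq_of_le (h.atoms A (by simp)) h2]; simp)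

lemma exists_mem (h : IsMinCover c Z U) {A : Multiset Q} (hA : A ∈ Z) : ∃ q ∈ A, q ∈ U := by
  classical
  by_contra! hdis
  obtain ⟨Z₁, rfl⟩ := Multiset.exists_cons_of_mem hA
  have hle := h.le_sum
  rw [Multiset.sum_cons] at hle
  have := h.minimal Z₁ (Multiset.le_cons_self _ _) (by
    rw [Multiset.le_iff_count] at hle ⊢
    intro q
    have h1 := hle q
    by_cases hq : q ∈ A
    · simp [Multiset.count_eq_zero_of_notMem (hdis q hq)]
    · rwa [Multiset.count_add, Multiset.count_eq_zero_of_notMem hq, zero_add] at h1)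
  simpa using congrArg Multiset.card this

lemma sum_ne_zero (h : IsMinCover c Z U) : ∀ q ∈ Z.sum, c q ≠ 0 := by
  intro q hq
  obtain ⟨A, hA, hqA⟩ := mem_sum_iff.1 hq
  exact h.ne_zero A hA q hqA

lemma exists_rest (h : IsMinCover c Z U) : ∃ W, Z.sum = U + W ∧ ZeroSumOver c W ∧
    ∀ q ∈ W, c q ≠ 0 := by
  obtain ⟨W, hW⟩ := Multiset.le_iff_exists_add.1 h.le_sum
  refine ⟨W, hW, ZeroSumOver.of_add_left (S := U) ?_ h.atom.2, fun q hq => ?_⟩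
  · rw [← hW]
    exact zeroSumOver_sum_of_atoms h.atoms
  · exact h.sum_ne_zero q (by rw [hW]; simp [hq])

end IsMinCover

lemma card_sum_le {Z : Multiset (Multiset Q)} {D : ℕ} (h : ∀ A ∈ Z, A.card ≤ D) :
    Z.sum.card ≤ Z.card * D := by
  induction Z using Multiset.induction with
  | empty => simp
  | cons A Z ih =>
    have := ih fun B hB => h B (by simp [hB])
    have := h A (by simp)
    rw [Multiset.sum_cons, Multiset.card_add, Multiset.card_cons, add_mul]
    omega

open Classical in
/-- To bound the tame degree it suffices to treat minimal covers. -/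
theorem tameLE_of_isMinCover {N : ℕ}
    (H : ∀ Z U, IsMinCover c Z U → (∃ Z' : Multiset (Multiset Q), (∀ A ∈ Z', IsAtomOver c A) ∧
      Z'.sum = Z.sum ∧ U ∈ Z' ∧ (Z - Z').card ≤ N ∧ (Z' - Z).card ≤ N)) : TameLE c N := by
  intro Z hZ U hU hUZ
  by_cases hmem : U ∈ Z
  · exact ⟨Z, hZ, rfl, hmem, by simp, by simp⟩
  have hU0 : ∀ q ∈ U, c q ≠ 0 := by
    intro q hq h0
    obtain rfl := hU.eq_singleton hq h0
    obtain ⟨A, hA, hqA⟩ := mem_sum_iff.1 (Multiset.mem_of_le hUZ hq)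
    exact hmem ((hZ A hA).eq_singleton hqA h0 ▸ hA)
  obtain ⟨Z₀, hZ₀, hmin⟩ : ∃ Z₀, (Z₀ ≤ Z ∧ U ≤ Z₀.sum) ∧
      ∀ Z₁, Z₁ ≤ Z ∧ U ≤ Z₁.sum → Z₀.card ≤ Z₁.card := by
    have hne : {Z₁ : Multiset (Multiset Q) | Z₁ ≤ Z ∧ U ≤ Z₁.sum}.Nonempty := ⟨Z, le_rfl, hUZ⟩
    exact ⟨_, Function.argminOn_mem Multiset.card _ hne,
      fun Z₁ h => Function.argminOn_le Multiset.card _ h⟩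
  have hmin' : ∀ Z₁ ≤ Z₀, U ≤ Z₁.sum → Z₁ = Z₀ := fun Z₁ h1 h2 =>
    Multiset.eq_of_le_of_card_le h1 (hmin Z₁ ⟨h1.trans hZ₀.1, h2⟩)
  have hat : ∀ A ∈ Z₀, IsAtomOver c A := fun A hA => hZ A (Multiset.mem_of_le hZ₀.1 hA)
  have hcov : IsMinCover c Z₀ U := by
    refine ⟨hat, hU, hZ₀.2, hmin', fun h => hmem (Multiset.mem_of_le hZ₀.1 h), ?_, hU0⟩
    intro A hA q hq h0
    obtain rfl := (hat A hA).eq_singleton hq h0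
    -- A member consisting of a term of value zero is disjoint from `U`, so it could be dropped from
    -- the cover.
    obtain ⟨Z₁, rfl⟩ := Multiset.exists_cons_of_mem hA
    have h1 := hmin' Z₁ (Multiset.le_cons_self _ _) (by
      have h2 := hZ₀.2
      rw [Multiset.sum_cons, Multiset.singleton_add] at h2
      exact (Multiset.le_cons_of_notMem fun hqU => hU0 q hqU h0).1 h2)
    simpa using congrArg Multiset.card h1
  obtain ⟨Z', h1, h2, h3, h4, h5⟩ := H Z₀ U hcov
  obtain ⟨R, rfl⟩ := Multiset.le_iff_exists_add.1 hZ₀.1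
  refine ⟨Z' + R, ?_, by simp [h2], by simp [h3], ?_, ?_⟩
  · intro A hA
    rcases Multiset.mem_add.1 hA with hA | hA
    exacts [h1 A hA, hZ A (by simp [hA])]
  · rwa [add_tsub_add_eq_tsub_right]
  · rwa [add_tsub_add_eq_tsub_right]

/-- The new factorization is `U` followed by the atoms of `W`, which accounts for the `+ 1`. -/
theorem tameLE_of_hasShortFact {N : ℕ} (H : ∀ Z U W, IsMinCover c Z U → Z.sum = U + W →
    ZeroSumOver c W → (∀ q ∈ W, c q ≠ 0) → Z.card ≤ N + 1 ∧ HasShortFact c W N) :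
    TameLE c (N + 1) := by
  classical
  refine tameLE_of_isMinCover fun Z U h => ?_
  obtain ⟨W, hW, hW0, hW1⟩ := h.exists_rest
  obtain ⟨hc, Y, hY, rfl, hYN⟩ := H Z U W h hW hW0 hW1
  exact exists_exchange h.atoms le_rfl h.atom hY hW.symm hc (by omega)

/-- The general upper bound for the tame degree in terms of the maximal length of an atom. -/
theorem tameLE_of_card_le {D : ℕ} (hD : ∀ A, IsAtomOver c A → A.card ≤ D) :
    TameLE c (1 + D * (D - 1) / 2) := by
  rw [add_comm]
  refine tameLE_of_hasShortFact fun Z U W h hs h0 h1 => ?_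
  have h2 := h.card_le
  have h3 := h.two_le_card
  have h4 := hD U h.atom
  have h5 := card_sum_le fun A hA => hD A (h.atoms A hA)
  rw [hs, Multiset.card_add] at h5
  obtain ⟨E, rfl⟩ : ∃ E, D = E + 1 := ⟨D - 1, by omega⟩
  -- With `E = D - 1` the sum has at most `U.card * (E + 1)` terms; removing `U` leaves at most
  -- `U.card * E ≤ D * (D - 1)` for `W`.
  have h6 : Z.card * (E + 1) ≤ U.card * (E + 1) := Nat.mul_le_mul_right _ h2
  have h7 : U.card * E ≤ (E + 1) * E := Nat.mul_le_mul_right _ h4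
  rw [add_tsub_cancel_right]
  refine ⟨?_, (hasShortFact_half h0 h1).mono (Nat.div_le_div_right (by linarith))⟩
  have h8 : 2 * E ≤ (E + 1) * E := by nlinarith
  omega

end Covers

end Krull

namespace Krull

/-! ### Lower bounds from covers with a long cofactor. -/

section Rows

variable {Q G : Type*} [AddCommGroup G] {c : Q → G}

lemma eq_zero_of_no_atoms {T B : Multiset Q} (hT : ∀ A ≤ T, ¬ IsAtomOver c A) (hB : B ≤ T)
    (h0 : ZeroSumOver c B) : B = 0 := by
  by_contra hne
  obtain ⟨q, hq⟩ := Multiset.exists_mem_of_ne_zero hne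
  obtain ⟨A, hA, hA', -⟩ := exists_isAtomOver_le h0 hq
  exact hT A (hA.trans hB) hA'

/-- Of a zero-sum subsequence and its complement, one avoids `x`; it lies in the zero-sum free `T`
and is therefore empty. -/
lemma isAtomOver_cons {T : Multiset Q} {x : Q} (hT : ∀ A ≤ T, ¬ IsAtomOver c A)
    (hx : ZeroSumOver c (x ::ₘ T)) : IsAtomOver c (x ::ₘ T) := by
  refine ⟨Multiset.cons_ne_zero, hx, fun B hB h0 => ?_⟩
  obtain ⟨R, hR⟩ := Multiset.le_iff_exists_add.1 hB
  have hm : x ∈ B + R := hR ▸ Multiset.mem_cons_self x T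
  rcases Multiset.mem_add.1 hm with hm | hm
  · obtain ⟨B, rfl⟩ := Multiset.exists_cons_of_mem hm
    rw [hR] at hx
    rw [Multiset.cons_add, Multiset.cons_inj_right] at hR
    have : R = 0 := eq_zero_of_no_atoms hT (hR ▸ Multiset.le_add_left _ _) (hx.of_add_left h0)
    exact Or.inr (by rw [hR, this, add_zero])
  · obtain ⟨R, rfl⟩ := Multiset.exists_cons_of_mem hm
    rw [Multiset.add_cons, Multiset.cons_inj_right] at hR
    exact Or.inl (eq_zero_of_no_atoms hT (hR ▸ Multiset.le_add_right _ _) h0)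

lemma sum_map_le_card (w : Q → ℚ) {Y : Multiset (Multiset Q)}
    (hY : ∀ A ∈ Y, (A.map w).sum ≤ 1) : (Y.sum.map w).sum ≤ Y.card := by
  induction Y using Multiset.induction with
  | empty => simp
  | cons A Y ih =>
    have h1 := ih fun B hB => hY B (by simp [hB])
    have h2 := hY A (by simp)
    simp only [Multiset.sum_cons, Multiset.map_add, Multiset.sum_add, Multiset.card_cons,
      Nat.cast_add, Nat.cast_one]
    linarith

lemma isAtomOver_univ_map {J : Type*} [Fintype J] [Nonempty J] {x : J → Q}
    (hsum : ∑ j, c (x j) = 0)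
    (hsub : ∀ I : Finset J, ∑ j ∈ I, c (x j) = 0 → I = ∅ ∨ I = Finset.univ) :
    IsAtomOver c ((Finset.univ : Finset J).val.map x) := by
  refine ⟨?_, ?_, fun B hB h0 => ?_⟩
  · intro h
    have := congrArg Multiset.card h
    simp at this
  · simpa [ZeroSumOver] using hsum
  · obtain ⟨S, hS, rfl⟩ := exists_le_of_le_map hB
    have hnd : S.Nodup := Multiset.nodup_of_le hS Finset.univ.nodup
    have h1 : ∑ j ∈ (⟨S, hnd⟩ : Finset J), c (x j) = 0 := by
      simpa [ZeroSumOver, Finset.sum] using h0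
    rcases hsub _ h1 with h | h
    · left
      have : S = 0 := congrArg Finset.val h
      simp [this]
    · right
      have : S = Finset.univ.val := congrArg Finset.val h
      simp [this]

/-- Lower bound for the tame degree. The atom `U` consists of the `x j`, it is covered by the atoms
`x j ::ₘ T j`, and all factorizations of `∑ j, T j` are long. -/
theorem not_tameLE_of_rows' {J : Type*} [Fintype J] {N : ℕ} (T : J → Multiset Q)
    (x : J → Q) (w : Q → ℚ) (hx : ∀ j, ZeroSumOver c (x j ::ₘ T j))
    (hsum : ∑ j, c (x j) = 0)
    (hsub : ∀ I : Finset J, ∑ j ∈ I, c (x j) = 0 → I = ∅ ∨ I = Finset.univ)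
    (hT : ∀ j, ∀ A ≤ T j, ¬ IsAtomOver c A)
    (hw : ∀ A ≤ ∑ j, T j, IsAtomOver c A → (A.map w).sum ≤ 1)
    (hN : (N : ℚ) ≤ ((∑ j, T j).map w).sum)
    (hV : ∀ j, ¬ x j ::ₘ T j ≤ ∑ j, T j)
    (hne : ∀ l, (Finset.univ : Finset J).val.map x ≠ x l ::ₘ T l) [Nonempty J] :
    ¬ TameLE c N := by
  classical
  intro H
  set U : Multiset Q := (Finset.univ : Finset J).val.map x with hUdef
  set W := ∑ j, T j with hWdef
  set Z : Multiset (Multiset Q) := (Finset.univ : Finset J).val.map fun j => x j ::ₘ T j with hZdef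
  have hU : IsAtomOver c U := isAtomOver_univ_map hsum hsub
  have hZ : ∀ A ∈ Z, IsAtomOver c A := by
    intro A hA
    obtain ⟨j, -, rfl⟩ := Multiset.mem_map.1 hA
    exact isAtomOver_cons (hT j) (hx j)
  have hZs : Z.sum = U + W := by
    have : ∑ j, (x j ::ₘ T j) = ∑ j, ({x j} : Multiset Q) + ∑ j, T j := by
      rw [← Finset.sum_add_distrib]
      simp
    have h2 : ∑ j, ({x j} : Multiset Q) = U := by
      rw [hUdef, ← Multiset.sum_map_singleton (Multiset.map x _), Multiset.map_map]
      rfl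
    rw [← h2, ← this]
    rfl
  obtain ⟨Z', h1, h2, h3, -, h5⟩ := H Z hZ U hU (by rw [hZs]; exact Multiset.le_add_right _ _)
  obtain ⟨Y, rfl⟩ := Multiset.exists_cons_of_mem h3
  rw [Multiset.sum_cons, hZs, add_right_inj] at h2
  have hYW : ∀ A ∈ Y, A ≤ W := fun A hA =>
    h2 ▸ Multiset.single_le_sum (fun _ _ => Multiset.zero_le _) _ hA
  have hUZ : U ∉ Z := by
    intro hm
    obtain ⟨l, -, hl⟩ := Multiset.mem_map.1 hm
    exact hne l hl.symm
  -- Nothing of the new factorization survives from `Z`: `U` is none of the rows, and no row fits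
  -- into `W`. So all of `U ::ₘ Y` counts towards the distance, and the weight forces `Y` to have at
  -- least `N` members.
  have hdisj : (U ::ₘ Y) - Z = U ::ₘ Y := by
    refine Multiset.ext' fun A => ?_
    rw [Multiset.count_sub]
    by_cases hA : A ∈ Z
    · have hA' : A ∉ U ::ₘ Y := by
        rw [Multiset.mem_cons, not_or]
        refine ⟨fun h => hUZ (h ▸ hA), fun h => ?_⟩
        obtain ⟨l, -, rfl⟩ := Multiset.mem_map.1 hA
        exact hV l (hYW _ h)
      rw [Multiset.count_eq_zero_of_notMem hA', zero_tsub]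
    · rw [Multiset.count_eq_zero_of_notMem hA, tsub_zero]
  rw [hdisj, Multiset.card_cons] at h5
  have h6 := sum_map_le_card w fun A hA => hw A (hYW A hA) (h1 A (by simp [hA]))
  rw [h2] at h6
  have h7 : (N : ℚ) ≤ Y.card := hN.trans h6
  have h8 : N ≤ Y.card := by exact_mod_cast h7
  omega

/-- Two of the `x j` lying outside `W` guarantee that `U` is not a row: for every `l` one of them
has index different from `l`, so it is a term of `U` that would have to occur in `T l`. -/
theorem not_tameLE_of_rows {J : Type*} [Fintype J] {N : ℕ} (T : J → Multiset Q)
    (x : J → Q) (w : Q → ℚ) (hx : ∀ j, ZeroSumOver c (x j ::ₘ T j))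
    (hsum : ∑ j, c (x j) = 0)
    (hsub : ∀ I : Finset J, ∑ j ∈ I, c (x j) = 0 → I = ∅ ∨ I = Finset.univ)
    (hT : ∀ j, ∀ A ≤ T j, ¬ IsAtomOver c A)
    (hw : ∀ A ≤ ∑ j, T j, IsAtomOver c A → (A.map w).sum ≤ 1)
    (hN : (N : ℚ) ≤ ((∑ j, T j).map w).sum)
    (hV : ∀ j, ¬ x j ::ₘ T j ≤ ∑ j, T j)
    (hgood : ∃ j₁ j₂, j₁ ≠ j₂ ∧ x j₁ ∉ ∑ j, T j ∧ x j₂ ∉ ∑ j, T j) : ¬ TameLE c N := by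
  classical
  obtain ⟨j₁, j₂, hne, hg₁, hg₂⟩ := hgood
  have : Nonempty J := ⟨j₁⟩
  refine not_tameLE_of_rows' T x w hx hsum hsub hT hw hN hV fun l hl => ?_
  obtain ⟨j, hjl, hj⟩ : ∃ j, j ≠ l ∧ x j ∉ ∑ j, T j := by
    by_cases h : j₁ = l
    · exact ⟨j₂, fun h' => hne (h.trans h'.symm), hg₂⟩
    · exact ⟨j₁, h, hg₁⟩
  have hsplit : (Finset.univ : Finset J).val.map x =
      x l ::ₘ ((Finset.univ.erase l).val.map x) := by
    rw [← Multiset.map_cons, ← Finset.insert_val_of_notMem (Finset.notMem_erase l _),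
      Finset.insert_erase (Finset.mem_univ l)]
  rw [hsplit, Multiset.cons_inj_right] at hl
  refine hj (Multiset.mem_of_le ?_ (hl ▸ Multiset.mem_map_of_mem x
    (Finset.mem_def.1 (Finset.mem_erase.2 ⟨hjl, Finset.mem_univ j⟩)) : x j ∈ T l))
  exact Finset.single_le_sum (fun _ _ => Multiset.zero_le _) (Finset.mem_univ l)

/-- Lower bound for the tame degree in the presence of elements of order two: a square-free atom
`U` and the factorization of `U²` into the squares of its terms. -/
theorem not_tameLE_of_squares {J : Type*} [Fintype J] [Nonempty J] {N : ℕ} (x : J → Q)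
    (hinj : Function.Injective x) (h2 : ∀ j, c (x j) + c (x j) = 0) (h0 : ∀ j, c (x j) ≠ 0)
    (hsum : ∑ j, c (x j) = 0)
    (hsub : ∀ I : Finset J, ∑ j ∈ I, c (x j) = 0 → I = ∅ ∨ I = Finset.univ)
    (hN : N < Fintype.card J) : ¬ TameLE c N := by
  classical
  intro H
  set U : Multiset Q := (Finset.univ : Finset J).val.map x with hUdef
  set Z : Multiset (Multiset Q) := (Finset.univ : Finset J).val.map fun j => x j ::ₘ {x j}
    with hZdef
  have hU : IsAtomOver c U := isAtomOver_univ_map hsum hsub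
  have hnd : U.Nodup := Finset.univ.nodup.map hinj
  have hZ : ∀ A ∈ Z, IsAtomOver c A := by
    intro A hA
    obtain ⟨j, -, rfl⟩ := Multiset.mem_map.1 hA
    refine isAtomOver_cons (fun B hB hB' => ?_) (by simpa [ZeroSumOver] using h2 j)
    rcases Multiset.le_singleton.1 hB with rfl | rfl
    · exact hB'.1 rfl
    · exact h0 j (by simpa [ZeroSumOver] using hB'.2)
  have hZs : Z.sum = U + U := by
    have : ∑ j, (x j ::ₘ {x j}) = ∑ j, ({x j} : Multiset Q) + ∑ j, {x j} := by
      rw [← Finset.sum_add_distrib]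
      simp
    have h2 : ∑ j, ({x j} : Multiset Q) = U := by
      rw [hUdef, ← Multiset.sum_map_singleton (Multiset.map x _), Multiset.map_map]
      rfl
    rw [h2] at this
    exact this
  obtain ⟨Z', h1, h2, h3, h4, -⟩ := H Z hZ U hU (by rw [hZs]; exact Multiset.le_add_right _ _)
  obtain ⟨Y, rfl⟩ := Multiset.exists_cons_of_mem h3
  rw [Multiset.sum_cons, hZs, add_right_inj] at h2
  -- Since `U` is square-free, no square of a term divides it. The cofactor is again `U`, so no
  -- member of `Z` can be retained.
  have hdisj : Z - (U ::ₘ Y) = Z := by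
    refine Multiset.ext' fun A => ?_
    rw [Multiset.count_sub]
    by_cases hA : A ∈ Z
    · have hA' : A ∉ U ::ₘ Y := by
        have hAU : ¬ A ≤ U := by
          obtain ⟨j, -, rfl⟩ := Multiset.mem_map.1 hA
          intro hle
          simpa using Multiset.nodup_of_le hle hnd
        rw [Multiset.mem_cons, not_or]
        refine ⟨fun h => hAU h.le, fun h => hAU ?_⟩
        exact h2 ▸ Multiset.single_le_sum (fun _ _ => Multiset.zero_le _) _ h
      rw [Multiset.count_eq_zero_of_notMem hA', tsub_zero]
    · rw [Multiset.count_eq_zero_of_notMem hA, zero_tsub]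
  rw [hdisj, hZdef, Multiset.card_map] at h4
  have h5 : Multiset.card (Finset.univ : Finset J).val = Fintype.card J := rfl
  omega

end Rows

end Krull

namespace Krull

set_option linter.unusedSectionVars false

/-! ### Sequences over a basis and its negatives. -/

section Columns

variable {ι : Type*} [Fintype ι] [DecidableEq ι] {n : ι → ℕ} {Q : Type*}
  {c : Q → (i : ι) → ZMod (n i)} {p : ((i : ι) → ZMod (n i)) → Q}

/-- The sequence with `a i` terms `eᵢ` and `b i` terms `-eᵢ`, lifted along the section `p`. -/
def colSeq (p : ((i : ι) → ZMod (n i)) → Q) (a b : ι → ℕ) : Multiset Q :=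
  ∑ i, (Multiset.replicate (a i) (p (Pi.single i 1)) +
    Multiset.replicate (b i) (p (-Pi.single i 1)))

lemma mem_colSeq {a b : ι → ℕ} {q : Q} (h : q ∈ colSeq p a b) :
    ∃ i, q = p (Pi.single i 1) ∨ q = p (-Pi.single i 1) := by
  obtain ⟨i, -, hi⟩ := Multiset.mem_sum.1 h
  refine ⟨i, ?_⟩
  rcases Multiset.mem_add.1 hi with hi | hi
  exacts [Or.inl (Multiset.eq_of_mem_replicate hi), Or.inr (Multiset.eq_of_mem_replicate hi)]

lemma sum_colSeq {J : Type*} [Fintype J] (a b : J → ι → ℕ) :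
    ∑ j, colSeq p (a j) (b j) = colSeq p (fun i => ∑ j, a j i) (fun i => ∑ j, b j i) := by
  simp only [colSeq]
  rw [Finset.sum_comm]
  refine Finset.sum_congr rfl fun i _ => ?_
  rw [Finset.sum_add_distrib]
  congr 1
  · exact (map_sum (Multiset.replicateAddMonoidHom (p (Pi.single i 1))) (fun j => a j i) _).symm
  · exact (map_sum (Multiset.replicateAddMonoidHom (p (-Pi.single i 1))) (fun j => b j i) _).symm

lemma single_ne_neg_single {i : ι} (h3 : 3 ≤ n i) :
    (Pi.single i 1 : (i : ι) → ZMod (n i)) ≠ -Pi.single i 1 := by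
  intro h
  have := congrFun h i
  rw [Pi.neg_apply, Pi.single_eq_same, eq_neg_iff_add_eq_zero] at this
  have h2 : ((2 : ℕ) : ZMod (n i)) = 0 := by rw [← this]; norm_num
  rw [ZMod.natCast_eq_zero_iff] at h2
  have := Nat.le_of_dvd (by norm_num) h2
  omega

lemma single_eq_neg_single {i : ι} (h2 : n i = 2) :
    (Pi.single i 1 : (i : ι) → ZMod (n i)) = -Pi.single i 1 := by
  rw [← Pi.single_neg]
  congr 1
  rw [eq_neg_iff_add_eq_zero]
  have : ((2 : ℕ) : ZMod (n i)) = 0 := by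
    rw [ZMod.natCast_eq_zero_iff, h2]
  rw [← this]; norm_num

lemma one_ne_zero_of (hn : ∀ i, 1 < n i) (i : ι) : (1 : ZMod (n i)) ≠ 0 := by
  have : Fact (1 < n i) := ⟨hn i⟩
  exact one_ne_zero

lemma eq_of_apply_ne_zero {i k : ι} {g : (i : ι) → ZMod (n i)}
    (hg : g = Pi.single i 1 ∨ g = -Pi.single i 1) (h : g k ≠ 0) : k = i := by
  by_contra hne
  rcases hg with rfl | rfl
  · exact h (by simp [hne])
  · exact h (by simp [hne])

lemma apply_ne_zero (hn : ∀ i, 1 < n i) {i : ι} {g : (i : ι) → ZMod (n i)}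
    (hg : g = Pi.single i 1 ∨ g = -Pi.single i 1) : g i ≠ 0 := by
  have := one_ne_zero_of hn i
  rcases hg with rfl | rfl <;> simpa

lemma count_neg_colSeq [DecidableEq Q] (hn : ∀ i, 1 < n i) (hp : ∀ g, c (p g) = g)
    {i : ι} (h3 : 3 ≤ n i) (a b : ι → ℕ) :
    Multiset.count (p (-Pi.single i 1)) (colSeq p a b) = b i := by
  have hinj : Function.Injective p := Function.LeftInverse.injective hp
  rw [colSeq, Multiset.count_sum', Finset.sum_eq_single i]
  · rw [Multiset.count_add, Multiset.count_replicate, Multiset.count_replicate, if_neg, if_pos rfl,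
      zero_add]
    exact fun h => single_ne_neg_single h3 (hinj h)
  · intro k _ hk
    have h1 : ¬ p (Pi.single k 1) = p (-Pi.single i 1) := fun h =>
      hk (eq_of_apply_ne_zero (Or.inr (hinj h)) (apply_ne_zero hn (Or.inl rfl)))
    have h2 : ¬ p (-Pi.single k 1) = p (-Pi.single i 1) := fun h =>
      hk (eq_of_apply_ne_zero (Or.inr (hinj h)) (apply_ne_zero hn (Or.inr rfl)))
    rw [Multiset.count_add, Multiset.count_replicate, Multiset.count_replicate, if_neg h1,
      if_neg h2, add_zero]
  · simp

/-- For `n i = 2` the elements `eᵢ` and `-eᵢ` coincide, so both kinds of terms are counted. -/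
lemma count_pos_colSeq [DecidableEq Q] (hn : ∀ i, 1 < n i) (hp : ∀ g, c (p g) = g)
    (i : ι) (a b : ι → ℕ) :
    Multiset.count (p (Pi.single i 1)) (colSeq p a b) = a i + if 3 ≤ n i then 0 else b i := by
  have hinj : Function.Injective p := Function.LeftInverse.injective hp
  rw [colSeq, Multiset.count_sum', Finset.sum_eq_single i]
  · rw [Multiset.count_add, Multiset.count_replicate, Multiset.count_replicate, if_pos rfl]
    congr 1
    by_cases h3 : 3 ≤ n i
    · rw [if_pos h3, if_neg]
      exact fun h => single_ne_neg_single h3 (hinj h).symm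
    · rw [if_neg h3, if_pos]
      rw [← single_eq_neg_single (by have := hn i; omega)]
  · intro k _ hk
    have h1 : ¬ p (Pi.single k 1) = p (Pi.single i 1) := fun h =>
      hk (eq_of_apply_ne_zero (Or.inl (hinj h)) (apply_ne_zero hn (Or.inl rfl)))
    have h2 : ¬ p (-Pi.single k 1) = p (Pi.single i 1) := fun h =>
      hk (eq_of_apply_ne_zero (Or.inl (hinj h)) (apply_ne_zero hn (Or.inr rfl)))
    rw [Multiset.count_add, Multiset.count_replicate, Multiset.count_replicate, if_neg h1,
      if_neg h2, add_zero]
  · simp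

lemma zeroSumOver_pi_iff {S : Multiset Q} :
    ZeroSumOver c S ↔ ∀ k, (S.map fun q => c q k).sum = 0 := by
  rw [ZeroSumOver, funext_iff]
  refine forall_congr' fun k => ?_
  have := map_multiset_sum (Pi.evalAddMonoidHom (fun i => ZMod (n i)) k) (S.map c)
  rw [Multiset.map_map] at this
  change (S.map c).sum k = _ at this
  rw [this]
  rfl

/-- The minimal zero-sum sequences over the `± eᵢ` with few terms `-eᵢ` are `eᵢ (-eᵢ)` and
`nᵢ eᵢ`. -/
lemma atom_le_colSeq (hn : ∀ i, 1 < n i) (hp : ∀ g, c (p g) = g) {a b : ι → ℕ}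
    (hb : ∀ i, b i < n i) {A : Multiset Q} (hA : IsAtomOver c A) (hle : A ≤ colSeq p a b) :
    ∃ i, A = {p (Pi.single i 1), p (-Pi.single i 1)} ∨
      A = Multiset.replicate (n i) (p (Pi.single i 1)) := by
  classical
  obtain ⟨q₀, hq₀⟩ := Multiset.exists_mem_of_ne_zero hA.1
  obtain ⟨i, hi⟩ := mem_colSeq (Multiset.mem_of_le hle hq₀)
  refine ⟨i, ?_⟩
  let P : Q → Prop := fun q => q = p (Pi.single i 1) ∨ q = p (-Pi.single i 1)
  have hcP : ∀ q, P q → c q = Pi.single i 1 ∨ c q = -Pi.single i 1 := by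
    rintro q (rfl | rfl)
    exacts [Or.inl (hp _), Or.inr (hp _)]
  -- The terms `± eᵢ` alone carry the `i`-th coordinate, so they form a zero-sum subsequence; by
  -- minimality they are all of `A`.
  have hB : ZeroSumOver c (A.filter P) := by
    rw [zeroSumOver_pi_iff]
    intro k
    by_cases hk : k = i
    · subst hk
      have h1 := zeroSumOver_pi_iff.1 hA.2 k
      rw [← Multiset.filter_add_not P A, Multiset.map_add, Multiset.sum_add] at h1
      rw [← h1, left_eq_add]
      refine Multiset.sum_eq_zero fun y hy => ?_
      obtain ⟨q, hq, rfl⟩ := Multiset.mem_map.1 hy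
      rw [Multiset.mem_filter] at hq
      obtain ⟨l, hl⟩ := mem_colSeq (Multiset.mem_of_le hle hq.1)
      by_contra hne
      have hcl : c q = Pi.single l 1 ∨ c q = -Pi.single l 1 := by
        rcases hl with rfl | rfl
        exacts [Or.inl (hp _), Or.inr (hp _)]
      have := eq_of_apply_ne_zero hcl hne
      subst this
      exact hq.2 hl
    · refine Multiset.sum_eq_zero fun y hy => ?_
      obtain ⟨q, hq, rfl⟩ := Multiset.mem_map.1 hy
      rw [Multiset.mem_filter] at hq
      by_contra hne
      exact hk (eq_of_apply_ne_zero (hcP q hq.2) hne)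
  have hAP : ∀ q ∈ A, P q := by
    rcases hA.3 _ (Multiset.filter_le P A) hB with h | h
    · exact absurd hi (Multiset.filter_eq_nil.1 h q₀ hq₀)
    · exact Multiset.filter_eq_self.1 h
  have hrep (g : (i : ι) → ZMod (n i)) (hg : g = Pi.single i 1 ∨ g = -Pi.single i 1) (k : ℕ)
      (hz : ZeroSumOver c (Multiset.replicate k (p g))) : n i ∣ k := by
    have := zeroSumOver_pi_iff.1 hz i
    rw [Multiset.map_replicate, Multiset.sum_replicate, hp] at this
    rw [← ZMod.natCast_eq_zero_iff]
    rcases hg with rfl | rfl <;> simpa using this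
  by_cases hpos : p (Pi.single i 1) ∈ A
  · obtain ⟨R, rfl⟩ := Multiset.exists_cons_of_mem hpos
    by_cases hneg : p (-Pi.single i 1) ∈ R
    · left
      have hle' : ({p (Pi.single i 1), p (-Pi.single i 1)} : Multiset Q) ≤
          p (Pi.single i 1) ::ₘ R :=
        (Multiset.cons_le_cons_iff _).2 (Multiset.singleton_le.2 hneg)
      rcases hA.3 _ hle' (by simp [ZeroSumOver, hp]) with h | h
      · simp at h
      · exact h.symm
    · right
      have hR : p (Pi.single i 1) ::ₘ R =
          Multiset.replicate (R.card + 1) (p (Pi.single i 1)) := by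
        rw [Multiset.eq_replicate]
        refine ⟨by simp, fun q hq => ?_⟩
        rcases Multiset.mem_cons.1 hq with h | h
        · exact h
        · rcases hAP q hq with h' | rfl
          · exact h'
          · exact absurd h hneg
      have hdvd := hrep _ (Or.inl rfl) _ (hR ▸ hA.2)
      have hle' : Multiset.replicate (n i) (p (Pi.single i 1)) ≤ p (Pi.single i 1) ::ₘ R := by
        rw [hR]
        exact Multiset.replicate_le_replicate _ |>.2 (Nat.le_of_dvd (Nat.succ_pos _) hdvd)
      rcases hA.3 _ hle' (by
        simp only [ZeroSumOver, Multiset.map_replicate, Multiset.sum_replicate, hp]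
        rw [← Pi.single_smul]
        simp) with h | h
      · have := congrArg Multiset.card h
        have := hn i
        simp at *
        omega
      · exact h.symm
  · exfalso
    -- An atom with terms `-eᵢ` only needs `n i` of them, more than are available. If `n i = 2`,
    -- such a term is also `eᵢ`.
    have hall : ∀ q ∈ A, q = p (-Pi.single i 1) := fun q hq =>
      (hAP q hq).resolve_left fun h => hpos (h ▸ hq)
    have hR := Multiset.eq_replicate_card.2 hall
    have hdvd := hrep _ (Or.inr rfl) _ (hR ▸ hA.2)
    have hcard : n i ≤ A.card := Nat.le_of_dvd (Multiset.card_pos.2 hA.1) hdvd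
    have hcount := Multiset.le_iff_count.1 hle (p (-Pi.single i 1))
    rw [hR, Multiset.count_replicate_self] at hcount
    by_cases h3 : 3 ≤ n i
    · rw [count_neg_colSeq hn hp h3] at hcount
      have := hb i
      omega
    · have h2 : n i = 2 := by have := hn i; omega
      apply hpos
      rw [single_eq_neg_single h2]
      exact hall q₀ hq₀ ▸ hq₀

lemma no_atom_le_colSeq (hn : ∀ i, 1 < n i) (hp : ∀ g, c (p g) = g) {a b : ι → ℕ}
    (ha : ∀ i, a i < n i) (hb : ∀ i, b i < n i) (hab : ∀ i, a i = 0 ∨ b i = 0)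
    {A : Multiset Q} (hle : A ≤ colSeq p a b) : ¬ IsAtomOver c A := by
  classical
  intro hA
  obtain ⟨i, h | h⟩ := atom_le_colSeq hn hp hb hA hle
  · have h1 := Multiset.le_iff_count.1 hle (p (Pi.single i 1))
    have h2 := Multiset.le_iff_count.1 hle (p (-Pi.single i 1))
    rw [count_pos_colSeq hn hp] at h1
    have h3 : 1 ≤ Multiset.count (p (Pi.single i 1)) A :=
      Multiset.one_le_count_iff_mem.2 (by simp [h])
    have h4 : 1 ≤ Multiset.count (p (-Pi.single i 1)) A :=
      Multiset.one_le_count_iff_mem.2 (by simp [h])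
    by_cases h5 : 3 ≤ n i
    · rw [count_neg_colSeq hn hp h5] at h2
      rw [if_pos h5] at h1
      have := hab i
      omega
    · have h6 : n i = 2 := by have := hn i; omega
      -- For `n i = 2` the atom `eᵢ (-eᵢ)` needs two equal terms, but `a i + b i ≤ 1`.
      rw [if_neg h5, h, ← single_eq_neg_single h6] at h1
      simp only [Multiset.insert_eq_cons, Multiset.count_cons_self,
        Multiset.count_singleton_self] at h1
      have := ha i
      have := hb i
      have := hab i
      omega
  · have h1 := Multiset.le_iff_count.1 hle (p (Pi.single i 1))
    rw [count_pos_colSeq hn hp, h, Multiset.count_replicate_self] at h1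
    have := ha i
    have := hb i
    rcases hab i with h0 | h0 <;> split_ifs at h1 <;> omega

/-- The weight `∑ᵢ gᵢ / nᵢ`, with representatives `0 ≤ gᵢ < nᵢ`. -/
def fracWeight (c : Q → (i : ι) → ZMod (n i)) (q : Q) : ℚ :=
  ∑ i, ((c q i).val : ℚ) / n i

lemma fracWeight_single (hn : ∀ i, 1 < n i) (hp : ∀ g, c (p g) = g) (i : ι) :
    fracWeight c (p (Pi.single i 1)) = 1 / n i := by
  have : Fact (1 < n i) := ⟨hn i⟩
  rw [fracWeight, Finset.sum_eq_single i]
  · rw [hp, Pi.single_eq_same, ZMod.val_one]; simp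
  · intro k _ hk
    rw [hp, Pi.single_eq_of_ne hk]; simp
  · simp

lemma fracWeight_neg_single (hn : ∀ i, 1 < n i) (hp : ∀ g, c (p g) = g) (i : ι) :
    fracWeight c (p (-Pi.single i 1)) = (n i - 1) / n i := by
  have : Fact (1 < n i) := ⟨hn i⟩
  rw [fracWeight, Finset.sum_eq_single i]
  · rw [hp, Pi.neg_apply, Pi.single_eq_same, ZMod.neg_val, if_neg one_ne_zero, ZMod.val_one,
      Nat.cast_sub (hn i).le]; simp
  · intro k _ hk
    rw [hp, Pi.neg_apply, Pi.single_eq_of_ne hk]; simp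
  · simp

lemma fracWeight_colSeq (hn : ∀ i, 1 < n i) (hp : ∀ g, c (p g) = g) (a b : ι → ℕ) :
    ((colSeq p a b).map (fracWeight c)).sum =
      ∑ i, ((a i : ℚ) + b i * (n i - 1)) / n i := by
  have h := map_sum (Multiset.sumAddMonoidHom.comp (Multiset.mapAddMonoidHom (fracWeight c)))
    (fun i => Multiset.replicate (a i) (p (Pi.single i 1)) +
      Multiset.replicate (b i) (p (-Pi.single i 1))) Finset.univ
  simp only [AddMonoidHom.comp_apply, Multiset.coe_sumAddMonoidHom,
    Multiset.coe_mapAddMonoidHom] at h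
  rw [colSeq, h]
  refine Finset.sum_congr rfl fun i _ => ?_
  rw [Multiset.map_add, Multiset.sum_add, Multiset.map_replicate, Multiset.map_replicate,
    Multiset.sum_replicate, Multiset.sum_replicate, fracWeight_single hn hp,
    fracWeight_neg_single hn hp, nsmul_eq_mul, nsmul_eq_mul]
  ring

/-- The two kinds of atoms have weight `1 / nᵢ + (nᵢ - 1) / nᵢ` and `nᵢ * (1 / nᵢ)`. The weight of a
sequence is therefore a lower bound for the length of its factorizations. -/
lemma fracWeight_atom_le (hn : ∀ i, 1 < n i) (hp : ∀ g, c (p g) = g) {a b : ι → ℕ}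
    (hb : ∀ i, b i < n i) {A : Multiset Q} (hA : IsAtomOver c A) (hle : A ≤ colSeq p a b) :
    (A.map (fracWeight c)).sum ≤ 1 := by
  obtain ⟨i, h⟩ := atom_le_colSeq hn hp hb hA hle
  have hpos : (n i : ℚ) ≠ 0 := by
    have := hn i
    positivity
  rcases h with rfl | rfl
  · rw [Multiset.insert_eq_cons, Multiset.map_cons, Multiset.sum_cons, Multiset.map_singleton,
      Multiset.sum_singleton, fracWeight_single hn hp, fracWeight_neg_single hn hp]
    field_simp
    simp
  · rw [Multiset.map_replicate, Multiset.sum_replicate, fracWeight_single hn hp, nsmul_eq_mul]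
    field_simp
    simp

end Columns

end Krull

namespace Krull

set_option linter.unusedSectionVars false

/-! ### Lower bounds from integer matrices. -/

section Matrix

variable {ι : Type*} [Fintype ι] [DecidableEq ι] {n : ι → ℕ} {Q : Type*}
  {c : Q → (i : ι) → ZMod (n i)} {p : ((i : ι) → ZMod (n i)) → Q}

/-- `q` is none of the chosen elements in the classes `± eᵢ`. -/
def OffBasis (p : ((i : ι) → ZMod (n i)) → Q) (q : Q) : Prop :=
  ∀ i, q ≠ p (Pi.single i 1) ∧ q ≠ p (-Pi.single i 1)

lemma OffBasis.notMem {q : Q} (h : OffBasis p q) (a b : ι → ℕ) : q ∉ colSeq p a b := by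
  intro hq
  obtain ⟨i, hi | hi⟩ := mem_colSeq hq
  exacts [(h i).1 hi, (h i).2 hi]

/-- Each `± eₗ` has only one non-zero coordinate. -/
lemma offBasis_of_two (hp : ∀ g, c (p g) = g) {q : Q} {i k : ι} (hik : i ≠ k) (hi : c q i ≠ 0)
    (hk : c q k ≠ 0) : OffBasis p q := by
  have key : ∀ l, ¬ (c q = Pi.single l 1 ∨ c q = -Pi.single l 1) := fun l h =>
    hik ((eq_of_apply_ne_zero h hi).trans (eq_of_apply_ne_zero h hk).symm)
  refine fun l => ⟨?_, ?_⟩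
  · rintro rfl
    exact key l (Or.inl (hp _))
  · rintro rfl
    exact key l (Or.inr (hp _))

lemma offBasis_of_apply (hp : ∀ g, c (p g) = g) {q : Q} {i : ι} (h0 : c q i ≠ 0)
    (h1 : c q i ≠ 1) (h2 : c q i ≠ -1) : OffBasis p q := by
  have key : ∀ l, ¬ (c q = Pi.single l 1 ∨ c q = -Pi.single l 1) := by
    intro l h
    obtain rfl := eq_of_apply_ne_zero h h0
    rcases h with h | h <;> simp [h] at h1 h2
  refine fun l => ⟨?_, ?_⟩
  · rintro rfl
    exact key l (Or.inl (hp _))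
  · rintro rfl
    exact key l (Or.inr (hp _))

lemma map_colSeq_sum (hp : ∀ g, c (p g) = g) (a b : ι → ℕ) (k : ι) :
    ((colSeq p a b).map fun q => c q k).sum = (a k : ZMod (n k)) - b k := by
  have h := map_sum (Multiset.sumAddMonoidHom.comp (Multiset.mapAddMonoidHom fun q => c q k))
    (fun i => Multiset.replicate (a i) (p (Pi.single i 1)) +
      Multiset.replicate (b i) (p (-Pi.single i 1))) Finset.univ
  simp only [AddMonoidHom.comp_apply, Multiset.coe_sumAddMonoidHom,
    Multiset.coe_mapAddMonoidHom] at h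
  rw [colSeq, h, Finset.sum_eq_single k]
  · simp [hp, sub_eq_add_neg]
  · intro i _ hik
    simp [hp, hik.symm]
  · simp

/-- Lower bound for the tame degree from an integer matrix: the row `m j` stands for a zero-sum
free sequence over the `± eᵢ` which, together with `x j`, is an atom. -/
theorem not_tameLE_of_matrix (hn : ∀ i, 1 < n i) (hp : ∀ g, c (p g) = g)
    {J : Type*} [Fintype J] (m : J → ι → ℤ) (x : J → Q) (N : ℕ)
    (hm : ∀ j i, |m j i| < n i) (hcol : ∀ i, (n i : ℤ) ∣ ∑ j, m j i)
    (hneg : ∀ i, ∑ j, (-m j i).toNat < n i)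
    (hx : ∀ j i, c (x j) i = -(m j i : ZMod (n i)))
    (hsub : ∀ I : Finset J, (∀ i, (n i : ℤ) ∣ ∑ j ∈ I, m j i) → I = ∅ ∨ I = Finset.univ)
    (hgood : ∀ j, OffBasis p (x j) ∨
      ∃ i, 3 ≤ n i ∧ x j = p (-Pi.single i 1) ∧ m j i = 1 - n i)
    (htwo : ∃ j₁ j₂, j₁ ≠ j₂ ∧ OffBasis p (x j₁) ∧ OffBasis p (x j₂))
    (hN : (N : ℚ) ≤ ∑ i, (((∑ j, (m j i).toNat : ℕ) : ℚ) +
      ((∑ j, (-m j i).toNat : ℕ) : ℚ) * (n i - 1)) / n i) : ¬ TameLE c N := by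
  classical
  have hsumI (I : Finset J) : (∑ j ∈ I, c (x j) = 0) ↔ ∀ i, (n i : ℤ) ∣ ∑ j ∈ I, m j i := by
    rw [funext_iff]
    refine forall_congr' fun i => ?_
    rw [Finset.sum_apply, Pi.zero_apply, ← ZMod.intCast_zmod_eq_zero_iff_dvd]
    simp [hx]
  have hW : ∑ j, colSeq p (fun i => (m j i).toNat) (fun i => (-m j i).toNat) =
      colSeq p (fun i => ∑ j, (m j i).toNat) (fun i => ∑ j, (-m j i).toNat) := sum_colSeq _ _
  obtain ⟨j₁, j₂, hne, h1, h2⟩ := htwo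
  refine not_tameLE_of_rows (c := c)
    (fun j => colSeq p (fun i => (m j i).toNat) (fun i => (-m j i).toNat)) x (fracWeight c)
    ?_ ((hsumI _).2 hcol) (fun I hI => hsub I ((hsumI I).1 hI)) ?_ ?_ ?_ ?_
    ⟨j₁, j₂, hne, ?_, ?_⟩
  · intro j
    rw [zeroSumOver_pi_iff]
    intro k
    rw [Multiset.map_cons, Multiset.sum_cons, map_colSeq_sum hp, hx]
    have : (m j k : ZMod (n k)) = (((m j k).toNat - (-m j k).toNat : ℤ) : ZMod (n k)) := by
      congr 1
      omega
    rw [this]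
    push_cast
    ring
  · intro j A hA
    refine no_atom_le_colSeq hn hp ?_ ?_ ?_ hA
    · intro i
      have := abs_lt.1 (hm j i)
      omega
    · intro i
      have := abs_lt.1 (hm j i)
      omega
    · intro i
      omega
  · intro A hA hA'
    rw [hW] at hA
    exact fracWeight_atom_le hn hp hneg hA' hA
  · rw [hW, fracWeight_colSeq hn hp]
    exact hN
  · intro j hle
    rw [hW] at hle
    rcases hgood j with h | ⟨i, h3, hxj, hmj⟩
    · exact h.notMem _ _ (Multiset.mem_of_le hle (Multiset.mem_cons_self _ _))
    -- Here the row consists of `-eᵢ` and `n i - 1` further copies from `T j`, too many for `W`,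
    -- which has fewer than `n i` of them.
    · have := Multiset.le_iff_count.1 hle (x j)
      rw [Multiset.count_cons_self, hxj, count_neg_colSeq hn hp h3, count_neg_colSeq hn hp h3]
        at this
      have := hneg i
      omega
  · rw [hW]
    exact h1.notMem _ _
  · rw [hW]
    exact h2.notMem _ _

end Matrix

end Krull

namespace Krull

set_option linter.unusedSectionVars false
set_option linter.unusedSimpArgs false

/-! ### Four-row matrices forcing more than `D*`. -/

section LargeDStar

variable {ι : Type*} [Fintype ι] [DecidableEq ι] {n : ι → ℕ} {Q : Type*}
  {c : Q → (i : ι) → ZMod (n i)} {p : ((i : ι) → ZMod (n i)) → Q}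

/-- If every column has weight at least `n i - 1` and one has weight `n i`, the total reaches `D*`.
-/
lemma one_add_sum_le (hn : ∀ i, 1 < n i) {v : ι → ℚ} (h : ∀ i, (n i : ℚ) - 1 ≤ v i) (i₀ : ι)
    (h₀ : (n i₀ : ℚ) ≤ v i₀) : ((1 + ∑ i, (n i - 1) : ℕ) : ℚ) ≤ ∑ i, v i := by
  have h1 : ∑ i, (((n i - 1 : ℕ) : ℚ) + if i = i₀ then 1 else 0) ≤ ∑ i, v i := by
    refine Finset.sum_le_sum fun i _ => ?_
    rw [Nat.cast_sub (hn i).le, Nat.cast_one]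
    split_ifs with hi
    · subst hi
      linarith
    · linarith [h i]
  rw [Finset.sum_add_distrib, Finset.sum_ite_eq' Finset.univ i₀, if_pos (Finset.mem_univ _)] at h1
  push_cast at h1 ⊢
  linarith

lemma sum_fin_four_subset (I : Finset (Fin 4)) (f : Fin 4 → ℤ) :
    ∑ j ∈ I, f j = (if 0 ∈ I then f 0 else 0) + (if 1 ∈ I then f 1 else 0) +
      (if 2 ∈ I then f 2 else 0) + (if 3 ∈ I then f 3 else 0) := by
  rw [← Fin.sum_univ_four fun j => if j ∈ I then f j else 0, Finset.sum_ite_mem,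
    Finset.univ_inter]

lemma fin_four_eq_empty_or_univ {I : Finset (Fin 4)} (h : (0 ∈ I ↔ 1 ∈ I) ∧ (0 ∈ I ↔ 2 ∈ I) ∧
    (0 ∈ I ↔ 3 ∈ I)) : I = ∅ ∨ I = Finset.univ := by
  obtain ⟨h1, h2, h3⟩ := h
  by_cases h0 : 0 ∈ I
  · right
    ext j
    fin_cases j <;> simp_all
  · left
    ext j
    fin_cases j <;> simp_all

lemma eq_zero_of_dvd {k : ℕ} {s : ℤ} (h : (k : ℤ) ∣ s) (h1 : s < k) (h2 : -s < k) : s = 0 :=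
  Int.eq_zero_of_abs_lt_dvd h (abs_lt.2 ⟨by omega, h1⟩)

lemma zero_or_self_of_dvd {k : ℕ} {s : ℤ} (h : (k : ℤ) ∣ s) (h1 : s < 2 * k) (h2 : -s < k) :
    s = 0 ∨ s = k := by
  rcases lt_or_ge s k with h3 | h3
  · exact Or.inl (eq_zero_of_dvd h h3 h2)
  · right
    have := eq_zero_of_dvd (dvd_sub_self_right.2 h) (s := s - k) (by omega) (by omega)
    omega

lemma intCast_ne_zero_of {k : ℕ} {s : ℤ} (h0 : s ≠ 0) (h1 : s < k) (h2 : -s < k) :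
    (s : ZMod k) ≠ 0 := by
  rw [Ne, ZMod.intCast_zmod_eq_zero_iff_dvd]
  exact fun h => h0 (eq_zero_of_dvd h h1 h2)

/-- Columns of sum `k` with `k - 1` negative terms, the most allowed: the weight is `((2k - 1) + (k
- 1)²) / k = k`. In the short version below the column sum is zero and the weight drops by one. -/
lemma colValue_long {k a b : ℕ} (hk : 1 < k) (ha : a = 2 * k - 1) (hb : b = k - 1) :
    ((a : ℚ) + (b : ℚ) * (k - 1)) / k = k := by
  subst ha hb
  have : (k : ℚ) ≠ 0 := by positivity
  rw [Nat.cast_sub (by omega), Nat.cast_sub hk.le]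
  push_cast
  field_simp
  ring

lemma colValue_short {k a b : ℕ} (hk : 1 < k) (ha : a = k - 1) (hb : b = k - 1) :
    ((a : ℚ) + (b : ℚ) * (k - 1)) / k = k - 1 := by
  subst ha hb
  have : (k : ℚ) ≠ 0 := by positivity
  rw [Nat.cast_sub hk.le]
  push_cast
  field_simp
  ring

/-- Cyclic groups of order at least five. -/
theorem not_tameLE_cyclic (hn : ∀ i, 1 < n i) (hp : ∀ g, c (p g) = g) (k : ι)
    (hk : ∀ i, i = k) (h5 : 5 ≤ n k) : ¬ TameLE c (1 + ∑ i, (n i - 1)) := by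
  -- The atom is `(2e)² (-3e) (-e)`, covered by `(2e) e^(n-2)` twice, `(-3e) e³` and `(-e)^n`. Order
  -- at least five makes `-3e` differ from `± e` and the last two terms not cancel the first two.
  let m : Fin 4 → ι → ℤ := fun j i => ![(n i : ℤ) - 2, n i - 2, 3, 1 - n i] j
  have h5' : ∀ i, 5 ≤ n i := fun i => hk i ▸ h5
  have hoff (j : Fin 4) (h1 : 2 ≤ m j k) (h2 : m j k ≤ n k - 2) :
      OffBasis p (p fun i => -(m j i : ZMod (n i))) := by
    refine offBasis_of_apply hp (i := k) ?_ ?_ ?_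
    · rw [hp, Ne, neg_eq_zero]
      exact intCast_ne_zero_of (by omega) (by omega) (by omega)
    · rw [hp, Ne, neg_eq_iff_add_eq_zero]
      have := intCast_ne_zero_of (k := n k) (s := m j k + 1) (by omega) (by omega) (by omega)
      push_cast at this
      exact this
    · rw [hp, Ne, neg_inj, ← sub_eq_zero]
      have := intCast_ne_zero_of (k := n k) (s := m j k - 1) (by omega) (by omega) (by omega)
      push_cast at this
      exact this
  refine not_tameLE_of_matrix hn hp m (fun j => p fun i => -(m j i : ZMod (n i))) _ ?_ ?_ ?_
    (fun j i => by rw [hp]) ?_ ?_ ⟨0, 1, by decide, hoff 0 ?_ ?_, hoff 1 ?_ ?_⟩ ?_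
  · intro j i
    have := h5' i
    rw [abs_lt]
    fin_cases j <;> simp [m] <;> omega
  · intro i
    simp [Fin.sum_univ_four, m]
    exact ⟨1, by ring⟩
  · intro i
    have := h5' i
    simp [Fin.sum_univ_four, m]
    omega
  · intro I hI
    have h1 := hI k
    apply fin_four_eq_empty_or_univ
    rw [sum_fin_four_subset] at h1
    simp only [m, Matrix.cons_val] at h1
    split_ifs at h1 <;> simp only [*, iff_true, iff_false, not_true, not_false_iff, and_true, and_false, true_and, false_and] <;>
      rcases zero_or_self_of_dvd h1 (by omega) (by omega) with h | h <;> omega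
  · intro j
    fin_cases j
    · exact Or.inl (hoff 0 (by simp [m]; omega) (by simp [m]))
    · exact Or.inl (hoff 1 (by simp [m]; omega) (by simp [m]))
    · exact Or.inl (hoff 2 (by simp [m]) (by simp [m]; omega))
    · refine Or.inr ⟨k, by omega, ?_, by simp [m]⟩
      congr 1
      ext i
      obtain rfl := hk i
      simp [m]
  · have := h5' k
    simp [m]; omega
  · simp [m]
  · have := h5' k
    simp [m]; omega
  · simp [m]
  · have hv (i : ι) := colValue_long (hn i) (a := ∑ j, (m j i).toNat)
      (b := ∑ j, (-m j i).toNat)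
      (by have := h5' i; simp [Fin.sum_univ_four, m]; omega)
      (by have := h5' i; simp [Fin.sum_univ_four, m]; omega)
    refine one_add_sum_le hn (fun i => ?_) k (hv k).ge
    rw [hv]
    linarith

/-- Groups of rank at least two in which `n k`, a multiple of all `n i`, is at least three. -/
theorem not_tameLE_of_three_le (hn : ∀ i, 1 < n i) (hp : ∀ g, c (p g) = g) (k i₀ : ι)
    (hki : i₀ ≠ k) (hdvd : ∀ i, n i ∣ n k) (h3 : 3 ≤ n k) :
    ¬ TameLE c (1 + ∑ i, (n i - 1)) := by
  -- Column `k` is short, all others are long. In a long column some pairs of rows sum to zero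
  -- modulo `n i`; the corresponding sums in column `k` are `± 2` or `± (n k - 2)`, not divisible by
  -- `n k ≥ 3`.
  let m : Fin 4 → ι → ℤ := fun j i => if i = k then ![(n i : ℤ) - 1, -1, -1, 3 - n i] j
    else ![(n i : ℤ) - 1, n i - 1, 1, 1 - n i] j
  have hmk (j : Fin 4) : m j k = ![(n k : ℤ) - 1, -1, -1, 3 - n k] j := if_pos rfl
  have hmi {i : ι} (hi : i ≠ k) (j : Fin 4) :
      m j i = ![(n i : ℤ) - 1, n i - 1, 1, 1 - n i] j := if_neg hi
  have hm : ∀ j i, m j i < n i ∧ -m j i < n i := by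
    intro j i
    have := hn i
    by_cases hi : i = k
    · subst hi
      rw [hmk]
      fin_cases j <;> simp <;> omega
    · rw [hmi hi]
      fin_cases j <;> simp <;> omega
  have hm0 {i : ι} (hi : i ≠ k) (j : Fin 4) : m j i ≠ 0 := by
    have := hn i
    rw [hmi hi]
    fin_cases j <;> simp <;> omega
  let x : Fin 4 → Q := fun j => p fun i => -(m j i : ZMod (n i))
  have hx0 {i : ι} {j : Fin 4} (h : m j i ≠ 0) : c (x j) i ≠ 0 := by
    rw [hp, Ne, neg_eq_zero]
    exact intCast_ne_zero_of h (hm j i).1 (hm j i).2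
  have hoff (j : Fin 4) (h : m j k ≠ 0) : OffBasis p (x j) :=
    offBasis_of_two hp hki (hx0 (hm0 hki j)) (hx0 h)
  have hcolp (i : ι) : ∑ j, (m j i).toNat = if i = k then n i - 1 else 2 * n i - 1 := by
    have := hn i
    split_ifs with hi
    · subst hi
      simp [Fin.sum_univ_four, hmk]; omega
    · simp [Fin.sum_univ_four, hmi hi]; omega
  have hcoln (i : ι) : ∑ j, (-m j i).toNat = n i - 1 := by
    have := hn i
    by_cases hi : i = k
    · subst hi
      simp [Fin.sum_univ_four, hmk]; omega
    · simp [Fin.sum_univ_four, hmi hi]; omega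
  have hoff0 : OffBasis p (x 0) := hoff 0 (by rw [hmk]; simp; omega)
  have hoff1 : OffBasis p (x 1) := hoff 1 (by rw [hmk]; simp)
  have hoff2 : OffBasis p (x 2) := hoff 2 (by rw [hmk]; simp)
  refine not_tameLE_of_matrix hn hp m x _ (fun j i => abs_lt.2 ⟨by linarith [(hm j i).2],
    (hm j i).1⟩) ?_ ?_ (fun j i => by rw [hp]) ?_ ?_ ⟨0, 1, by decide, hoff0, hoff1⟩ ?_
  · intro i
    by_cases hi : i = k
    · subst hi
      simp [Fin.sum_univ_four, hmk]
      exact ⟨0, by ring⟩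
    · simp [Fin.sum_univ_four, hmi hi]
      exact ⟨1, by ring⟩
  · intro i
    have := hn i
    rw [hcoln]
    omega
  · intro I hI
    have h1 := hI k
    have h2 := hI i₀
    have := hn i₀
    apply fin_four_eq_empty_or_univ
    rw [sum_fin_four_subset] at h1 h2
    simp only [hmk, hmi hki, Matrix.cons_val] at h1 h2
    split_ifs at h1 h2 <;> simp only [*, iff_true, iff_false, not_true, not_false_iff, and_true,
        and_false, true_and, false_and] <;>
      have h3 := eq_zero_of_dvd h1 (by omega) (by omega) <;>
      rcases zero_or_self_of_dvd h2 (by omega) (by omega) with h | h <;> omega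
  · intro j
    fin_cases j
    · exact Or.inl hoff0
    · exact Or.inl hoff1
    · exact Or.inl hoff2
    -- Row 3 is delicate: for `n k = 3` its entry in column `k` vanishes. Then all `n i` are three,
    -- and either a third coordinate helps or the rank is two and `x 3 = -e_{i₀}`, the exceptional
    -- case of the matrix criterion.
    · by_cases h4 : 4 ≤ n k
      · exact Or.inl (hoff 3 (by rw [hmk]; simp; omega))
      have hnk : n k = 3 := by omega
      have hn3 (i : ι) : n i = 3 := by
        have h5 := hdvd i
        rw [hnk, Nat.dvd_prime Nat.prime_three] at h5
        have := hn i
        omega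
      by_cases hi₁ : ∃ i₁, i₁ ≠ k ∧ i₁ ≠ i₀
      · obtain ⟨i₁, h5, h6⟩ := hi₁
        exact Or.inl (offBasis_of_two hp h6 (hx0 (hm0 h5 3)) (hx0 (hm0 hki 3)))
      · push Not at hi₁
        refine Or.inr ⟨i₀, (hn3 i₀).ge, ?_, by simp [hmi hki]⟩
        change p _ = p _
        congr 1
        ext i
        by_cases hi : i = k
        · subst hi
          rw [hmk]
          simp [hnk, hki.symm]
        · obtain rfl := hi₁ i hi
          rw [hmi hi]
          simp
  · refine one_add_sum_le hn (fun i => ?_) i₀ ?_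
    · by_cases hi : i = k
      · rw [colValue_short (hn i) (by rw [hcolp, if_pos hi]) (hcoln i)]
      · rw [colValue_long (hn i) (by rw [hcolp, if_neg hi]) (hcoln i)]
        linarith
    · rw [colValue_long (hn i₀) (by rw [hcolp, if_neg hki]) (hcoln i₀)]

/-- Elementary `2`-groups of rank at least three. -/
theorem not_tameLE_two (hn2 : ∀ i, n i = 2) (hp : ∀ g, c (p g) = g) {i₀ i₁ i₂ : ι}
    (h01 : i₀ ≠ i₁) (h02 : i₀ ≠ i₂) (h12 : i₁ ≠ i₂) {x₃ : Q}
    (hx₃ : ∀ i, c x₃ i = if i = i₁ ∨ i = i₂ then 0 else 1) (hoff₃ : OffBasis p x₃) :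
    ¬ TameLE c (1 + ∑ i, (n i - 1)) := by
  have hn : ∀ i, 1 < n i := fun i => by rw [hn2]; norm_num
  -- Two short columns of sum zero separate the rows, and all other columns are long.
  let m : Fin 4 → ι → ℤ := fun j i => if i = i₁ then ![1, -1, 0, 0] j else
    if i = i₂ then ![1, 0, -1, 0] j else ![1, 1, 1, -1] j
  have hm1 (j : Fin 4) : m j i₁ = ![1, -1, 0, 0] j := if_pos rfl
  have hm2 (j : Fin 4) : m j i₂ = ![1, 0, -1, 0] j := by simp [m, h12.symm]
  have hmi {i : ι} (h1 : i ≠ i₁) (h2 : i ≠ i₂) (j : Fin 4) : m j i = ![1, 1, 1, -1] j := by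
    simp [m, h1, h2]
  have hm : ∀ j i, m j i < n i ∧ -m j i < n i := by
    intro j i
    rw [hn2]
    simp only [m]
    split_ifs <;> fin_cases j <;> simp
  -- The last term is left free: in rank three its class is the basis element `e_{i₀}`, so it must
  -- be a different element of `Q` over that class.
  let x : Fin 4 → Q := fun j => if j = 3 then x₃ else p fun i => -(m j i : ZMod (n i))
  have hx : ∀ j i, c (x j) i = -(m j i : ZMod (n i)) := by
    intro j i
    by_cases hj : j = 3
    · subst hj
      simp only [x, if_true, hx₃, m]
      split_ifs <;> simp_all
    · simp only [x, if_neg hj, hp]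
  have hx0 {i : ι} {j : Fin 4} (h : m j i ≠ 0) : c (x j) i ≠ 0 := by
    rw [hx, Ne, neg_eq_zero]
    exact intCast_ne_zero_of h (hm j i).1 (hm j i).2
  have hoff0 : OffBasis p (x 0) :=
    offBasis_of_two hp h12 (hx0 (by rw [hm1]; simp)) (hx0 (by rw [hm2]; simp))
  have hoff1 : OffBasis p (x 1) :=
    offBasis_of_two hp h01 (hx0 (by rw [hmi h01 h02]; simp)) (hx0 (by rw [hm1]; simp))
  have hoff2 : OffBasis p (x 2) :=
    offBasis_of_two hp h02 (hx0 (by rw [hmi h01 h02]; simp)) (hx0 (by rw [hm2]; simp))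
  have hcolp (i : ι) : ∑ j, (m j i).toNat = if i = i₁ ∨ i = i₂ then n i - 1 else 2 * n i - 1 := by
    simp only [hn2, m, Fin.sum_univ_four]
    split_ifs <;> simp_all
  have hcoln (i : ι) : ∑ j, (-m j i).toNat = n i - 1 := by
    simp only [hn2, m, Fin.sum_univ_four]
    split_ifs <;> simp
  refine not_tameLE_of_matrix hn hp m x _ (fun j i => abs_lt.2 ⟨by linarith [(hm j i).2],
    (hm j i).1⟩) ?_ ?_ hx ?_ ?_ ⟨0, 1, by decide, hoff0, hoff1⟩ ?_
  · intro i
    simp only [hn2, m, Fin.sum_univ_four]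
    split_ifs <;> simp
  · intro i
    have := hn i
    rw [hcoln]
    omega
  · intro I hI
    have h1 := hI i₁
    have h2 := hI i₂
    have h3 := hI i₀
    apply fin_four_eq_empty_or_univ
    rw [sum_fin_four_subset, hn2] at h1 h2 h3
    simp only [hm1, hm2, hmi h01 h02, Matrix.cons_val] at h1 h2 h3
    split_ifs at h1 h2 h3 <;> simp only [*, iff_true, iff_false, not_true, not_false_iff, and_true,
        and_false, true_and, false_and] <;> omega
  · intro j
    fin_cases j
    exacts [Or.inl hoff0, Or.inl hoff1, Or.inl hoff2, Or.inl hoff₃]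
  · refine one_add_sum_le hn (fun i => ?_) i₀ ?_
    · by_cases hi : i = i₁ ∨ i = i₂
      · rw [colValue_short (hn i) (by rw [hcolp, if_pos hi]) (hcoln i)]
      · rw [colValue_long (hn i) (by rw [hcolp, if_neg hi]) (hcoln i)]
        linarith
    · rw [colValue_long (hn i₀) (by rw [hcolp, if_neg (by simp [h01, h02])]) (hcoln i₀)]

end LargeDStar

end Krull

namespace Krull

set_option linter.unusedSectionVars false

/-! ### Cyclic groups, and a bound quadratic in the rank. -/

section MoreLowerBounds

variable {ι : Type*} [Fintype ι] [DecidableEq ι] {n : ι → ℕ} {Q : Type*}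
  {c : Q → (i : ι) → ZMod (n i)} {p : ((i : ι) → ZMod (n i)) → Q}

/-- Cyclic groups of order at least three: the atoms `n e` and `n (-e)` cover `e (-e)`. -/
theorem not_tameLE_cyclic_pred (hn : ∀ i, 1 < n i) (hp : ∀ g, c (p g) = g) (k : ι)
    (hk : ∀ i, i = k) (h3 : 3 ≤ n k) : ¬ TameLE c (∑ i, (n i - 1)) := by
  classical
  have hn3 : ∀ i, 3 ≤ n i := fun i => hk i ▸ h3
  -- Each row has `n - 1` equal terms `e` or `-e`, completed by one more of the same kind; the
  -- cofactor `e^(n-1) (-e)^(n-1)` has weight `n - 1`.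
  let a : Fin 2 → ι → ℕ := fun j i => ![n i - 1, 0] j
  let b : Fin 2 → ι → ℕ := fun j i => ![0, n i - 1] j
  let g : Fin 2 → (i : ι) → ZMod (n i) := ![Pi.single k 1, -Pi.single k 1]
  have hW : ∑ j, colSeq p (a j) (b j) = colSeq p (fun i => ∑ j, a j i) (fun i => ∑ j, b j i) :=
    sum_colSeq _ _
  have hb : ∀ i, ∑ j, b j i < n i := by
    intro i
    have := hn i
    simp [b]
    omega
  have hc1 : ((n k - 1 : ℕ) : ZMod (n k)) = -1 := by
    rw [Nat.cast_sub (hn k).le]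
    simp
  refine not_tameLE_of_rows' (c := c) (fun j => colSeq p (a j) (b j)) (fun j => p (g j))
    (fracWeight c) ?_ ?_ ?_ ?_ ?_ ?_ ?_ ?_
  · intro j
    rw [zeroSumOver_pi_iff]
    intro i
    obtain rfl := hk i
    rw [Multiset.map_cons, Multiset.sum_cons, map_colSeq_sum hp, hp]
    fin_cases j <;> simp [a, b, g, hc1]
  · simp [g, hp]
  · intro I hI
    have hne := one_ne_zero_of hn k
    simp only [hp] at hI
    rw [← Finset.univ_inter I, ← Finset.sum_ite_mem, Fin.sum_univ_two] at hI
    have hI' := congrFun hI k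
    by_cases h0 : (0 : Fin 2) ∈ I
    · by_cases h1 : (1 : Fin 2) ∈ I
      · right
        ext j
        fin_cases j <;> simp [h0, h1]
      · simp [h0, h1, g, hne] at hI'
    · by_cases h1 : (1 : Fin 2) ∈ I
      · simp [h0, h1, g, hne] at hI'
      · left
        ext j
        fin_cases j <;> simp [h0, h1]
  · intro j A hA
    refine no_atom_le_colSeq hn hp ?_ ?_ ?_ hA
    all_goals
      intro i
      have := hn i
      fin_cases j <;> simp [a, b] <;> omega
  · intro A hA hA'
    rw [hW] at hA
    exact fracWeight_atom_le hn hp hb hA' hA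
  · rw [hW, fracWeight_colSeq hn hp]
    push_cast
    refine Finset.sum_le_sum fun i _ => ?_
    rw [← Nat.cast_sum, ← Nat.cast_sum, colValue_short (hn i) (by simp [a]) (by simp [b]),
      Nat.cast_sub (hn i).le]
    simp
  · intro j hle
    rw [hW] at hle
    have h1 := Multiset.le_iff_count.1 hle (p (g j))
    rw [Multiset.count_cons_self] at h1
    have := hn k
    fin_cases j
    · change Multiset.count (p (Pi.single k 1)) _ + 1 ≤ Multiset.count (p (Pi.single k 1)) _ at h1
      rw [count_pos_colSeq hn hp, count_pos_colSeq hn hp, if_pos h3] at h1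
      simp [a, h3] at h1
    · change Multiset.count (p (-Pi.single k 1)) _ + 1 ≤
        Multiset.count (p (-Pi.single k 1)) _ at h1
      rw [count_neg_colSeq hn hp h3, count_neg_colSeq hn hp h3] at h1
      simp [b] at h1
  · intro l hl
    -- The rows have length at least three, `U` has length two.
    have h0 : (n k - 1) * 1 ≤ (colSeq p (a l) (b l)).card := by
      rw [colSeq, Multiset.card_sum, Finset.sum_eq_single k (fun i _ h => absurd (hk i) h)
        (by simp)]
      fin_cases l <;> simp [a, b]
    have := congrArg Multiset.card hl
    simp only [Multiset.card_cons, Multiset.card_map] at this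
    have h5 : Multiset.card (Finset.univ : Finset (Fin 2)).val = 2 := rfl
    omega

/-- A lower bound for the tame degree that is quadratic in the rank. -/
theorem not_tameLE_quadratic (hn : ∀ i, 1 < n i) (hp : ∀ g, c (p g) = g) (s : Finset ι)
    (hs : s.Nonempty) {k₁ k₂ : ι} (hk₁ : k₁ ∉ s) (hk₂ : k₂ ∉ s) (hk : k₁ ≠ k₂) {e q : ℕ}
    (he : ∀ i, n i ∣ e) (hcard : s.card + 1 = e * q) (he0 : 0 < e) :
    ¬ TameLE c (sᶜ.card * q) := by
  classical
  -- A column `i ∈ s` has entries `n i - 1` in row `none` and `1` in row `i`, which ties these two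
  -- rows together in any zero-sum subset. The columns outside `s` consist of ones; each of them
  -- puts `e * q` terms `eᵢ` into the cofactor, hence weight at least `q`.
  let m : Option s → ι → ℤ := fun j i => if i ∈ s then
      j.elim ((n i : ℤ) - 1) (fun l => if (l : ι) = i then 1 else 0)
    else 1
  have hm0 (j i) : 0 ≤ m j i := by
    have := hn i
    simp only [m]
    split_ifs
    · cases j
      · simp; omega
      · simp only [Option.elim]; split_ifs <;> norm_num
    · norm_num
  have hm1 (j i) : m j i < n i := by
    have := hn i
    simp only [m]
    split_ifs
    · cases j
      · simp
      · simp only [Option.elim]; split_ifs <;> omega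
    · omega
  have hout {i} (hi : i ∉ s) (j) : m j i = 1 := by simp only [m, if_neg hi]
  let x : Option s → Q := fun j => p fun i => -(m j i : ZMod (n i))
  have hoff (j) : OffBasis p (x j) := by
    have := one_ne_zero_of hn k₁
    have := one_ne_zero_of hn k₂
    refine offBasis_of_two hp hk ?_ ?_
    · rw [hp, hout hk₁]; simpa
    · rw [hp, hout hk₂]; simpa
  have hin {i} (hi : i ∈ s) (I : Finset (Option s)) : ∑ j ∈ I, m j i =
      (if none ∈ I then (n i : ℤ) - 1 else 0) + (if some ⟨i, hi⟩ ∈ I then 1 else 0) := by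
    rw [← Finset.univ_inter I, ← Finset.sum_ite_mem, Fintype.sum_option]
    congr 1
    · simp [m, hi]
    · rw [Finset.sum_eq_single ⟨i, hi⟩]
      · simp [m, hi]
      · intro l _ hl
        have : (l : ι) ≠ i := fun h => hl (Subtype.ext h)
        simp [m, hi, this]
      · simp
  have hall {i} (hi : i ∈ s) : ∑ j, m j i = n i := by
    rw [hin hi]; simp
  have hpos (i) : ((∑ j, (m j i).toNat : ℕ) : ℤ) = ∑ j, m j i := by
    rw [Nat.cast_sum]
    exact Finset.sum_congr rfl fun j _ => Int.toNat_of_nonneg (hm0 j i)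
  have hneg (i) : ∑ j, (-m j i).toNat = 0 :=
    Finset.sum_eq_zero fun j _ => by have := hm0 j i; omega
  have hout' {i} (hi : i ∉ s) : ∑ j, m j i = e * q := by
    simp only [hout hi]
    simp only [Finset.sum_const, Finset.card_univ, Fintype.card_option, Fintype.card_coe, hcard]
    simp
  obtain ⟨i₀, hi₀⟩ := hs
  refine not_tameLE_of_matrix hn hp m x _ (fun j i => abs_lt.2 ⟨by linarith [hm0 j i, hm1 j i],
    hm1 j i⟩) ?_ ?_ (fun j i => by rw [hp]) ?_ (fun j => Or.inl (hoff j))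
    ⟨none, some ⟨i₀, hi₀⟩, by simp, hoff _, hoff _⟩ ?_
  · intro i
    by_cases hi : i ∈ s
    · rw [hall hi]
    · rw [hout' hi]
      exact Dvd.dvd.mul_right (Int.natCast_dvd_natCast.2 (he i)) _
  · intro i
    rw [hneg]
    have := hn i
    omega
  · intro I hI
    have key : ∀ l : s, some l ∈ I ↔ none ∈ I := by
      intro l
      have h1 := hI l
      have := hn l
      rw [hin l.2] at h1
      split_ifs at h1 with h2 h3 h3
      · simp [h2, h3]
      · have := eq_zero_of_dvd h1 (by omega) (by omega)
        omega
      · have := eq_zero_of_dvd h1 (by omega) (by omega)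
        omega
      · simp only [h2, iff_false]
        exact h3
    by_cases h : none ∈ I
    · right
      ext j
      cases j <;> simp [key, h]
    · left
      ext j
      cases j <;> simp [key, h]
  · simp only [hneg, Nat.cast_zero, zero_mul, add_zero]
    have hval : ∀ i, ((∑ j, (m j i).toNat : ℕ) : ℚ) = ((∑ j, m j i : ℤ) : ℚ) := fun i => by
      rw [← hpos, Int.cast_natCast]
    simp only [hval]
    have h1 : ∑ i ∈ sᶜ, (q : ℚ) ≤ ∑ i ∈ sᶜ, ((∑ j, m j i : ℤ) : ℚ) / n i := by
      refine Finset.sum_le_sum fun i hi => ?_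
      rw [hout' (Finset.mem_compl.1 hi)]
      have h2 : (n i : ℚ) ≤ e := by exact_mod_cast Nat.le_of_dvd he0 (he i)
      have h3 : (0 : ℚ) < n i := by have := hn i; positivity
      rw [le_div_iff₀ h3]
      push_cast
      nlinarith [(Nat.cast_nonneg q : (0 : ℚ) ≤ q)]
    rw [Finset.sum_const, nsmul_eq_mul] at h1
    push_cast
    refine h1.trans ?_
    push_cast
    refine Finset.sum_le_univ_sum_of_nonneg fun i => ?_
    have : (0 : ℚ) ≤ ∑ j, (m j i : ℚ) := Finset.sum_nonneg fun j _ => by exact_mod_cast hm0 j i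
    positivity

end MoreLowerBounds

end Krull

namespace Krull

/-! ### Upper bounds for small groups: common tools and the Klein group. -/

section SmallGroups

variable {Q G : Type*} [AddCommGroup G] {c : Q → G}

lemma IsAtomOver.map {A : Multiset Q} (hA : IsAtomOver c A) : IsAtomOver (id : G → G) (A.map c) :=
  isAtomOver_map_iff.2 hA

lemma IsAtomOver.eq_of_le_zeroSum {A B : Multiset Q} (hA : IsAtomOver c A) (hB : B ≤ A)
    (h0 : ZeroSumOver c B) (hne : B ≠ 0) : A = B :=
  ((hA.3 B hB h0).resolve_left hne).symm

/-- If atoms with a common term agree, then the monoid is free. -/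
theorem tameLE_zero_of_eq
    (h : ∀ A B, IsAtomOver c A → IsAtomOver c B → ∀ q ∈ A, q ∈ B → A = B) : TameLE c 0 := by
  intro Z hZ U hU hUZ
  obtain ⟨q, hq⟩ := Multiset.exists_mem_of_ne_zero hU.1
  obtain ⟨A, hA, hqA⟩ := mem_sum_iff.1 (Multiset.mem_of_le hUZ hq)
  exact ⟨Z, hZ, rfl, h A U (hZ A hA) hU q hqA hq ▸ hA, by simp, by simp⟩

/-- The tame degree is at most three if atoms have length at most three and the atoms of length
three are disjoint. -/
theorem tameLE_three (h3 : ∀ A : Multiset G, IsAtomOver id A → A.card ≤ 3)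
    (heq : ∀ A B : Multiset G, IsAtomOver id A → IsAtomOver id B → A.card = 3 → B.card = 3 →
      ∀ g ∈ A, g ∈ B → A = B) : TameLE c 3 := by
  have h3' : ∀ A : Multiset Q, IsAtomOver c A → A.card ≤ 3 := fun A hA => by
    simpa using h3 _ hA.map
  refine tameLE_of_hasShortFact fun Z U W h hs h0 h1 => ?_
  have hk := h3' U h.atom
  have hm := h.card_le
  refine ⟨hm.trans hk, ?_⟩
  have hcard := congrArg Multiset.card hs
  rw [Multiset.card_add] at hcard
  by_cases h5 : W.card ≤ 5
  · exact (hasShortFact_half h0 h1).mono (by omega)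
  have hZ3 := card_sum_le fun A hA => h3' A (h.atoms A hA)
  -- Six or more terms in `W` are only possible if `U` and exactly three members of `Z` have length
  -- three. By disjointness they all agree with `U` in values, so `W` has the values of `U` taken
  -- twice.
  have hall : ∀ A ∈ Z, A.card = 3 := by
    intro A hA
    obtain ⟨Z₁, rfl⟩ := Multiset.exists_cons_of_mem hA
    have h4 := card_sum_le (Z := Z₁) fun A hA => h3' A (h.atoms A (by simp [hA]))
    have h6 := h3' A (h.atoms A (by simp))
    simp only [Multiset.sum_cons, Multiset.card_add, Multiset.card_cons] at *
    omega
  have hmap : ∀ A ∈ Z, A.map c = U.map c := by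
    intro A hA
    obtain ⟨q, hqA, hqU⟩ := h.exists_mem hA
    exact heq _ _ (h.atoms A hA).map h.atom.map (by simpa using hall A hA)
      (by rw [Multiset.card_map]; omega) (c q) (Multiset.mem_map_of_mem c hqA)
      (Multiset.mem_map_of_mem c hqU)
  have hsum : ∀ Z : Multiset (Multiset Q), (∀ A ∈ Z, A.map c = U.map c) →
      Z.sum.map c = Z.card • U.map c := by
    intro Z hZ
    induction Z using Multiset.induction with
    | empty => simp
    | cons A Z ih =>
      rw [Multiset.sum_cons, Multiset.map_add, hZ A (by simp), ih fun B hB => hZ B (by simp [hB]),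
        Multiset.card_cons, add_smul, one_smul, add_comm]
  have hZc : Z.card = 3 := by omega
  have h6 := hsum Z hmap
  rw [hs, Multiset.map_add, hZc, show 3 • U.map c = U.map c + (U.map c + U.map c) by
    rw [← add_assoc]; simp [succ_nsmul], add_right_inj] at h6
  refine HasShortFact.of_map ?_
  rw [h6]
  exact h.atom.map.hasShortFact.add h.atom.map.hasShortFact

section ExponentTwo

lemma nodup_or_eq_pair {A : Multiset G} (h2 : ∀ g : G, g + g = 0) (hA : IsAtomOver id A) :
    A.Nodup ∨ ∃ g, A = {g, g} := by
  by_contra! hne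
  obtain ⟨hnd, hne⟩ := hne
  rw [Multiset.nodup_iff_le] at hnd
  push Not at hnd
  obtain ⟨g, hg⟩ := hnd
  refine hne g (hA.eq_of_le_zeroSum hg ?_ (by simp))
  simpa [ZeroSumOver] using h2 g

lemma zero_notMem_of_two_le {A : Multiset Q} (hA : IsAtomOver c A) (h : 2 ≤ A.card) :
    ∀ q ∈ A, c q ≠ 0 := by
  intro q hq h0
  rw [hA.eq_singleton hq h0] at h
  simp at h

lemma card_le_of_exponent_two [Fintype G] (h2 : ∀ g : G, g + g = 0) {A : Multiset G}
    (hA : IsAtomOver id A) (hG : 3 ≤ Fintype.card G) : A.card ≤ Fintype.card G - 1 := by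
  classical
  by_cases h : 2 ≤ A.card
  · rcases nodup_or_eq_pair h2 hA with hnd | ⟨g, rfl⟩
    · have h0 := zero_notMem_of_two_le hA h
      have : (⟨A, hnd⟩ : Finset G) ⊆ Finset.univ.erase 0 := fun g hg =>
        Finset.mem_erase.2 ⟨h0 g hg, Finset.mem_univ g⟩
      have := Finset.card_le_card this
      rwa [Finset.card_erase_of_mem (Finset.mem_univ _), Finset.card_univ] at this
    · simp
      omega
  · omega

/-- The Klein four-group. -/
theorem tameLE_klein [Fintype G] (h2 : ∀ g : G, g + g = 0) (hG : Fintype.card G = 4) :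
    TameLE c 3 := by
  classical
  have key : ∀ A : Multiset G, IsAtomOver id A → A.card = 3 →
      A = (Finset.univ.erase (0 : G)).val := by
    intro A hA h3
    rcases nodup_or_eq_pair h2 hA with hnd | ⟨g, rfl⟩
    · have h0 := zero_notMem_of_two_le hA (by omega)
      have h4 : (⟨A, hnd⟩ : Finset G) ⊆ Finset.univ.erase 0 := fun g hg =>
        Finset.mem_erase.2 ⟨h0 g hg, Finset.mem_univ g⟩
      have := Finset.eq_of_subset_of_card_le h4 (by
        rw [Finset.card_erase_of_mem (Finset.mem_univ _), Finset.card_univ, hG]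
        exact h3.ge)
      exact congrArg Finset.val this
    · simp at h3
  refine tameLE_three (fun A hA => ?_) fun A B hA hB h3 h3' _ _ _ => by rw [key A hA h3, key B hB h3']
  have := card_le_of_exponent_two h2 hA (by omega)
  omega

/-- Distinct subsets have distinct sums: in exponent two, equal sums make the symmetric difference a
zero-sum subset. -/
lemma two_pow_card_le [Fintype G] (h2 : ∀ g : G, g + g = 0) {T : Finset G}
    (hT : ∀ S ⊆ T, ∑ g ∈ S, g = 0 → S = ∅) : 2 ^ T.card ≤ Fintype.card G := by
  classical
  rw [← Finset.card_powerset, ← Finset.card_univ]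
  refine Finset.card_le_card_of_injOn (fun S => ∑ g ∈ S, g) (fun _ _ => Finset.mem_univ _) ?_
  intro S hS S' hS' hEq
  rw [Finset.mem_coe, Finset.mem_powerset] at hS hS'
  have hneg : ∀ g : G, -g = g := fun g => neg_eq_of_add_eq_zero_left (h2 g)
  have h1 := hT (symmDiff S S') (fun g hg => by
    rcases Finset.mem_symmDiff.1 hg with h | h
    exacts [hS h.1, hS' h.1]) (by
    have hd : Disjoint (S \ S') (S' \ S) := disjoint_sdiff_sdiff
    have : symmDiff S S' = (S \ S') ∪ (S' \ S) := rfl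
    rw [this, Finset.sum_union hd]
    have e1 := Finset.sum_inter_add_sum_sdiff S S' (fun g => g)
    have e2 := Finset.sum_inter_add_sum_sdiff S' S (fun g => g)
    rw [Finset.inter_comm] at e2
    simp only at hEq
    have e3 : ∑ g ∈ S \ S', g = ∑ g ∈ S' \ S, g := by
      apply add_left_cancel (a := ∑ g ∈ S ∩ S', g)
      rw [e1, e2, hEq]
    rw [e3, h2])
  exact symmDiff_eq_bot.1 h1

end ExponentTwo

end SmallGroups

end Krull

namespace Krull

set_option linter.unusedSectionVars false

/-! ### The elementary group of order eight. -/

section OrderEight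

variable {G : Type*} [AddCommGroup G] [Fintype G]

lemma nodup_of_three_le (h2 : ∀ g : G, g + g = 0) {A : Multiset G} (hA : IsAtomOver id A)
    (h3 : 3 ≤ A.card) : A.Nodup := by
  rcases nodup_or_eq_pair h2 hA with h | ⟨g, rfl⟩
  · exact h
  · simp at h3

lemma sum_ne_zero_of_cons {A T : Multiset G} {x : G} (hA : IsAtomOver id A) (hx : A = x ::ₘ T)
    {S : Multiset G} (hS : S ≤ T) (h0 : S.sum = 0) : S = 0 := by
  subst hx
  rcases hA.3 S (hS.trans (Multiset.le_cons_self _ _)) (by simpa [ZeroSumOver] using h0) with h | h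
  · exact h
  · have := Multiset.card_le_card hS
    rw [h, Multiset.card_cons] at this
    omega

lemma two_pow_card_le_of_atom (h2 : ∀ g : G, g + g = 0) {A : Multiset G}
    (hA : IsAtomOver id A) (h3 : 3 ≤ A.card) : 2 ^ (A.card - 1) ≤ Fintype.card G := by
  have hnd := nodup_of_three_le h2 hA h3
  obtain ⟨x, hx⟩ := Multiset.exists_mem_of_ne_zero hA.1
  obtain ⟨T, rfl⟩ := Multiset.exists_cons_of_mem hx
  have hT : T.Nodup := (Multiset.nodup_cons.1 hnd).2
  have := two_pow_card_le h2 (T := ⟨T, hT⟩) fun S hS h0 => by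
    have hle : S.val ≤ T := Finset.val_le_iff.2 hS
    exact Finset.val_eq_zero.1 (sum_ne_zero_of_cons hA rfl hle (by rw [Finset.sum_val]; exact h0))
  simpa using this

lemma card_le_four (h2 : ∀ g : G, g + g = 0) (hG : Fintype.card G = 8) {A : Multiset G}
    (hA : IsAtomOver id A) : A.card ≤ 4 := by
  by_contra hlt
  have h := two_pow_card_le_of_atom h2 hA (by omega)
  have : 2 ^ 4 ≤ 2 ^ (A.card - 1) := Nat.pow_le_pow_right (by norm_num) (by omega)
  omega

/-- Three terms of `U` form a basis and the fourth is their sum. The sum of coordinates `χ` is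
therefore one on `U`, and its fibre over one has only four elements. -/
lemma exists_parity (h2 : ∀ g : G, g + g = 0) (hG : Fintype.card G = 8) {U : Multiset G}
    (hU : IsAtomOver id U) (h4 : U.card = 4) :
    ∃ χ : G →+ ZMod 2, ∀ g, χ g = 1 ↔ g ∈ U := by
  classical
  have hnd := nodup_of_three_le h2 hU (by omega)
  obtain ⟨x, hx⟩ := Multiset.exists_mem_of_ne_zero hU.1
  obtain ⟨T, hT⟩ := Multiset.exists_cons_of_mem hx
  have hTnd : T.Nodup := (Multiset.nodup_cons.1 (hT ▸ hnd)).2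
  have hT3 : T.card = 3 := by
    rw [hT, Multiset.card_cons] at h4
    omega
  let _ : Module (ZMod 2) G := AddCommGroup.zmodModule (n := 2) fun g => by rw [two_nsmul, h2]
  let F : Finset G := ⟨T, hTnd⟩
  have hli : LinearIndependent (ZMod 2) (fun t : F => (t : G)) := by
    rw [Fintype.linearIndependent_iff]
    intro ε hε t
    have hsmul : ∀ t : F, ε t • (t : G) = if ε t = 1 then (t : G) else 0 := by
      intro t
      generalize ε t = a
      have h : ∀ a : ZMod 2, a = 0 ∨ a = 1 := by decide
      rcases h a with rfl | rfl
      · rw [zero_smul, if_neg (by decide)]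
      · rw [one_smul, if_pos rfl]
    simp only [hsmul] at hε
    rw [← Finset.sum_filter] at hε
    let S : Finset F := Finset.univ.filter fun t => ε t = 1
    have hS : (S.map (Function.Embedding.subtype _)).val = 0 := by
      refine sum_ne_zero_of_cons hU hT ?_ ?_
      · refine Finset.val_le_iff (s₂ := F).2 fun g hg => ?_
        obtain ⟨t, -, rfl⟩ := Finset.mem_map.1 hg
        exact t.2
      · have : ∑ g ∈ S.map (Function.Embedding.subtype _), g = 0 := by
          rw [Finset.sum_map]
          exact hε
        rw [Finset.sum_val]
        exact this
    have hS' : S = ∅ := by simpa using hS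
    by_contra hne
    have h1 : ε t = 1 := by
      have h : ∀ a : ZMod 2, a ≠ 0 → a = 1 := by decide
      exact h _ hne
    have : t ∈ S := by simp [S, h1]
    simp [hS'] at this
  have hrank : Module.finrank (ZMod 2) G = 3 := by
    have h := Module.card_eq_pow_finrank (K := ZMod 2) (V := G)
    rw [hG, ZMod.card] at h
    exact (Nat.pow_right_injective le_rfl (h.symm.trans (by norm_num : 8 = 2 ^ 3)))
  have : Nonempty F := by
    obtain ⟨t, ht⟩ := Multiset.card_pos_iff_exists_mem.1 (show 0 < T.card by omega)
    exact ⟨⟨t, ht⟩⟩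
  let b := basisOfLinearIndependentOfCardEqFinrank hli (by
    rw [hrank, Fintype.card_coe]
    exact hT3)
  let χ : G →+ ZMod 2 := (b.sumCoords : G →ₗ[ZMod 2] ZMod 2).toAddMonoidHom
  have hχT : ∀ t ∈ T, χ t = 1 := by
    intro t ht
    have hb : b ⟨t, ht⟩ = t := by simp [b]
    change b.sumCoords t = 1
    rw [← hb, Module.Basis.sumCoords_self_apply]
  have hχx : χ x = 1 := by
    have hz : U.sum = 0 := by simpa [ZeroSumOver] using hU.2
    have h := congrArg χ hz
    rw [hT, Multiset.sum_cons, map_add, map_zero, map_multiset_sum,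
      Multiset.map_congr rfl hχT, Multiset.map_const', Multiset.sum_replicate, hT3] at h
    have h' : ∀ a : ZMod 2, a + 3 • (1 : ZMod 2) = 0 → a = 1 := by decide
    exact h' _ h
  have hsub : ∀ g ∈ U, χ g = 1 := by
    intro g hg
    rw [hT, Multiset.mem_cons] at hg
    rcases hg with rfl | hg
    exacts [hχx, hχT g hg]
  refine ⟨χ, fun g => ⟨fun hg => ?_, hsub g⟩⟩
  let O : Finset G := Finset.univ.filter fun g => χ g = 1
  -- Translation by `x`, where `χ x = 1`, moves this fibre off itself.
  have hO : 2 * O.card ≤ 8 := by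
    have h1 : (O.image fun g => g + x).card = O.card :=
      Finset.card_image_of_injective _ (add_left_injective x)
    have h3 : Disjoint O (O.image fun g => g + x) := by
      rw [Finset.disjoint_left]
      intro a ha ha'
      obtain ⟨g, hg, rfl⟩ := Finset.mem_image.1 ha'
      simp only [O, Finset.mem_filter, Finset.mem_univ, true_and, map_add, hχx] at ha hg
      rw [hg] at ha
      exact absurd ha (by decide)
    have h5 := Finset.card_le_univ (O ∪ O.image fun g => g + x)
    rw [Finset.card_union_of_disjoint h3, h1, hG] at h5
    omega
  have hUO : (⟨U, hnd⟩ : Finset G) = O := by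
    refine Finset.eq_of_subset_of_card_le (fun g hg => ?_) ?_
    · simp only [O, Finset.mem_filter, Finset.mem_univ, true_and]
      exact hsub g hg
    · change O.card ≤ U.card
      omega
  have : g ∈ O := by simp [O, hg]
  rw [← hUO] at this
  exact this

/-- Applying the parity character of `U` to the zero sum of `V` shows that the number of terms of
`V` in `U` is even; a common term makes it positive. -/
lemma two_le_card_inter_aux [DecidableEq G] (h2 : ∀ g : G, g + g = 0) (hG : Fintype.card G = 8)
    {U V : Multiset G} (hU : IsAtomOver id U) (hV : IsAtomOver id V) (hU4 : U.card = 4)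
    (hV3 : 3 ≤ V.card) {x : G} (hxU : x ∈ U) (hxV : x ∈ V) : 2 ≤ (U ∩ V).card := by
  obtain ⟨χ, hχ⟩ := exists_parity h2 hG hU hU4
  have hnd := nodup_of_three_le h2 hV hV3
  have h1 : V.filter (· ∈ U) ≤ U ∩ V := by
    refine Multiset.le_inter ?_ (Multiset.filter_le _ _)
    rw [Multiset.le_iff_subset (hnd.filter _)]
    intro g hg
    exact (Multiset.mem_filter.1 hg).2
  have h3 := Multiset.card_le_card h1
  have h4 : 0 < (V.filter (· ∈ U)).card :=
    Multiset.card_pos_iff_exists_mem.2 ⟨x, Multiset.mem_filter.2 ⟨hxV, hxU⟩⟩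
  have h5 : (((V.filter (· ∈ U)).card : ℕ) : ZMod 2) = 0 := by
    have hz : V.sum = 0 := by simpa [ZeroSumOver] using hV.2
    have h := congrArg χ hz
    rw [map_zero, map_multiset_sum] at h
    rw [← h]
    have hχ' : ∀ g, χ g = if g ∈ U then 1 else 0 := by
      intro g
      split_ifs with hg
      · exact (hχ g).2 hg
      · have h' : ∀ a : ZMod 2, a ≠ 1 → a = 0 := by decide
        exact h' _ fun h'' => hg ((hχ g).1 h'')
    simp only [hχ']
    clear h1 h3 h4 h hz hnd hV hV3 hxV
    induction V using Multiset.induction with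
    | empty => simp
    | cons g V ih =>
      by_cases hg : g ∈ U
      · simp [hg, ih, add_comm]
      · simp [hg, ih]
  rw [ZMod.natCast_eq_zero_iff] at h5
  omega

lemma two_le_card_inter [DecidableEq G] (h2 : ∀ g : G, g + g = 0) (hG : Fintype.card G = 8)
    {U V : Multiset G} (hU : IsAtomOver id U) (hV : IsAtomOver id V) (hU3 : 3 ≤ U.card)
    (hV3 : 3 ≤ V.card) (h7 : 7 ≤ U.card + V.card) {x : G} (hxU : x ∈ U) (hxV : x ∈ V) :
    2 ≤ (U ∩ V).card := by
  have h4U := card_le_four h2 hG hU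
  have h4V := card_le_four h2 hG hV
  by_cases h : U.card = 4
  · exact two_le_card_inter_aux h2 hG hU hV h hV3 hxU hxV
  · rw [Multiset.inter_comm]
    exact two_le_card_inter_aux h2 hG hV hU (by omega) hU3 hxV hxU

lemma hasShortFact_of_pairs (h2 : ∀ g : G, g + g = 0) (S : Multiset G) :
    ZeroSumOver (id : G → G) (S + S) := by
  simp [ZeroSumOver, h2]

/-- A zero-sum sequence of length eight, without terms of multiplicity four, over the elementary
group of order eight. -/
lemma hasShortFact_three (h2 : ∀ g : G, g + g = 0) (hG : Fintype.card G = 8) {W : Multiset G}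
    [DecidableEq G] (hW : ZeroSumOver (id : G → G) W) (h0 : ∀ g ∈ W, g ≠ 0) (h8 : W.card = 8)
    (h3 : ∀ g, Multiset.count g W ≤ 3) : HasShortFact (id : G → G) W 3 := by
  obtain ⟨Y, hY, rfl⟩ := exists_atoms_sum_eq hW
  by_cases hY3 : Y.card ≤ 3
  · exact ⟨Y, hY, rfl, hY3⟩
  have hY4 : Y.card = 4 := by
    have := two_mul_card_le_card_sum hY h0
    omega
  -- Four atoms of length at least two in eight terms all have length two, that is, they are
  -- squares.
  have hpair : ∀ A ∈ Y, ∃ g, A = {g, g} := by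
    intro A hA
    obtain ⟨Y₁, rfl⟩ := Multiset.exists_cons_of_mem hA
    have h4 := two_mul_card_le_card_sum (c := (id : G → G)) (Y := Y₁)
      (fun B hB => hY B (by simp [hB])) (fun g hg => h0 g (by simp [hg]))
    simp only [Multiset.sum_cons, Multiset.card_add, Multiset.card_cons] at h8 hY4
    have hA' := hY A (by simp)
    have hc : A.card ≤ 2 := by omega
    have hA0 : ∀ g ∈ A, g ≠ 0 := fun g hg => h0 g (by simp [hg])
    have hc2 := hA'.two_le_card hA0
    obtain ⟨a, b, rfl⟩ := Multiset.card_eq_two.1 (by omega : A.card = 2)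
    have hz := hA'.2
    simp only [ZeroSumOver, Multiset.insert_eq_cons, Multiset.map_cons, Multiset.map_singleton,
      Multiset.sum_cons, Multiset.sum_singleton, id] at hz
    refine ⟨a, ?_⟩
    have : b = a := by
      rw [← add_left_cancel_iff (a := a), hz, h2]
    rw [this]
  obtain ⟨S, hS⟩ : ∃ S : Multiset G, Y.sum = S + S := by
    clear hY3 hY4 h8 h3 h0 hW hY
    induction Y using Multiset.induction with
    | empty => exact ⟨0, by simp⟩
    | cons A Y ih =>
      obtain ⟨S, hS⟩ := ih fun B hB => hpair B (by simp [hB])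
      obtain ⟨g, rfl⟩ := hpair A (by simp)
      refine ⟨g ::ₘ S, ?_⟩
      rw [Multiset.sum_cons, hS]
      simp [Multiset.cons_add, Multiset.add_cons]
  rw [hS] at h0 h8 h3 ⊢
  rw [Multiset.card_add] at h8
  have hSnd : S.Nodup := by
    rw [Multiset.nodup_iff_count_le_one]
    intro g
    have := h3 g
    rw [Multiset.count_add] at this
    omega
  -- Four distinct elements cannot be zero-sum free, as `2 ^ 4 > 8`. An atom `A` inside `S` has
  -- length at least three, so `S + S` is two copies of `A` and at most one square.
  obtain ⟨R, hRS, hR0, hRne⟩ : ∃ R : Finset G, R.val ≤ S ∧ ∑ g ∈ R, g = 0 ∧ R ≠ ∅ := by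
    by_contra! hno
    have := two_pow_card_le h2 (T := ⟨S, hSnd⟩) fun R hR hR0 =>
      hno R (Finset.val_le_iff (s₂ := ⟨S, hSnd⟩).2 hR) hR0
    rw [hG] at this
    change 2 ^ S.card ≤ 8 at this
    rw [show S.card = 4 by omega] at this
    omega
  obtain ⟨g, hg⟩ := Finset.nonempty_iff_ne_empty.2 hRne
  obtain ⟨A, hAR, hA, -⟩ := exists_isAtomOver_le (c := (id : G → G)) (S := R.val)
    (by rw [ZeroSumOver, Multiset.map_id, Finset.sum_val]; exact hR0) hg
  obtain ⟨B, rfl⟩ := Multiset.le_iff_exists_add.1 (hAR.trans hRS)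
  have hA3 : 3 ≤ A.card := by
    have hA2 := hA.two_le_card fun g hg => h0 g (by simp [hg])
    by_contra hlt
    obtain ⟨a, b, rfl⟩ := Multiset.card_eq_two.1 (by omega : A.card = 2)
    have hz := hA.2
    simp only [ZeroSumOver, Multiset.insert_eq_cons, Multiset.map_cons, Multiset.map_singleton,
      Multiset.sum_cons, Multiset.sum_singleton, id] at hz
    have : b = a := by
      rw [← add_left_cancel_iff (a := a), hz, h2]
    subst this
    simpa using Multiset.nodup_of_le (Multiset.le_add_right _ _) hSnd
  rw [Multiset.card_add] at h8
  have hB := hasShortFact_half (hasShortFact_of_pairs h2 B) fun g hg =>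
    h0 g (by simp only [Multiset.mem_add] at hg ⊢; tauto)
  rw [show A + B + (A + B) = A + A + (B + B) by abel]
  exact ((hA.hasShortFact.add hA.hasShortFact).add hB).mono (by rw [Multiset.card_add]; omega)

/-- The zero-sum sequences over the elementary group of order eight. -/
theorem tameLE_eight (h2 : ∀ g : G, g + g = 0) (hG : Fintype.card G = 8) :
    TameLE (id : G → G) 4 := by
  classical
  refine tameLE_of_hasShortFact fun Z U W h hs h0 h1 => ?_
  have h4 : ∀ A ∈ Z, A.card ≤ 4 := fun A hA => card_le_four h2 hG (h.atoms A hA)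
  have hU4 := card_le_four h2 hG h.atom
  have hm := h.card_le
  have hcard := congrArg Multiset.card hs
  rw [Multiset.card_add] at hcard
  have hsum := card_sum_le h4
  have hhalf := hasShortFact_half h0 h1
  refine ⟨by omega, ?_⟩
  by_cases h7 : W.card ≤ 7
  · exact hhalf.mono (by omega)
  by_cases hshare : ∃ A ∈ Z, 2 ≤ (U ∩ A).card
  · obtain ⟨A, hA, hA2⟩ := hshare
    have hlt := h.card_lt hA hA2
    -- At least eight terms in `W` then force three members of length four, `U.card = 4` and `W.card
    -- = 8`. All members are square-free, so multiplicities in `W` are at most three.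
    have hZ3 : Z.card = 3 := by omega
    have hnd : ∀ B ∈ Z, B.Nodup := by
      intro B hB
      obtain ⟨Z₁, rfl⟩ := Multiset.exists_cons_of_mem hB
      have h5 := card_sum_le (Z := Z₁) fun A hA => h4 A (by simp [hA])
      simp only [Multiset.sum_cons, Multiset.card_add, Multiset.card_cons] at *
      exact nodup_of_three_le h2 (h.atoms B (by simp)) (by omega)
    refine hasShortFact_three h2 hG h0 h1 (by omega) fun g => ?_
    have hcount : ∀ Z : Multiset (Multiset G), (∀ B ∈ Z, B.Nodup) →
        Multiset.count g Z.sum ≤ Z.card := by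
      intro Z hZ
      induction Z using Multiset.induction with
      | empty => simp
      | cons B Z ih =>
        have h5 := ih fun B hB => hZ B (by simp [hB])
        have h6 := Multiset.nodup_iff_count_le_one.1 (hZ B (by simp)) g
        rw [Multiset.sum_cons, Multiset.count_add, Multiset.card_cons]
        omega
    have h5 := hcount Z hnd
    rw [hs, Multiset.count_add] at h5
    omega
  · exfalso
    push Not at hshare
    by_cases hU3 : 3 ≤ U.card
    -- A longer member would share two terms with `U` by parity. With members this short, `W` cannot
    -- have eight terms.
    · have hsmall : ∀ A ∈ Z, A.card ≤ 6 - U.card := by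
        intro A hA
        obtain ⟨x, hxA, hxU⟩ := h.exists_mem hA
        by_contra hlt
        have := two_le_card_inter h2 hG h.atom (h.atoms A hA) hU3 (by omega) (by omega) hxU hxA
        have := hshare A hA
        omega
      have h5 := card_sum_le hsmall
      have h6 : Z.card * (6 - U.card) ≤ U.card * (6 - U.card) := Nat.mul_le_mul_right _ hm
      interval_cases hu : U.card <;> omega
    · omega

end OrderEight

end Krull

namespace Krull

set_option linter.unusedSectionVars false

/-! ### Groups of order at most two. -/

section OrderTwo

variable {G : Type*} [AddCommGroup G] [Fintype G]

lemma atom_eq_pair_of_card_le_two (h2 : ∀ g : G, g + g = 0) (hG : Fintype.card G ≤ 2)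
    {A : Multiset G} (hA : IsAtomOver id A) {g : G} (hg : g ∈ A) (h0 : g ≠ 0) : A = {g, g} := by
  classical
  rcases nodup_or_eq_pair h2 hA with hnd | ⟨h, rfl⟩
  · exfalso
    by_cases hA2 : 2 ≤ A.card
    · have h3 := zero_notMem_of_two_le hA hA2
      have : (⟨A, hnd⟩ : Finset G) ⊆ Finset.univ.erase 0 := fun g hg =>
        Finset.mem_erase.2 ⟨h3 g hg, Finset.mem_univ g⟩
      have := Finset.card_le_card this
      rw [Finset.card_erase_of_mem (Finset.mem_univ _), Finset.card_univ] at this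
      change A.card ≤ _ at this
      omega
    · have := Multiset.card_pos.2 hA.1
      obtain ⟨a, rfl⟩ := Multiset.card_eq_one.1 (show A.card = 1 by omega)
      rw [Multiset.mem_singleton] at hg
      subst hg
      exact h0 (by simpa [ZeroSumOver] using hA.2)
  · have : g = h := by simpa using hg
    rw [this]

theorem tameLE_zero_of_card_le_two (h2 : ∀ g : G, g + g = 0) (hG : Fintype.card G ≤ 2) :
    TameLE (id : G → G) 0 := by
  refine tameLE_zero_of_eq fun A B hA hB g hgA hgB => ?_
  by_cases h0 : g = 0
  · rw [hA.eq_singleton hgA h0, hB.eq_singleton hgB h0]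
  · rw [atom_eq_pair_of_card_le_two h2 hG hA hgA h0, atom_eq_pair_of_card_le_two h2 hG hB hgB h0]

theorem tameLE_two_of_card_le_two {Q : Type*} {c : Q → G} (h2 : ∀ g : G, g + g = 0)
    (hG : Fintype.card G ≤ 2) : TameLE c 2 := by
  -- For atoms of length at most two the general bound is `1 + 2 * 1 / 2 = 2`.
  refine tameLE_of_card_le (D := 2) fun A hA => ?_
  rw [← Multiset.card_map c A]
  obtain ⟨g, hg⟩ := Multiset.exists_mem_of_ne_zero hA.map.1
  by_cases h0 : g = 0
  · rw [hA.map.eq_singleton hg h0]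
    simp
  · rw [atom_eq_pair_of_card_le_two h2 hG hA.map hg h0]
    simp

end OrderTwo

/-! ### The group of order three. -/

section OrderThree

lemma atom_zmod_three {A : Multiset (ZMod 3)} (hA : IsAtomOver id A) {g : ZMod 3} (hg : g ∈ A)
    (h0 : g ≠ 0) : A = {g, -g} ∨ A = Multiset.replicate 3 g := by
  by_cases hneg : -g ∈ A
  · left
    have hne : ∀ g : ZMod 3, g ≠ 0 → -g ≠ g := by decide
    obtain ⟨R, rfl⟩ := Multiset.exists_cons_of_mem hg
    rw [Multiset.mem_cons, or_iff_right (hne g h0)] at hneg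
    exact hA.eq_of_le_zeroSum ((Multiset.cons_le_cons_iff _).2 (Multiset.singleton_le.2 hneg))
      (by simp [ZeroSumOver]) (by simp)
  · right
    have key : ∀ g h : ZMod 3, g ≠ 0 → h ≠ 0 → h ≠ -g → h = g := by decide
    have hA0 : ∀ h ∈ A, h ≠ 0 := by
      rintro h hh rfl
      rw [hA.eq_singleton hh rfl, Multiset.mem_singleton] at hg
      exact h0 hg
    have hrep := Multiset.eq_replicate_card.2 fun h hh =>
      key g h h0 (hA0 h hh) fun h' => hneg (h' ▸ hh)
    have hz := hA.2
    rw [hrep, ZeroSumOver, Multiset.map_id, Multiset.sum_replicate] at hz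
    have h3 : 3 ≤ A.card := by
      by_contra hlt
      have hpos := Multiset.card_pos.2 hA.1
      have h1 : ∀ g : ZMod 3, g ≠ 0 → 1 • g ≠ 0 ∧ 2 • g ≠ 0 := by decide
      interval_cases A.card
      exacts [(h1 g h0).1 hz, (h1 g h0).2 hz]
    refine hA.eq_of_le_zeroSum ?_ ?_ (by simp)
    · rw [hrep]
      exact (Multiset.replicate_le_replicate _).2 h3
    · have h1 : ∀ g : ZMod 3, 3 • g = 0 := by decide
      rw [ZeroSumOver, Multiset.map_id, Multiset.sum_replicate, h1]

theorem tameLE_zmod_three {Q : Type*} {c : Q → ZMod 3} : TameLE c 3 := by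
  refine tameLE_three (fun A hA => ?_) fun A B hA hB hA3 hB3 g hgA hgB => ?_
  · obtain ⟨g, hg⟩ := Multiset.exists_mem_of_ne_zero hA.1
    by_cases h0 : g = 0
    · rw [hA.eq_singleton hg h0]
      simp
    · rcases atom_zmod_three hA hg h0 with h | h <;> simp [h]
  · have h0 : g ≠ 0 := zero_notMem_of_two_le hA (by omega) g hgA
    rcases atom_zmod_three hA hgA h0 with h | h
    · simp [h] at hA3
    rcases atom_zmod_three hB hgB h0 with h' | h'
    · simp [h'] at hB3
    rw [h, h']

end OrderThree

/-! ### The cyclic group of order four. -/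

section OrderFour

/-- A sequence over `ZMod 4` with prescribed numbers of terms `g`, `2` and `-g`. -/
def seqFour (g : ZMod 4) (x y z : ℕ) : Multiset (ZMod 4) :=
  Multiset.replicate x g + Multiset.replicate y 2 + Multiset.replicate z (-g)

lemma seqFour_add (g : ZMod 4) (x y z x' y' z' : ℕ) :
    seqFour g x y z + seqFour g x' y' z' = seqFour g (x + x') (y + y') (z + z') := by
  simp only [seqFour, Multiset.replicate_add]
  abel

lemma seqFour_sum (g : ZMod 4) (x y z : ℕ) :
    (seqFour g x y z).sum = x • g + y • (2 : ZMod 4) + z • (-g) := by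
  simp [seqFour]

lemma seqFour_card (g : ZMod 4) (x y z : ℕ) : (seqFour g x y z).card = x + y + z := by
  simp [seqFour]

lemma seqFour_inj {g : ZMod 4} (hg : g = 1 ∨ g = -1) {x y z x' y' z' : ℕ}
    (h : seqFour g x y z = seqFour g x' y' z') : x = x' ∧ y = y' ∧ z = z' := by
  have h1 := congrArg (Multiset.count g) h
  have h2 := congrArg (Multiset.count 2) h
  have h3 := congrArg (Multiset.count (-g)) h
  simp only [seqFour, Multiset.count_add, Multiset.count_replicate] at h1 h2 h3
  have hne : g ≠ 2 ∧ g ≠ -g ∧ (2 : ZMod 4) ≠ -g := by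
    rcases hg with rfl | rfl <;> decide
  simp only [hne.1, hne.1.symm, hne.2.1, hne.2.1.symm, hne.2.2, hne.2.2.symm, if_true, if_false]
    at h1 h2 h3
  omega

lemma eq_seqFour {g : ZMod 4} (hg : g = 1 ∨ g = -1) (A : Multiset (ZMod 4)) (h0 : (0 : ZMod 4) ∉ A) :
    ∃ x y z, A = seqFour g x y z := by
  induction A using Multiset.induction with
  | empty => exact ⟨0, 0, 0, by simp [seqFour]⟩
  | cons a A ih =>
    obtain ⟨x, y, z, rfl⟩ := ih fun h => h0 (by simp [h])
    have ha : a ≠ 0 := fun h => h0 (by simp [h])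
    have key : ∀ g a : ZMod 4, g = 1 ∨ g = -1 → a ≠ 0 → a = g ∨ a = 2 ∨ a = -g := by decide
    rw [← Multiset.singleton_add]
    rcases key g a hg ha with rfl | rfl | rfl
    · exact ⟨1 + x, y, z, by rw [← zero_add y, ← zero_add z, ← seqFour_add]; simp [seqFour]⟩
    · exact ⟨x, 1 + y, z, by rw [← zero_add x, ← zero_add z, ← seqFour_add]; simp [seqFour]⟩
    · exact ⟨x, y, 1 + z, by rw [← zero_add y, ← zero_add x, ← seqFour_add]; simp [seqFour]⟩

lemma seqFour_le {g : ZMod 4} {x y z x' y' z' : ℕ} (h1 : x' ≤ x) (h2 : y' ≤ y) (h3 : z' ≤ z) :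
    seqFour g x' y' z' ≤ seqFour g x y z :=
  add_le_add (add_le_add ((Multiset.replicate_le_replicate _).2 h1)
    ((Multiset.replicate_le_replicate _).2 h2)) ((Multiset.replicate_le_replicate _).2 h3)

/-- In units of the generator `g`, the terms `g`, `2`, `-g` are `1`, `2`, `3`. -/
lemma zeroSum_seqFour {g : ZMod 4} (hg : g = 1 ∨ g = -1) (x y z : ℕ) :
    ZeroSumOver id (seqFour g x y z) ↔ 4 ∣ x + 2 * y + 3 * z := by
  rw [ZeroSumOver, Multiset.map_id, seqFour_sum, ← ZMod.natCast_eq_zero_iff]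
  have h3 : (3 : ZMod 4) = -1 := by decide
  have h2 : (2 : ZMod 4) = -2 := by decide
  push_cast
  rw [h3]
  rcases hg with rfl | rfl
  · simp [mul_comm]
  · rw [← neg_eq_zero]
    simp only [nsmul_eq_mul]
    rw [show -((x : ZMod 4) * -1 + y * 2 + z * - -1) = x + y * -2 + z * -1 by ring, ← h2]
    ring_nf

/-- The possible counts of the terms `g`, `2`, `-g` in an atom over `ZMod 4`. -/
lemma atom_seqFour {g : ZMod 4} (hg : g = 1 ∨ g = -1) {x y z : ℕ}
    (hA : IsAtomOver id (seqFour g x y z)) :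
    (x = 4 ∧ y = 0 ∧ z = 0) ∨ (x = 2 ∧ y = 1 ∧ z = 0) ∨ (x = 1 ∧ y = 0 ∧ z = 1) ∨
      (x = 0 ∧ y = 2 ∧ z = 0) ∨ (x = 0 ∧ y = 1 ∧ z = 2) ∨ (x = 0 ∧ y = 0 ∧ z = 4) := by
  have key : ∀ x' y' z' : ℕ, 4 ∣ x' + 2 * y' + 3 * z' → 0 < x' + y' + z' →
      x' ≤ x → y' ≤ y → z' ≤ z → x = x' ∧ y = y' ∧ z = z' := by
    intro x' y' z' h4 hpos h1 h2 h3
    refine seqFour_inj hg (hA.eq_of_le_zeroSum (seqFour_le h1 h2 h3)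
      ((zeroSum_seqFour hg _ _ _).2 h4) fun h => ?_)
    have := congrArg Multiset.card h
    rw [seqFour_card, Multiset.card_zero] at this
    omega
  have h4 := (zeroSum_seqFour hg x y z).1 hA.2
  have hpos : 0 < x + y + z := by
    rw [← seqFour_card g]
    exact Multiset.card_pos.2 hA.1
  by_cases h101 : 1 ≤ x ∧ 1 ≤ z
  · obtain ⟨rfl, rfl, rfl⟩ := key 1 0 1 (by norm_num) (by norm_num) h101.1 (Nat.zero_le _) h101.2
    simp
  by_cases h020 : 2 ≤ y
  · obtain ⟨rfl, rfl, rfl⟩ :=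
      key 0 2 0 (by norm_num) (by norm_num) (Nat.zero_le _) h020 (Nat.zero_le _)
    simp
  by_cases h210 : 2 ≤ x ∧ 1 ≤ y
  · obtain ⟨rfl, rfl, rfl⟩ := key 2 1 0 (by norm_num) (by norm_num) h210.1 h210.2 (Nat.zero_le _)
    simp
  by_cases h012 : 1 ≤ y ∧ 2 ≤ z
  · obtain ⟨rfl, rfl, rfl⟩ := key 0 1 2 (by norm_num) (by norm_num) (Nat.zero_le _) h012.1 h012.2
    simp
  by_cases h400 : 4 ≤ x
  · obtain ⟨rfl, rfl, rfl⟩ :=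
      key 4 0 0 (by norm_num) (by norm_num) h400 (Nat.zero_le _) (Nat.zero_le _)
    simp
  by_cases h004 : 4 ≤ z
  · obtain ⟨rfl, rfl, rfl⟩ :=
      key 0 0 4 (by norm_num) (by norm_num) (Nat.zero_le _) (Nat.zero_le _) h004
    simp
  exfalso
  clear key hA
  have hx : x < 4 := by omega
  have hy : y < 2 := by omega
  have hz : z < 4 := by omega
  interval_cases x <;> interval_cases y <;> interval_cases z <;> omega

/-- Any factorization into two or more atoms would split off a proper part with counts from the list
in `atom_seqFour`, which none of these four allows. -/
lemma isAtomOver_seqFour {g : ZMod 4} (hg : g = 1 ∨ g = -1) {x y z : ℕ}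
    (h : (x = 4 ∧ y = 0 ∧ z = 0) ∨ (x = 2 ∧ y = 1 ∧ z = 0) ∨ (x = 1 ∧ y = 0 ∧ z = 1) ∨
      (x = 0 ∧ y = 2 ∧ z = 0)) : HasShortFact id (seqFour g x y z) 1 := by
  have hz : ZeroSumOver id (seqFour g x y z) := by
    rw [zeroSum_seqFour hg]
    omega
  have h0 : ∀ a ∈ seqFour g x y z, id a ≠ 0 := by
    intro a ha
    have hne : g ≠ 0 ∧ (2 : ZMod 4) ≠ 0 ∧ -g ≠ 0 := by rcases hg with rfl | rfl <;> decide
    simp only [seqFour, Multiset.mem_add, Multiset.mem_replicate] at ha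
    rcases ha with (⟨-, rfl⟩ | ⟨-, rfl⟩) | ⟨-, rfl⟩
    exacts [hne.1, hne.2.1, hne.2.2]
  obtain ⟨Y, hY, hs⟩ := exists_atoms_sum_eq hz
  refine ⟨Y, hY, hs, ?_⟩
  by_contra hlt
  have h2 : 2 ≤ Y.card := by omega
  obtain ⟨A, hA⟩ := Multiset.card_pos_iff_exists_mem.1 (show 0 < Y.card by omega)
  obtain ⟨Y, rfl⟩ := Multiset.exists_cons_of_mem hA
  have hA' := hY A (by simp)
  rw [Multiset.card_cons] at h2
  have hA0 : (0 : ZMod 4) ∉ A := fun h' => h0 0 (by rw [← hs]; simp [h']) rfl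
  have hR0 : (0 : ZMod 4) ∉ Y.sum := fun h' => h0 0 (by
    rw [← hs, Multiset.sum_cons]; exact Multiset.mem_add.2 (Or.inr h')) rfl
  obtain ⟨x₁, y₁, z₁, rfl⟩ := eq_seqFour hg A hA0
  obtain ⟨x₂, y₂, z₂, hR⟩ := eq_seqFour hg Y.sum hR0
  rw [Multiset.sum_cons, hR, seqFour_add] at hs
  have := seqFour_inj hg hs
  have hA1 := atom_seqFour hg hA'
  have hRpos : 0 < x₂ + y₂ + z₂ := by
    rw [← seqFour_card g, ← hR]
    have := two_mul_card_le_card_sum (c := (id : ZMod 4 → ZMod 4)) (Y := Y)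
      (fun B hB => hY B (by simp [hB])) (fun q hq h' => hR0 (h' ▸ hq))
    omega
  omega

lemma hasShortFact_seqFour {g : ZMod 4} (hg : g = 1 ∨ g = -1) (y₁ y₂ y₃ y₄ : ℕ) :
    HasShortFact id (seqFour g (4 * y₁ + 2 * y₂ + y₃) (y₂ + 2 * y₄) y₃) (y₁ + y₂ + y₃ + y₄) := by
  have key : ∀ (x y z : ℕ), HasShortFact id (seqFour g x y z) 1 → ∀ k : ℕ,
      HasShortFact id (seqFour g (k * x) (k * y) (k * z)) k := by
    intro x y z h k
    induction k with
    | zero => simpa [seqFour] using hasShortFact_zero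
    | succ k ih =>
      rw [add_mul, add_mul, add_mul, one_mul, one_mul, one_mul, ← seqFour_add]
      exact ih.add h
  have h1 := key 4 0 0 (isAtomOver_seqFour hg (by omega)) y₁
  have h2 := key 2 1 0 (isAtomOver_seqFour hg (by omega)) y₂
  have h3 := key 1 0 1 (isAtomOver_seqFour hg (by omega)) y₃
  have h4 := key 0 2 0 (isAtomOver_seqFour hg (by omega)) y₄
  have h := ((h1.add h2).add h3).add h4
  simp only [seqFour_add] at h
  convert h using 2 <;> ring

/-- Only the numbers of terms `g`, `2`, `-g` matter. Up to sign `U` is `g⁴`, `g² 2`, `g (-g)` or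
`2²`, and a cover is recorded by how often each of the six atom types occurs. Cofactors with at most
seven terms are harmless; the few longer ones are factored into at most three atoms explicitly. -/
theorem tameLE_zmod_four {Q : Type*} {c : Q → ZMod 4} : TameLE c 4 := by
  refine tameLE_of_hasShortFact fun Z U W h hs h0 h1 => ?_
  have hm := h.card_le
  have hU0 : (0 : ZMod 4) ∉ U.map c := by
    intro hm
    obtain ⟨q, hq, hq0⟩ := Multiset.mem_map.1 hm
    exact h.ne_zero' q hq hq0
  have hW0 : (0 : ZMod 4) ∉ W.map c := by
    intro hm
    obtain ⟨q, hq, hq0⟩ := Multiset.mem_map.1 hm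
    exact h1 q hq hq0
  -- choose the sign such that `U` has no term `-g`, unless it has length two
  obtain ⟨g, hg, a, b, d, hUg, hgen⟩ : ∃ g : ZMod 4, (g = 1 ∨ g = -1) ∧ ∃ a b d,
      U.map c = seqFour g a b d ∧ ((a = 4 ∧ b = 0 ∧ d = 0) ∨ (a = 2 ∧ b = 1 ∧ d = 0) ∨
        (a = 1 ∧ b = 0 ∧ d = 1) ∨ (a = 0 ∧ b = 2 ∧ d = 0)) := by
    obtain ⟨a, b, d, hU⟩ := eq_seqFour (g := 1) (Or.inl rfl) (U.map c) hU0
    have hat := atom_seqFour (Or.inl rfl) (hU ▸ h.atom.map)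
    by_cases hd : 2 ≤ d
    · refine ⟨-1, Or.inr rfl, d, b, a, ?_, by omega⟩
      rw [hU, seqFour, seqFour, neg_neg]
      abel
    · exact ⟨1, Or.inl rfl, a, b, d, hU, by omega⟩
  have hUcard : U.card = a + b + d := by rw [← Multiset.card_map c, hUg, seqFour_card]
  obtain ⟨a', b', d', hWg⟩ := eq_seqFour hg (W.map c) hW0
  have hWcard : W.card = a' + b' + d' := by rw [← Multiset.card_map c, hWg, seqFour_card]
  have hhalf := hasShortFact_half h0 h1
  have hmeet : ∀ A ∈ Z, ∃ q ∈ A, c q ∈ U.map c := by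
    intro A hA
    obtain ⟨q, hqA, hqU⟩ := h.exists_mem hA
    exact ⟨q, hqA, Multiset.mem_map_of_mem c hqU⟩
  -- The numbers `x₁, ..., x₆` count the members of types `g⁴`, `g² 2`, `g (-g)`, `2²`, `2 (-g)²`,
  -- `(-g)⁴`. The final clauses exclude types disjoint from `U`.
  have hcount : ∀ Z : Multiset (Multiset Q), (∀ A ∈ Z, IsAtomOver c A) →
      (∀ A ∈ Z, ∀ q ∈ A, c q ≠ 0) → (∀ A ∈ Z, ∃ q ∈ A, c q ∈ U.map c) →
      ∃ x₁ x₂ x₃ x₄ x₅ x₆ : ℕ, Z.card = x₁ + x₂ + x₃ + x₄ + x₅ + x₆ ∧ Z.sum.map c =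
        seqFour g (4 * x₁ + 2 * x₂ + x₃) (x₂ + 2 * x₄ + x₅) (x₃ + 2 * x₅ + 4 * x₆) ∧
        (b = 0 ∧ d = 0 → x₄ = 0 ∧ x₅ = 0) ∧ (d = 0 → x₆ = 0) := by
    intro Z hZ hZ0 hZU
    induction Z using Multiset.induction with
    | empty => exact ⟨0, 0, 0, 0, 0, 0, by simp, by simp [seqFour], by simp, by simp⟩
    | cons A Z ih =>
      obtain ⟨x₁, x₂, x₃, x₄, x₅, x₆, hc, hsum, hb, hd⟩ :=
        ih (fun B hB => hZ B (by simp [hB])) (fun B hB => hZ0 B (by simp [hB]))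
          fun B hB => hZU B (by simp [hB])
      obtain ⟨x, y, z, hA⟩ := eq_seqFour hg (A.map c) (fun hm => by
        obtain ⟨q, hq, hq0⟩ := Multiset.mem_map.1 hm
        exact hZ0 A (by simp) q hq hq0)
      have hat := atom_seqFour hg (hA ▸ (hZ A (by simp)).map)
      have hcommon : (x ≠ 0 ∧ a ≠ 0) ∨ (y ≠ 0 ∧ b ≠ 0) ∨ (z ≠ 0 ∧ d ≠ 0) := by
        obtain ⟨q, hqA, hqU⟩ := hZU A (by simp)
        have hqA' := Multiset.mem_map_of_mem c hqA
        rw [hA] at hqA'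
        rw [hUg] at hqU
        have hne : g ≠ 2 ∧ g ≠ -g ∧ (2 : ZMod 4) ≠ -g := by
          rcases hg with rfl | rfl <;> decide
        simp only [seqFour, Multiset.mem_add, Multiset.mem_replicate] at hqA' hqU
        rcases hqA' with (⟨h1, e1⟩ | ⟨h1, e1⟩) | ⟨h1, e1⟩ <;>
          rcases hqU with (⟨h2, e2⟩ | ⟨h2, e2⟩) | ⟨h2, e2⟩ <;> rw [e1] at e2
        · exact Or.inl ⟨h1, h2⟩
        · exact absurd e2 hne.1
        · exact absurd e2 hne.2.1
        · exact absurd e2.symm hne.1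
        · exact Or.inr (Or.inl ⟨h1, h2⟩)
        · exact absurd e2 hne.2.2
        · exact absurd e2.symm hne.2.1
        · exact absurd e2.symm hne.2.2
        · exact Or.inr (Or.inr ⟨h1, h2⟩)
      rw [Multiset.sum_cons, Multiset.map_add, hA, hsum, seqFour_add, Multiset.card_cons, hc]
      clear hUg hWg hA hsum hc hgen
      rcases hat with ⟨rfl, rfl, rfl⟩ | ⟨rfl, rfl, rfl⟩ | ⟨rfl, rfl, rfl⟩ | ⟨rfl, rfl, rfl⟩ |
        ⟨rfl, rfl, rfl⟩ | ⟨rfl, rfl, rfl⟩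
      · exact ⟨x₁ + 1, x₂, x₃, x₄, x₅, x₆, by omega, by congr 1 <;> omega, hb, hd⟩
      · exact ⟨x₁, x₂ + 1, x₃, x₄, x₅, x₆, by omega, by congr 1 <;> omega, hb, hd⟩
      · exact ⟨x₁, x₂, x₃ + 1, x₄, x₅, x₆, by omega, by congr 1 <;> omega, hb, hd⟩
      · exact ⟨x₁, x₂, x₃, x₄ + 1, x₅, x₆, by omega, by congr 1 <;> omega, by omega, hd⟩
      · exact ⟨x₁, x₂, x₃, x₄, x₅ + 1, x₆, by omega, by congr 1 <;> omega, by omega, hd⟩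
      · exact ⟨x₁, x₂, x₃, x₄, x₅, x₆ + 1, by omega, by congr 1 <;> omega, hb, by omega⟩
  obtain ⟨x₁, x₂, x₃, x₄, x₅, x₆, hZc, hZs, hb, hd⟩ := hcount Z h.atoms h.ne_zero hmeet
  rw [hs, Multiset.map_add, hUg, hWg, seqFour_add] at hZs
  obtain ⟨e1, e2, e3⟩ := seqFour_inj hg hZs
  -- The witnesses are the multiplicities of `g⁴`, `g² 2`, `g (-g)` and `2²` in a factorization of
  -- `W`.
  have fin : ∀ y₁ y₂ y₃ y₄, y₁ + y₂ + y₃ + y₄ ≤ 3 → a' = 4 * y₁ + 2 * y₂ + y₃ →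
      b' = y₂ + 2 * y₄ → d' = y₃ → HasShortFact c W 3 := by
    rintro y₁ y₂ y₃ y₄ hy rfl rfl rfl
    refine HasShortFact.of_map ?_
    rw [hWg]
    exact (hasShortFact_seqFour hg y₁ y₂ d' y₄).mono hy
  refine ⟨by omega, ?_⟩
  by_cases h7 : W.card ≤ 7
  · exact hhalf.mono (by omega)
  clear hcount hmeet hZs hhalf hUg hWg hU0 hW0 hg h0 h1
  rcases hgen with ⟨rfl, rfl, rfl⟩ | ⟨rfl, rfl, rfl⟩ | ⟨rfl, rfl, rfl⟩ | ⟨rfl, rfl, rfl⟩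
  · obtain ⟨rfl, rfl⟩ := hb ⟨rfl, rfl⟩
    obtain rfl := hd rfl
    have l1 : x₁ ≤ 4 := by omega
    have l2 : x₂ ≤ 4 := by omega
    have l3 : x₃ ≤ 4 := by omega
    interval_cases x₁ <;> interval_cases x₂ <;> interval_cases x₃ <;>
      first
      | (exfalso; omega)
      | exact fin 3 0 0 0 (by norm_num) (by omega) (by omega) (by omega)
      | exact fin 2 0 0 0 (by norm_num) (by omega) (by omega) (by omega)
      | exact fin 2 1 0 0 (by norm_num) (by omega) (by omega) (by omega)
      | exact fin 2 0 1 0 (by norm_num) (by omega) (by omega) (by omega)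
      | exact fin 2 0 0 1 (by norm_num) (by omega) (by omega) (by omega)
      | exact fin 1 1 1 0 (by norm_num) (by omega) (by omega) (by omega)
      | exact fin 1 0 2 0 (by norm_num) (by omega) (by omega) (by omega)
      | exact fin 1 1 0 1 (by norm_num) (by omega) (by omega) (by omega)
      | exact fin 1 0 1 1 (by norm_num) (by omega) (by omega) (by omega)
      | exact fin 1 0 0 2 (by norm_num) (by omega) (by omega) (by omega)
  · obtain rfl := hd rfl
    -- For `U = g² 2` some member contains `2` and has length at most three; eleven terms in three
    -- members then mean `4 + 4 + 3`. The cofactor is `g⁸` or `g⁶ (-g)²`.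
    have l1 : x₁ = 2 := by omega
    subst l1
    by_cases l2 : x₂ = 1
    · exact fin 2 0 0 0 (by norm_num) (by omega) (by omega) (by omega)
    · exact fin 1 0 2 0 (by norm_num) (by omega) (by omega) (by omega)
  · exfalso
    omega
  · exfalso
    omega

end OrderFour

end Krull

namespace Krull

/-! ### The Davenport constant is linear in the rank for fixed exponent. -/

section Davenport

variable {G : Type*} [AddCommGroup G] [Fintype G]

/-- If no character `χ` satisfies `χ (g i) ≠ a i` for all `i`, then some non-empty partial sum
of the family `g` vanishes. -/
theorem exists_nonempty_sum_eq_zero {ι : Type*} [Fintype ι] {g : ι → G} {a : ι → ℂ}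
    (ha : ∀ i, a i ≠ 0) (h : ∀ χ : AddChar G ℂ, ∃ i, χ (g i) = a i) :
    ∃ s : Finset ι, s.Nonempty ∧ ∑ i ∈ s, g i = 0 := by
  classical
  by_contra! hfree
  -- Every product has a vanishing factor. On expanding, orthogonality of characters kills all terms
  -- that involve a non-empty partial sum, since these sums are non-zero; what remains is the number
  -- of characters times the product of the `a i`, which is not zero.
  have h0 : ∑ χ : AddChar G ℂ, ∏ i, (a i + -χ (g i)) = 0 :=
    Finset.sum_eq_zero fun χ _ => by
      obtain ⟨i, hi⟩ := h χ
      exact Finset.prod_eq_zero (Finset.mem_univ i) (by rw [hi, add_neg_cancel])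
  simp_rw [Finset.prod_add] at h0
  rw [Finset.sum_comm, Finset.sum_eq_single (Finset.univ : Finset ι)] at h0
  · simp only [Finset.sdiff_self, Finset.prod_empty, mul_one, Finset.sum_const, nsmul_eq_mul] at h0
    rcases mul_eq_zero.1 h0 with h1 | h1
    · exact Nat.cast_ne_zero.2 (Finset.card_ne_zero.2 ⟨1, Finset.mem_univ _⟩) h1
    · exact Finset.prod_ne_zero_iff.2 (fun i _ => ha i) h1
  · intro s _ hs
    have hne : (Finset.univ \ s).Nonempty := by
      rw [Finset.sdiff_nonempty]
      exact fun h => hs (Finset.univ_subset_iff.1 h)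
    have key : ∀ χ : AddChar G ℂ, ∏ i ∈ Finset.univ \ s, -χ (g i) =
        (-1) ^ (Finset.univ \ s).card * χ (∑ i ∈ Finset.univ \ s, g i) := by
      intro χ
      rw [Finset.prod_neg]
      congr 1
      exact (map_prod χ.toMonoidHom (fun i => Multiplicative.ofAdd (g i)) _).symm
    simp_rw [key]
    rw [← Finset.mul_sum, ← Finset.mul_sum,
      AddChar.sum_apply_eq_zero_iff_ne_zero.2 (hfree _ hne), mul_zero, mul_zero]
  · exact fun h => absurd (Finset.mem_powerset.2 (Finset.Subset.refl _)) h

open Classical in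
/-- Greedy choice of roots of unity: each step discards at least one `n`-th of the remaining
characters. -/
theorem exists_roots_card_filter_le {n : ℕ} (hn : 0 < n) (hG : ∀ x : G, n • x = 0)
    {ι : Type*} (g : ι → G) (s : Finset ι) :
    ∃ a : ι → ℂ, (∀ i, a i ≠ 0) ∧
      (Finset.univ.filter fun χ : AddChar G ℂ => ∀ i ∈ s, χ (g i) ≠ a i).card * n ^ s.card ≤
        Fintype.card G * (n - 1) ^ s.card := by
  induction s using Finset.induction_on with
  | empty => exact ⟨fun _ => 1, fun _ => one_ne_zero, by simp [Finset.card_univ]⟩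
  | insert j s hj ih =>
    obtain ⟨a, ha, hle⟩ := ih
    set X := Finset.univ.filter fun χ : AddChar G ℂ => ∀ i ∈ s, χ (g i) ≠ a i with hX
    -- Pigeonhole: on the surviving characters `χ (g j)` takes at most `n` values, all of them roots
    -- of unity.
    obtain ⟨b, hb0, hb⟩ : ∃ b : ℂ, b ≠ 0 ∧
        X.card ≤ n * (X.filter fun χ => χ (g j) = b).card := by
      by_contra! hcon
      have hmaps : ∀ χ ∈ X, χ (g j) ∈ Polynomial.nthRootsFinset n (1 : ℂ) := by
        intro χ _
        rw [Polynomial.mem_nthRootsFinset hn, ← AddChar.map_nsmul_eq_pow, hG,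
          AddChar.map_zero_eq_one]
      have h1 : (1 : ℂ) ∈ Polynomial.nthRootsFinset n (1 : ℂ) := by
        rw [Polynomial.mem_nthRootsFinset hn, one_pow]
      have hsum := Finset.card_eq_sum_card_fiberwise hmaps
      have hlt : ∑ b ∈ Polynomial.nthRootsFinset n (1 : ℂ),
          n * (X.filter fun χ => χ (g j) = b).card <
          ∑ b ∈ Polynomial.nthRootsFinset n (1 : ℂ), X.card := by
        refine Finset.sum_lt_sum_of_nonempty ⟨1, h1⟩ fun b hb => hcon b ?_
        rintro rfl
        rw [Polynomial.mem_nthRootsFinset hn, zero_pow hn.ne'] at hb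
        exact zero_ne_one hb
      rw [← Finset.mul_sum, ← hsum, Finset.sum_const, smul_eq_mul] at hlt
      have hcard : (Polynomial.nthRootsFinset n (1 : ℂ)).card ≤ n := by
        rw [Polynomial.nthRootsFinset]
        exact (Multiset.toFinset_card_le _).trans (Polynomial.card_nthRoots n 1)
      exact absurd (Nat.mul_le_mul_right X.card hcard) (not_le.2 hlt)
    refine ⟨Function.update a j b, fun i => ?_, ?_⟩
    · rcases eq_or_ne i j with rfl | h
      · rwa [Function.update_self]
      · rw [Function.update_of_ne h]
        exact ha i
    · have hfil : (Finset.univ.filter fun χ : AddChar G ℂ =>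
          ∀ i ∈ insert j s, χ (g i) ≠ Function.update a j b i) =
          X.filter fun χ => ¬ χ (g j) = b := by
        ext χ
        simp only [Finset.mem_filter, Finset.mem_univ, true_and, Finset.forall_mem_insert,
          Function.update_self, hX]
        rw [and_comm]
        refine and_congr_left fun _ => forall₂_congr fun i hi => ?_
        rw [Function.update_of_ne (ne_of_mem_of_not_mem hi hj)]
      rw [hfil, Finset.card_insert_of_notMem hj]
      have hadd := Finset.card_filter_add_card_filter_not (s := X) (fun χ => χ (g j) = b)
      obtain ⟨m, rfl⟩ : ∃ m, n = m + 1 := ⟨n - 1, by omega⟩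
      simp only [Nat.add_sub_cancel] at hle ⊢
      have h3 : (X.filter fun χ => ¬ χ (g j) = b).card * (m + 1) ≤ X.card * m := by
        nlinarith
      calc _ = ((X.filter fun χ => ¬ χ (g j) = b).card * (m + 1)) * (m + 1) ^ s.card := by ring
        _ ≤ X.card * m * (m + 1) ^ s.card := Nat.mul_le_mul_right _ h3
        _ = X.card * (m + 1) ^ s.card * m := by ring
        _ ≤ Fintype.card G * m ^ s.card * m := Nat.mul_le_mul_right _ hle
        _ = _ := by ring

/-- After all greedy steps fewer than one character survives, so every character hits one of the
chosen roots. -/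
theorem exists_nonempty_sum_eq_zero_of_lt {n : ℕ} (hn : 0 < n) (hG : ∀ x : G, n • x = 0)
    {ι : Type*} [Fintype ι] (g : ι → G)
    (hlt : Fintype.card G * (n - 1) ^ Fintype.card ι < n ^ Fintype.card ι) :
    ∃ s : Finset ι, s.Nonempty ∧ ∑ i ∈ s, g i = 0 := by
  obtain ⟨a, ha, hle⟩ := exists_roots_card_filter_le hn hG g Finset.univ
  refine exists_nonempty_sum_eq_zero ha fun χ => ?_
  by_contra! hχ
  rw [Finset.card_univ] at hle
  refine absurd (hle.trans_lt hlt) (not_lt.2 (Nat.le_mul_of_pos_left _ (Finset.card_pos.2 ⟨χ, ?_⟩)))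
  simpa using hχ

variable {Q : Type*} {c : Q → G}

/-- An atom with one term removed is zero-sum free. Already `k * r` terms are too many for that,
because `n ^ r * (n - 1) ^ (k * r) = (n * (n - 1) ^ k) ^ r < n ^ (k * r)`. -/
theorem IsAtomOver.card_le_mul {n k r : ℕ} (hn : 0 < n) (hG : ∀ x : G, n • x = 0)
    (hcard : Fintype.card G ≤ n ^ r) (hk : n * (n - 1) ^ k < n ^ k) (hr : r ≠ 0)
    {A : Multiset Q} (hA : IsAtomOver c A) : A.card ≤ k * r := by
  by_contra! hlt
  obtain ⟨x, hx⟩ := Multiset.exists_mem_of_ne_zero hA.ne_zero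
  obtain ⟨B, rfl⟩ := Multiset.exists_cons_of_mem hx
  rw [Multiset.card_cons, Nat.lt_succ_iff] at hlt
  obtain ⟨l, hB', hB'c⟩ : ∃ l : List Q, (l : Multiset Q) ≤ B ∧ l.length = k * r := by
    refine ⟨B.toList.take (k * r), ?_, ?_⟩
    · conv_rhs => rw [← Multiset.coe_toList B]
      exact Multiset.coe_le.2 (List.take_sublist _ _).subperm
    · rw [List.length_take, Multiset.length_toList, min_eq_left hlt]
  obtain ⟨s, ⟨i, hi⟩, hs⟩ := exists_nonempty_sum_eq_zero_of_lt hn hG (fun i => c (l.get i)) (by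
    rw [Fintype.card_fin, hB'c]
    calc _ ≤ n ^ r * (n - 1) ^ (k * r) := Nat.mul_le_mul_right _ hcard
      _ = (n * (n - 1) ^ k) ^ r := by rw [mul_pow, pow_mul]
      _ < (n ^ k) ^ r := Nat.pow_lt_pow_left hk hr
      _ = _ := by rw [pow_mul])
  have hle : s.val.map l.get ≤ (l : Multiset Q) := by
    have h := Multiset.map_le_map (f := l.get) (Finset.val_le_iff.2 (Finset.subset_univ s))
    simpa [Fin.univ_def] using h
  have hz : ZeroSumOver c (s.val.map l.get) := by
    rw [ZeroSumOver, Multiset.map_map]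
    exact hs
  have hBx := (hle.trans hB').trans (Multiset.le_cons_self B x)
  rcases hA.minimal _ hBx hz with h | h
  · rw [Multiset.map_eq_zero] at h
    simp [Finset.val_eq_zero.1 h] at hi
  · have := Multiset.card_le_card (hle.trans hB')
    rw [h, Multiset.card_cons] at this
    omega

end Davenport

end Krull

namespace Krull

/-! ### Invariant factors and the value of `D*`. -/

section InvariantFactors

/-- Every element of order `exponent G` of a finite abelian group `G` is mapped to a generator by
some homomorphism onto a cyclic group of that order. -/
lemma exists_addMonoidHom_zmod_exponent {G : Type*} [AddCommGroup G] [Finite G] {g : G}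
    (hg : addOrderOf g = AddMonoid.exponent G) :
    ∃ f : G →+ ZMod (AddMonoid.exponent G), f g = 1 := by
  set e := AddMonoid.exponent G with he
  have he0 : e ≠ 0 := AddMonoid.exponent_ne_zero_of_finite
  have : NeZero e := ⟨he0⟩
  have hexp : Monoid.exponent (Multiplicative G) = e := Monoid.exponent_multiplicative
  have : NeZero (Monoid.exponent (Multiplicative G)) := ⟨hexp ▸ he0⟩
  let x : Multiplicative G := Multiplicative.ofAdd g
  have hx : orderOf x = e := hg
  obtain ⟨ζ, hζ⟩ : ∃ ζ : ℂˣ, IsPrimitiveRoot ζ e :=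
    ⟨_, (Complex.isPrimitiveRoot_exp e he0).isUnit_unit he0⟩
  have hgen : ∀ y : Subgroup.zpowers x,
      y ∈ Subgroup.zpowers (⟨x, Subgroup.mem_zpowers x⟩ : Subgroup.zpowers x) := by
    rintro ⟨y, k, rfl⟩
    exact ⟨k, rfl⟩
  have hord : orderOf ζ ∣ orderOf (⟨x, Subgroup.mem_zpowers x⟩ : Subgroup.zpowers x) := by
    rw [Subgroup.orderOf_mk, hx, ← hζ.eq_orderOf]
  -- The character of the cyclic subgroup that sends the generator to a primitive root `ζ` extends
  -- to the whole group. Its values are `e`-th roots of unity, that is, powers of `ζ`.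
  obtain ⟨ψ, hψ⟩ := MonoidHom.domRestrict_surjective ℂ (Subgroup.zpowers x)
    (monoidHomOfForallMemZpowers hgen hord)
  have hψx : ψ x = ζ := by
    have := DFunLike.congr_fun hψ ⟨x, Subgroup.mem_zpowers x⟩
    rwa [monoidHomOfForallMemZpowers_apply_gen] at this
  have hmem : ∀ y, ψ y ∈ Subgroup.zpowers ζ := by
    intro y
    rw [hζ.zpowers_eq, mem_rootsOfUnity, ← map_pow, ← hexp, Monoid.pow_exponent_eq_one, map_one]
  let F : Multiplicative G →* Multiplicative (ZMod e) :=
    (AddMonoidHom.toMultiplicative hζ.zmodEquivZPowers.symm.toAddMonoidHom).comp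
      (ψ.codRestrict _ hmem)
  refine ⟨AddMonoidHom.toMultiplicative.symm F, ?_⟩
  have h1 := hζ.zmodEquivZPowers_symm_apply_zpow 1
  rw [Int.cast_one] at h1
  rw [← h1]
  change hζ.zmodEquivZPowers.symm (Additive.ofMul ⟨ψ x, _⟩) = _
  congr 2
  exact Subtype.ext (hψx.trans (zpow_one ζ).symm)

/-- An element of maximal order generates a direct summand: the homomorphism sending it to `1` is
split by `1 ↦ g`, and `K` is its kernel. -/
lemma exists_addEquiv_zmod_exponent_prod (G : Type*) [AddCommGroup G] [Finite G] :
    ∃ K : AddSubgroup G, Nonempty (G ≃+ ZMod (AddMonoid.exponent G) × K) := by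
  have he0 : AddMonoid.exponent G ≠ 0 := AddMonoid.exponent_ne_zero_of_finite
  obtain ⟨g, hg⟩ : ∃ g : G, addOrderOf g = AddMonoid.exponent G :=
    AddMonoid.exists_addOrderOf_eq_exponent (AddMonoid.exponent_ne_zero.1 he0)
  obtain ⟨f, hf⟩ := exists_addMonoidHom_zmod_exponent hg
  let s : ZMod (AddMonoid.exponent G) →+ G := ZMod.lift _ ⟨zmultiplesHom G g, by
    simp [AddMonoid.exponent_nsmul_eq_zero]⟩
  have hs1 : s 1 = g := by
    have := ZMod.lift_coe (AddMonoid.exponent G) ⟨zmultiplesHom G g, by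
      simp [AddMonoid.exponent_nsmul_eq_zero]⟩ 1
    rw [Int.cast_one] at this
    simpa using this
  have hfs : ∀ a, f (s a) = a := by
    intro a
    obtain ⟨k, rfl⟩ := ZMod.intCast_surjective a
    rw [← zsmul_one, map_zsmul, map_zsmul, hs1, hf]
  refine ⟨f.ker, ⟨
    { toFun := fun x => (f x, ⟨x - s (f x), by rw [AddMonoidHom.mem_ker, map_sub, hfs, sub_self]⟩)
      invFun := fun y => s y.1 + y.2
      left_inv := fun x => by simp
      right_inv := ?_
      map_add' := fun x y => ?_ }⟩⟩
  · rintro ⟨a, k, hk⟩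
    rw [AddMonoidHom.mem_ker] at hk
    ext <;> simp [hfs, hk]
  · ext
    · simp
    · simp only [map_add, Prod.mk_add_mk, AddMemClass.mk_add_mk]
      abel

variable {G : Type*} [AddCommGroup G]

lemma dvd_exponent_of_addEquiv {ι : Type*} {n : ι → ℕ} (e : G ≃+ ((i : ι) → ZMod (n i))) (i : ι) :
    n i ∣ AddMonoid.exponent G := by
  classical
  have h : AddMonoid.exponent G • e.symm (Pi.single i 1) = 0 :=
    AddMonoid.exponent_nsmul_eq_zero _
  rw [← map_nsmul, EmbeddingLike.map_eq_zero_iff] at h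
  have := congrFun h i
  rw [Pi.smul_apply, Pi.single_eq_same, nsmul_one, Pi.zero_apply] at this
  exact (ZMod.natCast_eq_zero_iff _ _).1 this

lemma natCard_eq_prod_of_addEquiv {ι : Type*} [Fintype ι] {n : ι → ℕ}
    (e : G ≃+ ((i : ι) → ZMod (n i))) : Nat.card G = ∏ i, n i := by
  rw [Nat.card_congr e.toEquiv, Nat.card_pi]
  simp

theorem exists_isInvariantFactors (G : Type*) [AddCommGroup G] [Finite G] :
    ∃ (r : ℕ) (n : Fin r → ℕ), IsInvariantFactors G n := by
  suffices H : ∀ (m : ℕ) (K : AddSubgroup G), Nat.card K ≤ m →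
      ∃ (r : ℕ) (n : Fin r → ℕ), IsInvariantFactors K n by
    obtain ⟨r, n, h1, h2, ⟨e⟩⟩ := H (Nat.card (⊤ : AddSubgroup G)) ⊤ le_rfl
    exact ⟨r, n, h1, h2, ⟨AddSubgroup.topEquiv.symm.trans e⟩⟩
  intro m
  induction m with
  | zero => exact fun K hK => absurd (Nat.card_pos (α := K)) (by omega)
  | succ m ih =>
    intro K hK
    rcases subsingleton_or_nontrivial K with hK' | hK'
    · exact ⟨0, Fin.elim0, fun i => i.elim0, fun i => i.elim0,
        ⟨⟨⟨fun _ i => i.elim0, fun _ => 0, fun _ => Subsingleton.elim _ _,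
          fun _ => Subsingleton.elim _ _⟩, fun _ _ => Subsingleton.elim _ _⟩⟩⟩
    obtain ⟨L, ⟨e⟩⟩ := exists_addEquiv_zmod_exponent_prod K
    have hexp : 1 < AddMonoid.exponent K := by
      have h0 : AddMonoid.exponent K ≠ 0 := AddMonoid.exponent_ne_zero_of_finite
      have h1 : AddMonoid.exponent K ≠ 1 := fun h =>
        not_subsingleton K (AddMonoid.exp_eq_one_iff.1 h)
      omega
    have hcard : Nat.card K = AddMonoid.exponent K * Nat.card L := by
      rw [Nat.card_congr e.toEquiv, Nat.card_prod, Nat.card_zmod]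
    have hL : 0 < Nat.card L := Nat.card_pos
    let eL : L ≃+ L.map K.subtype := L.equivMapOfInjective _ K.subtype_injective
    obtain ⟨r, n, h1, h2, ⟨e'⟩⟩ := ih (L.map K.subtype) (by
      rw [← Nat.card_congr eL.toEquiv]
      nlinarith)
    -- The exponent is put last, since the invariant factors of the complement all divide it.
    let N : Fin (r + 1) → ℕ := Fin.snoc n (AddMonoid.exponent K)
    have hNl : N (Fin.last r) = AddMonoid.exponent K := Fin.snoc_last _ _
    have hNc : ∀ i : Fin r, N i.castSucc = n i := fun i => Fin.snoc_castSucc _ _ _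
    have hdvd : ∀ i, n i ∣ AddMonoid.exponent K := fun i =>
      (dvd_exponent_of_addEquiv (eL.trans e') i).trans
        (AddMonoid.exponent_addSubmonoid_dvd L.toAddSubmonoid)
    refine ⟨r + 1, N, fun i => ?_, fun i j hij => ?_, ⟨?_⟩⟩
    · cases i using Fin.lastCases with
      | last => rwa [hNl]
      | cast i => rw [hNc]; exact h1 i
    · cases j using Fin.lastCases with
      | last =>
        rw [hNl]
        cases i using Fin.lastCases with
        | last => rw [hNl]
        | cast i => rw [hNc]; exact hdvd i
      | cast j =>
        cases i using Fin.lastCases with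
        | last => exact absurd hij (not_le.2 (Fin.castSucc_lt_last j))
        | cast i => rw [hNc, hNc]; exact h2 i j (Fin.castSucc_le_castSucc_iff.1 hij)
    · let e₁ : (ZMod (N (Fin.last r)) × ((i : Fin r) → ZMod (N i.castSucc))) ≃+
          ((i : Fin (r + 1)) → ZMod (N i)) :=
        AddEquiv.symm
          { (Fin.snocEquiv fun i => ZMod (N i)).symm with map_add' := fun _ _ => rfl }
      exact (e.trans (AddEquiv.prodCongr (ZMod.ringEquivCongr hNl.symm).toAddEquiv
        ((eL.trans e').trans (AddEquiv.piCongrRight fun i =>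
          (ZMod.ringEquivCongr (hNc i).symm).toAddEquiv)))).trans e₁

variable (G)

lemma exists_isInvariantFactors_rank [Finite G] : ∃ n : Fin (rank G) → ℕ, IsInvariantFactors G n :=
  Nat.sInf_mem (exists_isInvariantFactors G)

lemma exists_isInvariantFactors_dStar [Finite G] :
    ∃ (r : ℕ) (n : Fin r → ℕ), IsInvariantFactors G n ∧ dStar G = 1 + ∑ i, (n i - 1) := by
  obtain ⟨r, n, h⟩ := exists_isInvariantFactors G
  exact Nat.sInf_mem (s := {d | ∃ (r : ℕ) (n : Fin r → ℕ), IsInvariantFactors G n ∧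
    d = 1 + ∑ i, (n i - 1)}) ⟨_, r, n, h, rfl⟩

variable {G}

lemma IsInvariantFactors.dvd_exponent {r : ℕ} {n : Fin r → ℕ} (h : IsInvariantFactors G n)
    (i : Fin r) : n i ∣ AddMonoid.exponent G :=
  dvd_exponent_of_addEquiv h.2.2.some i

lemma IsInvariantFactors.natCard_eq {r : ℕ} {n : Fin r → ℕ} (h : IsInvariantFactors G n) :
    Nat.card G = ∏ i, n i :=
  natCard_eq_prod_of_addEquiv h.2.2.some

lemma dStar_eq_of_elementary {p r : ℕ} (hp : p.Prime) (e : G ≃+ (Fin r → ZMod p)) :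
    dStar G = 1 + r * (p - 1) := by
  have : NeZero p := ⟨hp.ne_zero⟩
  have : Finite G := Finite.of_equiv _ e.symm.toEquiv
  obtain ⟨s, n, h, hd⟩ := exists_isInvariantFactors_dStar G
  have hexp : AddMonoid.exponent G ∣ p := by
    rw [AddMonoid.exponent_dvd_iff_forall_nsmul_eq_zero]
    intro g
    apply e.injective
    rw [map_nsmul, map_zero]
    ext i
    simp
  have hn : ∀ i, n i = p := fun i =>
    ((Nat.dvd_prime hp).1 ((h.dvd_exponent i).trans hexp)).resolve_left (h.1 i).ne'
  have hcard := h.natCard_eq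
  rw [Finset.prod_congr rfl fun i _ => hn i, natCard_eq_prod_of_addEquiv e] at hcard
  simp only [Finset.prod_const, Finset.card_univ, Fintype.card_fin] at hcard
  rw [hd, Finset.sum_congr rfl fun i _ => by rw [hn i], Finset.sum_const, Finset.card_univ,
    Fintype.card_fin, Nat.pow_right_injective hp.two_le hcard, smul_eq_mul]

lemma dStar_eq_four (e : G ≃+ ZMod 4) : dStar G = 4 := by
  have : Finite G := Finite.of_equiv _ e.symm.toEquiv
  obtain ⟨s, n, h, hd⟩ := exists_isInvariantFactors_dStar G
  have hcard := h.natCard_eq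
  rw [Nat.card_congr e.toEquiv, Nat.card_zmod] at hcard
  have hs : 2 ^ s ≤ 2 ^ 2 := by
    calc 2 ^ s = ∏ _i : Fin s, 2 := by simp
      _ ≤ ∏ i, n i := Finset.prod_le_prod' fun i _ => h.1 i
      _ = 2 ^ 2 := hcard.symm
  have hs2 : s ≤ 2 := (Nat.pow_le_pow_iff_right (by norm_num)).1 hs
  interval_cases s
  · simp at hcard
  · simp only [Finset.univ_unique, Fin.default_eq_zero, Fin.isValue, Finset.prod_singleton,
      Finset.sum_singleton] at hcard hd
    omega
  · rw [Fin.prod_univ_two] at hcard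
    have h0 := h.1 0
    have h1 := h.1 1
    have h2 : n 0 = 2 ∧ n 1 = 2 := by constructor <;> nlinarith
    -- Two invariant factors equal to two would make the group of exponent two, but `2 • 1 ≠ 0` in
    -- `ZMod 4`.
    have e' := e.symm.trans h.2.2.some
    have h3 : (2 : ℕ) • e' 1 = 0 := by
      ext i
      have hi : ((2 : ℕ) : ZMod (n i)) = 0 := by
        rw [ZMod.natCast_eq_zero_iff]
        fin_cases i
        exacts [h2.1.dvd, h2.2.dvd]
      rw [Pi.smul_apply, nsmul_eq_mul, hi, zero_mul, Pi.zero_apply]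
    rw [← map_nsmul, EmbeddingLike.map_eq_zero_iff] at h3
    exact absurd h3 (by decide)

end InvariantFactors

end Krull

namespace Krull

/-! ### The atom formed by a basis and the negative of its sum, and exact values. -/

section TameDegree

variable {G Q M : Type*} [AddCommGroup G] [CommMonoid M] {θ : M →* FreeAbMonoid Q} {c : Q → G}

lemma IsZeroSumModel.tameDegree_eq_succ (h : IsZeroSumModel θ c) {N : ℕ}
    (hle : TameLE c (N + 1)) (hlt : ¬ TameLE c N) : tameDegree M = ((N + 1 : ℕ) : ℕ∞) := by
  refine le_antisymm ((tameDegree_le_iff h _).2 hle) ?_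
  rw [← tameDegree_le_iff h, not_le] at hlt
  rw [Nat.cast_succ]
  exact Order.add_one_le_of_lt hlt

end TameDegree

section Basis

variable {r : ℕ} {n : Fin r → ℕ}

/-- The standard basis together with the negative of its sum. -/
def basisVec (n : Fin r → ℕ) (j : Option (Fin r)) (i : Fin r) : ZMod (n i) :=
  (if j = some i then 1 else 0) - (if j = none then 1 else 0)

lemma sum_basisVec_apply (I : Finset (Option (Fin r))) (i : Fin r) :
    (∑ j ∈ I, basisVec n j) i = (if some i ∈ I then 1 else 0) - (if none ∈ I then 1 else 0) := by
  rw [Finset.sum_apply]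
  simp only [basisVec, Finset.sum_sub_distrib, Finset.sum_ite_eq']

lemma sum_basisVec : ∑ j, basisVec n j = 0 := by
  ext i
  rw [sum_basisVec_apply]
  simp

/-- Coordinate `i` vanishes only if `eᵢ` and the negative sum are both in `I` or both outside. -/
lemma eq_empty_or_univ_of_sum_basisVec (hn : ∀ i, 1 < n i) {I : Finset (Option (Fin r))}
    (h : ∑ j ∈ I, basisVec n j = 0) : I = ∅ ∨ I = Finset.univ := by
  have key : ∀ i, some i ∈ I ↔ none ∈ I := by
    intro i
    have : Fact (1 < n i) := ⟨hn i⟩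
    have hi := congrFun h i
    rw [sum_basisVec_apply] at hi
    by_cases h1 : some i ∈ I <;> by_cases h2 : none ∈ I <;> simp_all
  by_cases h0 : none ∈ I
  · right
    ext j
    cases j <;> simp [key, h0]
  · left
    ext j
    cases j <;> simp [key, h0]

lemma basisVec_injective (hn : ∀ i, 1 < n i) (hr : 2 ≤ r) : Function.Injective (basisVec n) := by
  have h1 : ∀ i, (1 : ZMod (n i)) ≠ 0 := fun i =>
    have : Fact (1 < n i) := ⟨hn i⟩
    one_ne_zero
  have hnone : ∀ l, basisVec n none ≠ basisVec n (some l) := by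
    intro l h
    have : Nontrivial (Fin r) := Fin.nontrivial_iff_two_le.2 hr
    obtain ⟨i, hi⟩ := exists_ne l
    have := congrFun h i
    simp [basisVec, hi.symm, h1] at this
  rintro (_ | i) (_ | j) h
  · rfl
  · exact absurd h (hnone j)
  · exact absurd h.symm (hnone i)
  · by_contra hij
    have := congrFun h i
    simp [basisVec, h1, Ne.symm (fun h' : i = j => hij (congrArg some h'))] at this

lemma basisVec_ne_zero (hn : ∀ i, 1 < n i) (hr : r ≠ 0) (j : Option (Fin r)) :
    basisVec n j ≠ 0 := by
  have h1 : ∀ i, (1 : ZMod (n i)) ≠ 0 := fun i =>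
    have : Fact (1 < n i) := ⟨hn i⟩
    one_ne_zero
  intro h
  cases j with
  | none =>
    have := congrFun h ⟨0, Nat.pos_of_ne_zero hr⟩
    simp [basisVec, h1] at this
  | some i =>
    have := congrFun h i
    simp [basisVec, h1] at this

lemma isAtomOver_basisVec (hn : ∀ i, 1 < n i) :
    IsAtomOver (id : ((i : Fin r) → ZMod (n i)) → _) (Finset.univ.val.map (basisVec n)) :=
  isAtomOver_univ_map (c := id) sum_basisVec fun _ => eq_empty_or_univ_of_sum_basisVec hn

end Basis

/-! ### Groups whose tame degree is at most `D*`. -/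

section Classification

variable {G Q : Type*} [AddCommGroup G] {c : Q → G}

lemma exists_section_comp {K : Type*} [AddCommGroup K] (hc : Function.Surjective c)
    (e : G ≃+ K) : ∃ p : K → Q, ∀ g, e (c (p g)) = g := by
  choose p hp using hc
  exact ⟨fun g => p (e.symm g), fun g => by rw [hp, e.apply_symm_apply]⟩

/-- The square-free atom `e_1, ..., e_r, e_1 + ... + e_r` has `r + 1` terms; bringing it into the
product of their squares replaces all of them. -/
theorem not_tameLE_of_elementary_two {r : ℕ} (hr : 2 ≤ r) (hc : Function.Surjective c)
    (e : G ≃+ (Fin r → ZMod 2)) : ¬ TameLE c r := by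
  obtain ⟨p, hp⟩ := exists_section_comp hc e
  rw [← tameLE_comp_iff (f := e.toAddMonoidHom) e.injective]
  have hx : ∀ j, e (c (p (basisVec (fun _ => 2) j))) = basisVec (fun _ => 2) j := fun j => hp _
  have hn : ∀ _i : Fin r, 1 < 2 := fun _ => one_lt_two
  refine not_tameLE_of_squares (J := Option (Fin r)) (fun j => p (basisVec (fun _ => 2) j))
    ?_ ?_ ?_ ?_ ?_ ?_
  · intro j l h
    apply basisVec_injective hn hr
    rw [← hx j, ← hx l]
    exact congrArg (fun q => e (c q)) h
  · intro j
    ext i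
    exact CharTwo.add_self_eq_zero _
  · intro j
    exact (hx j).trans_ne (basisVec_ne_zero hn (by omega) j)
  · exact (Finset.sum_congr rfl fun j _ => hx j).trans sum_basisVec
  · intro I hI
    exact eq_empty_or_univ_of_sum_basisVec hn
      ((Finset.sum_congr rfl fun j _ => hx j).symm.trans hI)
  · simp

theorem not_tameLE_of_zmod {m : ℕ} (hm : 3 ≤ m) (hc : Function.Surjective c) (e : G ≃+ ZMod m) :
    ¬ TameLE c (m - 1) := by
  let e' : G ≃+ ((_i : Fin 1) → ZMod m) := e.trans
    { (Equiv.funUnique (Fin 1) (ZMod m)).symm with map_add' := fun _ _ => rfl }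
  obtain ⟨p, hp⟩ := exists_section_comp hc e'
  rw [← tameLE_comp_iff (f := e'.toAddMonoidHom) e'.injective]
  have := not_tameLE_cyclic_pred (n := fun _ : Fin 1 => m) (c := fun q => e' (c q)) (p := p)
    (fun _ => by omega) hp 0 (fun i => Subsingleton.elim _ _) hm
  simpa using this

/-- The element `p² q²` has the factorizations `p² · q²` and `(pq)²`, and the first contains no
`pq`. -/
theorem not_tameLE_one_of_two_primes {g : G} (hg : g ≠ 0) (h2 : g + g = 0) {p q : Q} (hpq : p ≠ q)
    (hp : c p = g) (hq : c q = g) : ¬ TameLE c 1 := by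
  have hx : ∀ j : Fin 2, c (![p, q] j) = g := by
    intro j
    fin_cases j <;> assumption
  refine not_tameLE_of_squares ![p, q] ?_ (fun j => by rw [hx, h2]) (fun j => by rwa [hx]) ?_ ?_
    (by simp)
  · intro i j
    fin_cases i <;> fin_cases j <;> simp [hpq, hpq.symm]
  · rw [Fin.sum_univ_two, hx, hx, h2]
  · intro I hI
    rw [Finset.sum_congr rfl fun j _ => hx j, Finset.sum_const] at hI
    have hcard : I.card ≤ 2 := by simpa using Finset.card_le_univ I
    interval_cases h : I.card
    · exact Or.inl (Finset.card_eq_zero.1 h)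
    · rw [one_nsmul] at hI
      exact absurd hI hg
    · exact Or.inr ((Finset.card_eq_iff_eq_univ I).1 (by simpa using h))

/-- If the tame degree is at most `D*(G)`, then `D*(G) ≤ 4`. -/
theorem classification_of_tameLE_dStar [Finite G] (hc : Function.Surjective c)
    (h : TameLE c (dStar G)) : Subsingleton G ∨ Nonempty (G ≃+ ZMod 2) ∨ Nonempty (G ≃+ ZMod 3) ∨
      Nonempty (G ≃+ ZMod 4) ∨ Nonempty (G ≃+ (Fin 2 → ZMod 2)) ∨
      Nonempty (G ≃+ (Fin 3 → ZMod 2)) := by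
  obtain ⟨r, n, ⟨hn, hdvd, ⟨e⟩⟩, hd⟩ := exists_isInvariantFactors_dStar G
  obtain ⟨p, hp⟩ := exists_section_comp hc e
  rw [hd, ← tameLE_comp_iff (f := e.toAddMonoidHom) e.injective] at h
  change TameLE (fun q => e (c q)) _ at h
  cases r with
  | zero => exact Or.inl (e.toEquiv.subsingleton)
  | succ r =>
    right
    have hcyc {m : ℕ} (hr : r = 0) (hm : n (Fin.last r) = m) : Nonempty (G ≃+ ZMod m) := by
      subst hr
      let e' : ((i : Fin 1) → ZMod (n i)) ≃+ ZMod (n 0) :=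
        { Equiv.piUnique (fun i : Fin 1 => ZMod (n i)) with map_add' := fun _ _ => rfl }
      exact ⟨(e.trans e').trans (ZMod.ringEquivCongr hm).toAddEquiv⟩
    have hr0 : r = 0 → ∀ i : Fin (r + 1), i = Fin.last r := by
      rintro rfl i
      exact Fin.eq_zero i
    rcases Nat.eq_or_lt_of_le (hn (Fin.last r)) with h2 | h3
    · have hn2 : ∀ i, n i = 2 := fun i =>
        ((Nat.dvd_prime Nat.prime_two).1 
          ((hdvd i _ (Fin.le_last i)).trans h2.symm.dvd)).resolve_left (hn i).ne'
      have hel : Nonempty (G ≃+ (Fin (r + 1) → ZMod 2)) :=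
        ⟨e.trans (AddEquiv.piCongrRight fun i => (ZMod.ringEquivCongr (hn2 i)).toAddEquiv)⟩
      rcases lt_or_ge r 3 with hr | hr
      · interval_cases r
        · exact Or.inl (hcyc rfl h2.symm)
        · exact Or.inr (Or.inr (Or.inr (Or.inl hel)))
        · exact Or.inr (Or.inr (Or.inr (Or.inr hel)))
      · exfalso
        have h1 : ∀ i, (1 : ZMod (n i)) ≠ 0 := fun i =>
          have : Fact (1 < n i) := ⟨hn i⟩
          one_ne_zero
        let i₀ : Fin (r + 1) := ⟨0, by omega⟩
        let i₁ : Fin (r + 1) := ⟨1, by omega⟩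
        let i₂ : Fin (r + 1) := ⟨2, by omega⟩
        -- In rank at least four the fourth term has the two non-zero coordinates `i₀` and `i₃`, so
        -- it is off the basis without a second prime.
        let i₃ : Fin (r + 1) := ⟨3, by omega⟩
        refine not_tameLE_two (c := fun q => e (c q)) hn2 hp (i₀ := i₀) (i₁ := i₁) (i₂ := i₂) (by simp [i₀, i₁])
          (by simp [i₀, i₂]) (by simp [i₁, i₂])
          (x₃ := p fun i => if i = i₁ ∨ i = i₂ then 0 else 1) (fun i => by rw [hp])
          (offBasis_of_two (c := fun q => e (c q)) hp (i := i₀) (k := i₃) (by simp [i₀, i₃]) ?_ ?_) h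
        · rw [hp, if_neg (by simp [i₀, i₁, i₂])]
          exact h1 _
        · rw [hp, if_neg (by simp [i₃, i₁, i₂])]
          exact h1 _
    · rcases Nat.eq_zero_or_pos r with hr | hr
      · rcases lt_or_ge (n (Fin.last r)) 5 with h5 | h5
        · obtain h' | h' : n (Fin.last r) = 3 ∨ n (Fin.last r) = 4 := by omega
          · exact Or.inr (Or.inl (hcyc hr h'))
          · exact Or.inr (Or.inr (Or.inl (hcyc hr h')))
        · exact absurd h (not_tameLE_cyclic hn hp _ (hr0 hr) h5)
      · refine absurd h (not_tameLE_of_three_le hn hp (Fin.last r) 0 ?_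
          (fun i => hdvd i _ (Fin.le_last i)) h3)
        exact fun h' => hr.ne (congrArg Fin.val h')

/-- A basis of an elementary `2`-group of rank three may be chosen to contain a given element. -/
lemma exists_addEquiv_apply_eq_single {v : Fin 3 → ZMod 2} (hv : v ≠ 0) :
    ∃ (i : Fin 3) (f : (Fin 3 → ZMod 2) ≃+ (Fin 3 → ZMod 2)), f v = Pi.single i 1 := by
  obtain ⟨i, hi⟩ := Function.ne_iff.1 hv
  have hi1 : v i = 1 := by
    exact (by decide : ∀ a : ZMod 2, a ≠ 0 → a = 1) _ hi
  -- A transvection: `v - eᵢ` has `i`-th coordinate zero, so `F` fixes the `i`-th coordinate and is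
  -- an involution in characteristic two.
  let F : (Fin 3 → ZMod 2) → (Fin 3 → ZMod 2) := fun x => x + x i • (v - Pi.single i 1)
  have hF : Function.Involutive F := by
    intro x
    have : F x i = x i := by simp [F, hi1]
    change F x + F x i • (v - Pi.single i 1) = x
    rw [this, add_assoc, CharTwo.add_self_eq_zero, add_zero]
  refine ⟨i, ⟨hF.toPerm, fun x y => ?_⟩, ?_⟩
  · change x + y + (x i + y i) • _ = (x + _) + (y + _)
    rw [add_smul]
    abel
  · change v + v i • (v - Pi.single i 1) = _
    rw [hi1, one_smul, CharTwo.sub_eq_add, ← add_assoc, CharTwo.add_self_eq_zero, zero_add]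

/-- Choose the basis so that `g` is `e_{i₀}`. The lift of the basis uses `x` for this class, and `y`
serves as the fourth term of the four-row matrix: same class, but off the lifted basis. -/
theorem not_tameLE_dStar_of_two_primes (hc : Function.Surjective c) (e : G ≃+ (Fin 3 → ZMod 2))
    {g : G} (hg : g ≠ 0) {x y : Q} (hxy : x ≠ y) (hx : c x = g) (hy : c y = g) :
    ¬ TameLE c (dStar G) := by
  obtain ⟨i₀, f, hf⟩ := exists_addEquiv_apply_eq_single
    ((EmbeddingLike.map_ne_zero_iff (f := e)).2 hg)
  let e' := e.trans f
  have hex : e' (c x) = Pi.single i₀ 1 := by rw [hx]; exact hf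
  have hey : e' (c y) = Pi.single i₀ 1 := by rw [hy]; exact hf
  obtain ⟨p, hp⟩ := exists_section_comp hc e'
  rw [← tameLE_comp_iff (f := e'.toAddMonoidHom) e'.injective,
    dStar_eq_of_elementary Nat.prime_two e]
  obtain ⟨i₁, i₂, h01, h02, h12, hcov⟩ : ∃ i₁ i₂ : Fin 3, i₀ ≠ i₁ ∧ i₀ ≠ i₂ ∧ i₁ ≠ i₂ ∧
      ∀ i, (i = i₁ ∨ i = i₂) ↔ i ≠ i₀ := by
    clear hf hex hey
    decide +revert
  have hp' : ∀ g, e' (c (Function.update p (Pi.single i₀ 1) x g)) = g := by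
    intro g
    rcases eq_or_ne g (Pi.single i₀ 1) with rfl | hne
    · rw [Function.update_self, hex]
    · rw [Function.update_of_ne hne, hp]
  have hoff : ∀ i, y ≠ Function.update p (Pi.single i₀ 1) x (Pi.single i 1) := by
    intro i hy'
    rcases eq_or_ne i i₀ with rfl | hne
    · rw [Function.update_self] at hy'
      exact hxy hy'.symm
    · have := (hy' ▸ hp' (Pi.single i 1) : e' (c y) = Pi.single i 1)
      rw [hey] at this
      have := congrFun this i
      simp [hne] at this
  have := not_tameLE_two (n := fun _ : Fin 3 => 2) (c := fun q => e' (c q)) (fun _ => rfl) hp'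
    h01 h02 h12 (x₃ := y) (fun i => ?_) (fun i => ⟨hoff i, ?_⟩)
  · simpa using this
  · simp only [hey, hcov, ite_not]
    rw [Pi.single_apply]
  · rw [← Pi.single_neg, CharTwo.neg_eq]
    exact hoff i

end Classification

end Krull

namespace Krull

/-! ### Bounds for the Davenport constant and growth of the tame degree. -/

section DavenportConstant

variable {G Q : Type*} [AddCommGroup G]

lemma irreducible_associatesMk_iff {M : Type*} [CommMonoid M] {a : M} :
    Irreducible (Associates.mk a) ↔ Irreducible a := by
  refine ⟨fun h => ⟨fun ha => h.1 (Associates.isUnit_mk.2 ha), fun x y hxy => ?_⟩,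
    fun h => ⟨fun ha => h.1 (Associates.isUnit_mk.1 ha), fun x y hxy => ?_⟩⟩
  · have := h.2 (a := Associates.mk x) (b := Associates.mk y) (by rw [hxy, Associates.mk_mul_mk])
    rwa [Associates.isUnit_mk, Associates.isUnit_mk] at this
  · obtain ⟨x, rfl⟩ := Associates.mk_surjective x
    obtain ⟨y, rfl⟩ := Associates.mk_surjective y
    rw [Associates.mk_mul_mk, Associates.mk_eq_mk_iff_associated] at hxy
    rw [Associates.isUnit_mk, Associates.isUnit_mk]
    exact (hxy.irreducible h).isUnit_or_isUnit rfl

lemma davenport_le_iff (N : ℕ) :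
    davenport G ≤ N ↔ ∀ A : Multiset G, IsAtomOver (id : G → G) A → A.card ≤ N := by
  have h := isZeroSumModel_zeroSumEmbedding (AddEquiv.refl G)
  have hirr (U : zeroSumMonoid G) :
      Irreducible U ↔ IsAtomOver (id : G → G) (U : FreeAbMonoid G).toAdd := by
    rw [← irreducible_associatesMk_iff, irreducible_iff_isAtomOver h, content_mk,
      toAdd_zeroSumEmbedding]
    simp
  simp only [davenport, iSup_le_iff, Nat.cast_le, hirr]
  refine ⟨fun H A hA => ?_, fun H U hU => H _ hU⟩
  refine H ⟨Multiplicative.ofAdd A, ?_⟩ hA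
  change A.sum = 0
  simpa [ZeroSumOver] using hA.zeroSum

variable {c : Q → G}

lemma IsAtomOver.card_le_of_davenport {d : ℕ} (hd : davenport G = d) {A : Multiset Q}
    (hA : IsAtomOver c A) : A.card ≤ d := by
  rw [← Multiset.card_map c A]
  exact (davenport_le_iff d).1 hd.le _ hA.map

lemma card_add_one_le_davenport {r : ℕ} {n : Fin r → ℕ} (hG : IsInvariantFactors G n) {d : ℕ}
    (hd : davenport G = d) : r + 1 ≤ d := by
  obtain ⟨hn, -, ⟨e⟩⟩ := hG
  have hA' : IsAtomOver (fun g => e.symm.toAddMonoidHom (id g))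
      (Finset.univ.val.map (basisVec n)) :=
    (isAtomOver_comp_iff (f := e.symm.toAddMonoidHom) e.symm.injective).2 (isAtomOver_basisVec hn)
  simpa using hA'.card_le_of_davenport hd

end DavenportConstant

section Positive

lemma TameLE.mono {G Q : Type*} [AddCommGroup G] {c : Q → G} {N N' : ℕ} (h : TameLE c N)
    (hN : N ≤ N') : TameLE c N' := fun Z hZ U hU hUZ =>
  let ⟨Z', hZ', hs, hU', h₁, h₂⟩ := h Z hZ U hU hUZ
  ⟨Z', hZ', hs, hU', h₁.trans hN, h₂.trans hN⟩

variable {G Q : Type*} [AddCommGroup G] {c : Q → G}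

/-- In a monoid of tame degree zero all atoms are prime, so that a prime divisor in a class of
order `m` occurs in a zero-sum sequence only with multiplicity at least `m`. -/
lemma addOrderOf_le_count_of_tameLE_zero [Finite G] (h : TameLE c 0) {q : Q}
    {S : Multiset Q} (hS : ZeroSumOver c S) (hqS : q ∈ S) :
    Multiset.replicate (addOrderOf (c q)) q ≤ S := by
  classical
  have hU : IsAtomOver c (Multiset.replicate (addOrderOf (c q)) q) := by
    refine ⟨?_, ?_, fun B hB hz => ?_⟩
    · rw [Ne, ← Multiset.card_eq_zero, Multiset.card_replicate]
      exact (addOrderOf_pos _).ne'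
    · simp [ZeroSumOver, addOrderOf_nsmul_eq_zero]
    · obtain ⟨k, hk, rfl⟩ := Multiset.le_replicate_iff.1 hB
      have hdvd : addOrderOf (c q) ∣ k := by
        rw [addOrderOf_dvd_iff_nsmul_eq_zero]
        simpa [ZeroSumOver] using hz
      rcases Nat.eq_zero_or_pos k with rfl | hk0
      · exact Or.inl rfl
      · exact Or.inr (by rw [le_antisymm hk (Nat.le_of_dvd hk0 hdvd)])
  obtain ⟨Z, hZ, rfl⟩ := exists_atoms_sum_eq hS
  obtain ⟨A, hA, hqA⟩ := mem_sum_iff.1 hqS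
  -- Enough copies of `A` contain the atom `U`, a power of `q`. Distance zero leaves only copies of
  -- `A` in the new factorization, so `U = A`.
  obtain ⟨Z', -, -, hUZ', -, hd⟩ := h (Multiset.replicate (addOrderOf (c q)) A)
    (fun B hB => Multiset.eq_of_mem_replicate hB ▸ hZ A hA) _ hU (by
      rw [Multiset.sum_replicate, ← Multiset.nsmul_singleton]
      exact nsmul_le_nsmul_right (Multiset.singleton_le.2 hqA) _)
  have hle : Z' ≤ Multiset.replicate (addOrderOf (c q)) A := by
    rw [← tsub_eq_zero_iff_le, ← Multiset.card_eq_zero]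
    omega
  rw [Multiset.eq_of_mem_replicate (Multiset.mem_of_le hle hUZ')]
  exact Multiset.single_le_sum (fun _ _ => zero_le) A hA

/-- Otherwise every `φ x` divisible by `p` is divisible by `p ^ m`, with `m > 1` the order of its
class, and `p` could not be a greatest common divisor of such images. -/
lemma not_tameLE_zero {H P : Type*} [CancelCommMonoid H] {φ : H →* FreeAbMonoid P}
    (hφ : IsDivisorTheory φ) [Finite (DivisorClassGroup φ)] {p : P} (hp : primeClass φ p ≠ 0) :
    ¬ TameLE (primeClass φ) 0 := by
  intro h
  obtain ⟨X, -, hX, hgcd⟩ := hφ.exists_gcd p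
  have hdvd := hgcd (Multiplicative.ofAdd (Multiset.replicate (addOrderOf (primeClass φ p)) p)) (by
    rintro _ ⟨x, hx, rfl⟩
    obtain ⟨R, hR⟩ := hX _ ⟨x, hx, rfl⟩
    have hmem : p ∈ (φ x).toAdd := by
      rw [hR]
      simp
    obtain ⟨T, hT⟩ := Multiset.le_iff_exists_add.1 (addOrderOf_le_count_of_tameLE_zero h
      ((hφ.isZeroSumModel.zeroSum_iff _).2 ⟨x, rfl⟩) hmem)
    exact ⟨Multiplicative.ofAdd T, Multiplicative.toAdd.injective hT⟩)
  obtain ⟨R, hR⟩ := hdvd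
  have hcard := congrArg (fun S : FreeAbMonoid P => S.toAdd.card) hR
  simp only [toAdd_ofAdd, Multiset.card_singleton, toAdd_mul, Multiset.card_add,
    Multiset.card_replicate] at hcard
  have h1 : addOrderOf (primeClass φ p) ≠ 1 := by rwa [Ne, AddMonoid.addOrderOf_eq_one_iff]
  have h0 := addOrderOf_pos (primeClass φ p)
  omega

end Positive

section Growth

variable {G Q : Type*} [AddCommGroup G] [Finite G] {c : Q → G}

lemma exists_mul_pow_lt_pow {n : ℕ} (hn : 0 < n) : ∃ k, n * (n - 1) ^ k < n ^ k := by
  have hn' : (0 : ℝ) < n := Nat.cast_pos.2 hn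
  obtain ⟨k, hk⟩ := exists_pow_lt_of_lt_one (x := (1 / n : ℝ)) (y := ((n - 1 : ℝ) / n))
    (by positivity) (by rw [div_lt_one hn']; linarith)
  refine ⟨k, ?_⟩
  rw [div_pow, div_lt_div_iff₀ (by positivity) hn', one_mul] at hk
  rw [← Nat.cast_lt (α := ℝ)]
  push_cast [Nat.cast_sub (Nat.one_le_iff_ne_zero.2 hn.ne')]
  linarith

lemma natCard_le_exponent_pow {r : ℕ} {n : Fin r → ℕ} (h : IsInvariantFactors G n) :
    Nat.card G ≤ AddMonoid.exponent G ^ r := by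
  rw [h.natCard_eq]
  calc ∏ i, n i ≤ ∏ _i : Fin r, AddMonoid.exponent G :=
        Finset.prod_le_prod' fun i _ => Nat.le_of_dvd
          (Nat.pos_of_ne_zero AddMonoid.exponent_ne_zero_of_finite) (h.dvd_exponent i)
    _ = _ := by simp

lemma davenport_le_mul_rank {k : ℕ}
    (hk : AddMonoid.exponent G * (AddMonoid.exponent G - 1) ^ k < AddMonoid.exponent G ^ k)
    (hr : rank G ≠ 0) : davenport G ≤ (k * rank G : ℕ) := by
  have : Fintype G := Fintype.ofFinite G
  obtain ⟨n, hn⟩ := exists_isInvariantFactors_rank G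
  rw [davenport_le_iff]
  intro A hA
  refine hA.card_le_mul (Nat.pos_of_ne_zero AddMonoid.exponent_ne_zero_of_finite)
    AddMonoid.exponent_nsmul_eq_zero ?_ hk hr
  rw [← Nat.card_eq_fintype_card]
  exact natCard_le_exponent_pow hn

lemma rank_ne_zero [Nontrivial G] : rank G ≠ 0 := by
  intro h
  obtain ⟨n, hn⟩ := exists_isInvariantFactors_rank G
  have hcard := natCard_le_exponent_pow hn
  rw [h, pow_zero] at hcard
  exact absurd hcard (not_le.2 Finite.one_lt_card)

/-- A quadratic lower bound for the tame degree in terms of the rank. -/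
lemma rank_sq_le_of_tameLE (hc : Function.Surjective c) (he : 2 ≤ AddMonoid.exponent G)
    (h0 : ¬ TameLE c 0) {t : ℕ} (ht : TameLE c t) :
    rank G ^ 2 ≤ 8 * AddMonoid.exponent G ^ 2 * t := by
  set e := AddMonoid.exponent G with he'
  set r := rank G
  obtain ⟨n, hG⟩ := exists_isInvariantFactors_rank G
  have hdvd : ∀ i, n i ∣ e := hG.dvd_exponent
  obtain ⟨hn, -, ⟨f⟩⟩ := hG
  obtain ⟨p, hp⟩ := exists_section_comp hc f
  have hmono {s : ℕ} (hs : ¬ TameLE c s) : s < t := by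
    by_contra! hts
    exact hs (ht.mono hts)
  have ht0 := hmono h0
  rcases lt_or_ge r (2 * e) with hr | hr
  -- When the rank is small compared with the exponent, `1 ≤ t` is enough.
  · calc r ^ 2 ≤ (2 * e) ^ 2 := Nat.pow_le_pow_left hr.le 2
      _ ≤ 8 * e ^ 2 * 1 := by nlinarith
      _ ≤ 8 * e ^ 2 * t := Nat.mul_le_mul_left _ ht0
  -- With `s.card = e * q - 1` the matrix has `e * q ≤ r / 2` rows and at least `r / 2` columns
  -- outside `s`, while `q ≥ r / (4 * e)`; so the tame degree exceeds a value of at least `r ^ 2 /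
  -- (8 * e)`.
  · set q := r / (2 * e)
    have hq1 : 1 ≤ q := (Nat.one_le_div_iff (by omega)).2 hr
    have hq2 : 2 * e * q ≤ r := Nat.mul_div_le r (2 * e)
    have hq3 : r < 2 * e * (q + 1) := Nat.lt_mul_div_succ r (by omega)
    have heq : 2 ≤ e * q := by nlinarith
    have hqr : 2 * (e * q) ≤ r := by rwa [← mul_assoc]
    obtain ⟨s, -, hs⟩ := Finset.exists_subset_card_eq
      (s := (Finset.univ : Finset (Fin r))) (n := e * q - 1) (by
        rw [Finset.card_univ, Fintype.card_fin]
        omega)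
    have hsc : sᶜ.card = r - (e * q - 1) := by rw [Finset.card_compl, Fintype.card_fin, hs]
    have hsc2 : r ≤ 2 * sᶜ.card := by
      rw [hsc]
      omega
    obtain ⟨k₁, hk₁, k₂, hk₂, hk⟩ := Finset.one_lt_card.1 (show 1 < sᶜ.card by omega)
    rw [Finset.mem_compl] at hk₁ hk₂
    have key := not_tameLE_quadratic (c := fun q => f (c q)) hn hp s
      (Finset.card_pos.1 (by omega)) hk₁ hk₂ hk hdvd (q := q) (by omega) (by omega)
    rw [show (fun q => f (c q)) = fun q => f.toAddMonoidHom (c q) from rfl,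
      tameLE_comp_iff (f := f.toAddMonoidHom) f.injective] at key
    have hlt := hmono key
    have hr4 : r ≤ 4 * e * q := by nlinarith
    calc r ^ 2 = r * r := sq r
      _ ≤ (2 * sᶜ.card) * (4 * e * q) := Nat.mul_le_mul hsc2 hr4
      _ = 8 * e * (sᶜ.card * q) := by ring
      _ ≤ 8 * e * t := Nat.mul_le_mul_left _ hlt.le
      _ ≤ 8 * e ^ 2 * t := Nat.mul_le_mul_right _ (by nlinarith)

end Growth

end Krull

namespace Krull

/-! ### The main results. -/

section Cyclic

variable {G Q : Type*} [AddCommGroup G]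

lemma dStar_eq_of_zmod {p : ℕ} (hp : p.Prime) (e : G ≃+ ZMod p) : dStar G = p := by
  have := dStar_eq_of_elementary (r := 1) hp (e.trans
    { (Equiv.funUnique (Fin 1) (ZMod p)).symm with map_add' := fun _ _ => rfl })
  have := hp.one_le
  omega

lemma tameLE_three_of_zmod_three {c : Q → G} (e : G ≃+ ZMod 3) : TameLE c 3 :=
  (tameLE_comp_iff (f := e.toAddMonoidHom) e.injective).1 tameLE_zmod_three

lemma tameLE_four_of_zmod_four {c : Q → G} (e : G ≃+ ZMod 4) : TameLE c 4 :=
  (tameLE_comp_iff (f := e.toAddMonoidHom) e.injective).1 tameLE_zmod_four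

lemma add_self_and_card_of_elementary_two [Fintype G] {r : ℕ} (e : G ≃+ (Fin r → ZMod 2)) :
    (∀ g : G, g + g = 0) ∧ Fintype.card G = 2 ^ r := by
  refine ⟨fun g => e.injective ?_, ?_⟩
  · ext i
    rw [map_add, map_zero, Pi.add_apply, CharTwo.add_self_eq_zero, Pi.zero_apply]
  · rw [Fintype.card_congr e.toEquiv]
    simp

end Cyclic

section MainResults

variable {G : Type*} [AddCommGroup G] [Finite G]

/-- The groups with `t(G) = D*(G)`. -/
theorem tameDegree_zeroSumMonoid_eq_dStar_iff :
    tameDegree (zeroSumMonoid G) = (dStar G : ℕ∞) ↔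
      (Nonempty (G ≃+ ZMod 3) ∨ Nonempty (G ≃+ ZMod 4) ∨ Nonempty (G ≃+ (Fin 2 → ZMod 2)) ∨
        Nonempty (G ≃+ (Fin 3 → ZMod 2))) := by
  have : Fintype G := Fintype.ofFinite G
  have hM := isZeroSumModel_zeroSumEmbedding (AddEquiv.refl G)
  have hid : Function.Surjective (id : G → G) := Function.surjective_id
  constructor
  · intro h
    have hne : dStar G ≠ 0 := by
      obtain ⟨r, n, -, hd⟩ := exists_isInvariantFactors_dStar G
      omega
    -- For order at most two B(G) has tame degree zero, whereas `D*` is positive.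
    have hsmall (h2 : ∀ g : G, g + g = 0) (hG : Fintype.card G ≤ 2) : False := by
      have h0 := (tameDegree_le_iff hM 0).2 (tameLE_zero_of_card_le_two h2 hG)
      rw [h, Nat.cast_le] at h0
      omega
    rcases classification_of_tameLE_dStar hid ((tameDegree_le_iff hM _).1 h.le) with
      h1 | ⟨⟨e⟩⟩ | h3 | h4 | h5 | h6
    · exact (hsmall (fun _ => Subsingleton.elim _ _)
        ((Fintype.card_le_one_iff_subsingleton.2 h1).trans one_le_two)).elim
    · refine (hsmall (fun g => e.injective ?_) ?_).elim
      · rw [map_add, map_zero, CharTwo.add_self_eq_zero]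
      · rw [Fintype.card_congr e.toEquiv, ZMod.card]
    · exact Or.inl h3
    · exact Or.inr (Or.inl h4)
    · exact Or.inr (Or.inr (Or.inl h5))
    · exact Or.inr (Or.inr (Or.inr h6))
  · rintro (⟨⟨e⟩⟩ | ⟨⟨e⟩⟩ | ⟨⟨e⟩⟩ | ⟨⟨e⟩⟩)
    · rw [dStar_eq_of_zmod Nat.prime_three e]
      exact hM.tameDegree_eq_succ (tameLE_three_of_zmod_three e)
        (not_tameLE_of_zmod le_rfl hid e)
    · rw [dStar_eq_four e]
      exact hM.tameDegree_eq_succ (tameLE_four_of_zmod_four e)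
        (not_tameLE_of_zmod (by norm_num) hid e)
    · rw [dStar_eq_of_elementary Nat.prime_two e]
      exact hM.tameDegree_eq_succ (tameLE_klein (add_self_and_card_of_elementary_two e).1
        (add_self_and_card_of_elementary_two e).2)
        (not_tameLE_of_elementary_two le_rfl hid e)
    · rw [dStar_eq_of_elementary Nat.prime_two e]
      exact hM.tameDegree_eq_succ (tameLE_eight (add_self_and_card_of_elementary_two e).1
        (add_self_and_card_of_elementary_two e).2)
        (not_tameLE_of_elementary_two (by norm_num) hid e)

variable {H P : Type*} [CancelCommMonoid H] {φ : H →* FreeAbMonoid P}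

theorem tameDegree_eq_dStar_iff (hφ : IsDivisorTheory φ) [Finite (DivisorClassGroup φ)]
    (hc : Function.Surjective (primeClass φ)) {g : DivisorClassGroup φ} (hg : g ≠ 0) {p q : P}
    (hpq : p ≠ q) (hp : primeClass φ p = g) (hq : primeClass φ q = g) :
    tameDegree H = (dStar (DivisorClassGroup φ) : ℕ∞) ↔
      (Nonempty (DivisorClassGroup φ ≃+ ZMod 2) ∨ Nonempty (DivisorClassGroup φ ≃+ ZMod 3) ∨
        Nonempty (DivisorClassGroup φ ≃+ ZMod 4) ∨
        Nonempty (DivisorClassGroup φ ≃+ (Fin 2 → ZMod 2))) := by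
  have : Fintype (DivisorClassGroup φ) := Fintype.ofFinite _
  have hM := hφ.isZeroSumModel
  constructor
  · intro h
    have hT := (tameDegree_le_iff hM _).1 h.le
    rcases classification_of_tameLE_dStar hc hT with h1 | h2 | h3 | h4 | h5 | ⟨⟨e⟩⟩
    · exact absurd (Subsingleton.elim _ _) hg
    · exact Or.inl h2
    · exact Or.inr (Or.inl h3)
    · exact Or.inr (Or.inr (Or.inl h4))
    · exact Or.inr (Or.inr (Or.inr h5))
    · exact absurd hT (not_tameLE_dStar_of_two_primes hc e hg hpq hp hq)
  · rintro (⟨⟨e⟩⟩ | ⟨⟨e⟩⟩ | ⟨⟨e⟩⟩ | ⟨⟨e⟩⟩)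
    · have h2 : ∀ x : DivisorClassGroup φ, x + x = 0 := fun x => e.injective (by
        rw [map_add, map_zero, CharTwo.add_self_eq_zero])
      rw [dStar_eq_of_zmod Nat.prime_two e]
      refine hM.tameDegree_eq_succ (tameLE_two_of_card_le_two h2 ?_)
        (not_tameLE_one_of_two_primes hg (h2 g) hpq hp hq)
      rw [Fintype.card_congr e.toEquiv, ZMod.card]
    · rw [dStar_eq_of_zmod Nat.prime_three e]
      exact hM.tameDegree_eq_succ (tameLE_three_of_zmod_three e) (not_tameLE_of_zmod le_rfl hc e)
    · rw [dStar_eq_four e]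
      exact hM.tameDegree_eq_succ (tameLE_four_of_zmod_four e)
        (not_tameLE_of_zmod (by norm_num) hc e)
    · rw [dStar_eq_of_elementary Nat.prime_two e]
      exact hM.tameDegree_eq_succ (tameLE_klein (add_self_and_card_of_elementary_two e).1
        (add_self_and_card_of_elementary_two e).2) (not_tameLE_of_elementary_two le_rfl hc e)

/-- Bounds in natural numbers for the Davenport constant and the tame degree. -/
theorem exists_davenport_tameDegree_bounds (hφ : IsDivisorTheory φ) [Finite (DivisorClassGroup φ)]
    (hc : Function.Surjective (primeClass φ)) {n k : ℕ} (hn : 2 ≤ n)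
    (he : AddMonoid.exponent (DivisorClassGroup φ) = n) (hk : n * (n - 1) ^ k < n ^ k) :
    ∃ d t : ℕ, davenport (DivisorClassGroup φ) = (d : ℕ∞) ∧ tameDegree H = (t : ℕ∞) ∧
      1 ≤ rank (DivisorClassGroup φ) ∧ rank (DivisorClassGroup φ) + 1 ≤ d ∧
      d ≤ k * rank (DivisorClassGroup φ) ∧
      rank (DivisorClassGroup φ) ^ 2 ≤ 8 * n ^ 2 * t ∧ t ≤ 1 + d * (d - 1) / 2 := by
  subst he
  have : Nontrivial (DivisorClassGroup φ) := by
    rw [← not_subsingleton_iff_nontrivial]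
    intro h
    rw [AddMonoid.exp_eq_one_of_subsingleton] at hn
    omega
  have hr := rank_ne_zero (G := DivisorClassGroup φ)
  have hd := davenport_le_mul_rank hk hr
  obtain ⟨d, hd'⟩ := ENat.ne_top_iff_exists.1 (ne_top_of_le_ne_top (ENat.natCast_ne_top _) hd)
  rw [← hd', Nat.cast_le] at hd
  obtain ⟨m, hm⟩ := exists_isInvariantFactors_rank (DivisorClassGroup φ)
  have hM := hφ.isZeroSumModel
  have ht := (tameDegree_le_iff hM _).2 (tameLE_of_card_le (c := primeClass φ) (D := d)
    fun A hA => hA.card_le_of_davenport hd'.symm)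
  obtain ⟨t, ht'⟩ := ENat.ne_top_iff_exists.1 (ne_top_of_le_ne_top (ENat.natCast_ne_top _) ht)
  rw [← ht', Nat.cast_le] at ht
  obtain ⟨g, hg⟩ := exists_ne (0 : DivisorClassGroup φ)
  obtain ⟨p, rfl⟩ := hc g
  exact ⟨d, t, hd'.symm, ht'.symm, Nat.one_le_iff_ne_zero.2 hr,
    card_add_one_le_davenport hm hd'.symm, hd,
    rank_sq_le_of_tameLE hc hn (not_tameLE_zero hφ hg) ((tameDegree_le_iff hM t).1 ht'.ge), ht⟩

end MainResults

end Krull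
theorem theorem4p11 :
    -- parts 1 and 2
    (∀ (H : Type u) [CancelCommMonoid H] (P : Type v) (φ : H →* Krull.FreeAbMonoid P),
      Krull.IsDivisorTheory φ →
      Finite (Krull.DivisorClassGroup φ) →
      (∀ g : Krull.DivisorClassGroup φ, ∃ p : P, Krull.primeClass φ p = g) →
      (Krull.tameDegree (Krull.zeroSumMonoid (Krull.DivisorClassGroup φ)) =
          (Krull.dStar (Krull.DivisorClassGroup φ) : ℕ∞) ↔
        (Nonempty (Krull.DivisorClassGroup φ ≃+ ZMod 3) ∨
          Nonempty (Krull.DivisorClassGroup φ ≃+ ZMod 4) ∨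
          Nonempty (Krull.DivisorClassGroup φ ≃+ (Fin 2 → ZMod 2)) ∨
          Nonempty (Krull.DivisorClassGroup φ ≃+ (Fin 3 → ZMod 2)))) ∧
      ((∃ g : Krull.DivisorClassGroup φ, g ≠ 0 ∧
          ∃ p q : P, p ≠ q ∧ Krull.primeClass φ p = g ∧ Krull.primeClass φ q = g) →
        (Krull.tameDegree H = (Krull.dStar (Krull.DivisorClassGroup φ) : ℕ∞) ↔
          (Nonempty (Krull.DivisorClassGroup φ ≃+ ZMod 2) ∨
            Nonempty (Krull.DivisorClassGroup φ ≃+ ZMod 3) ∨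
            Nonempty (Krull.DivisorClassGroup φ ≃+ ZMod 4) ∨
            Nonempty (Krull.DivisorClassGroup φ ≃+ (Fin 2 → ZMod 2)))))) ∧
    -- part 3: the constants depend only on the exponent `n` of the class group
    (∀ n : ℕ, 2 ≤ n →
      ∃ M₁ M₂ M₃ M₄ M₅ : ℝ, 0 < M₁ ∧ 0 < M₂ ∧ 0 < M₃ ∧ 0 < M₄ ∧ 0 < M₅ ∧
        ∀ (H : Type u) [CancelCommMonoid H] (P : Type v) (φ : H →* Krull.FreeAbMonoid P),
          Krull.IsDivisorTheory φ →
          Finite (Krull.DivisorClassGroup φ) →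
          (∀ g : Krull.DivisorClassGroup φ, ∃ p : P, Krull.primeClass φ p = g) →
          AddMonoid.exponent (Krull.DivisorClassGroup φ) = n →
          ∃ d t : ℕ,
            Krull.davenport (Krull.DivisorClassGroup φ) = (d : ℕ∞) ∧
            Krull.tameDegree H = (t : ℕ∞) ∧
            M₁ * (Krull.rank (Krull.DivisorClassGroup φ) : ℝ) ≤ (d : ℝ) ∧
            (d : ℝ) ≤ M₂ * (Krull.rank (Krull.DivisorClassGroup φ) : ℝ) ∧
            M₃ * (Krull.rank (Krull.DivisorClassGroup φ) : ℝ) ^ 2 ≤ (t : ℝ) ∧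
            (t : ℝ) ≤ M₄ * (Krull.rank (Krull.DivisorClassGroup φ) : ℝ) ^ 2 ∧
            M₅ * (1 + (d : ℝ) * ((d : ℝ) - 1) / 2) ≤ (t : ℝ) ∧
            (t : ℝ) ≤ 1 + (d : ℝ) * ((d : ℝ) - 1) / 2) := by
  refine ⟨fun H _ P φ hφ hfin hc => ⟨Krull.tameDegree_zeroSumMonoid_eq_dStar_iff, ?_⟩,
    fun n hn => ?_⟩
  · rintro ⟨g, hg, p, q, hpq, hp, hq⟩
    exact Krull.tameDegree_eq_dStar_iff hφ hc hg hpq hp hq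
  · obtain ⟨k, hk⟩ := Krull.exists_mul_pow_lt_pow (show 0 < n by omega)
    have hk0 : 0 < k := by
      rw [Nat.pos_iff_ne_zero]
      rintro rfl
      simp only [pow_zero, mul_one] at hk
      omega
    have hkR : (0 : ℝ) < k := Nat.cast_pos.2 hk0
    have hnR : (0 : ℝ) < n := Nat.cast_pos.2 (by omega)
    -- The integer `k` depends only on `n`. From `d ≤ k * r` and `1 ≤ r` one gets `1 + d(d - 1)/2 ≤
    -- (1 + k²/2) r²`, which is the fourth constant; the fifth is the quotient of the third by the
    -- fourth.
    refine ⟨1, k, 1 / (8 * n ^ 2), 1 + k ^ 2 / 2, 1 / (8 * n ^ 2) / (1 + k ^ 2 / 2),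
      one_pos, hkR, by positivity, by positivity, by positivity, fun H _ P φ hφ hfin hc he => ?_⟩
    obtain ⟨d, t, hd, ht, hr, hrd, hdr, hrt, htd⟩ :=
      Krull.exists_davenport_tameDegree_bounds hφ hc hn he hk
    refine ⟨d, t, hd, ht, ?_⟩
    set r := Krull.rank (Krull.DivisorClassGroup φ)
    have hr' : (1 : ℝ) ≤ r := by exact_mod_cast hr
    have hrd' : (r : ℝ) + 1 ≤ d := by exact_mod_cast hrd
    have hdr' : (d : ℝ) ≤ k * r := by exact_mod_cast hdr
    have hrt' : (r : ℝ) ^ 2 ≤ 8 * n ^ 2 * t := by exact_mod_cast hrt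
    have htd' : (t : ℝ) ≤ 1 + d * (d - 1) / 2 := by
      calc (t : ℝ) ≤ ((1 + d * (d - 1) / 2 : ℕ) : ℝ) := Nat.cast_le.2 htd
        _ ≤ 1 + ((d * (d - 1) : ℕ) : ℝ) / 2 := by
          push_cast
          gcongr
          exact_mod_cast Nat.cast_div_le (α := ℝ) (m := d * (d - 1)) (n := 2)
        _ = _ := by
          push_cast [Nat.cast_sub (show 1 ≤ d by omega)]
          rfl
    have hlow : 1 / (8 * (n : ℝ) ^ 2) * r ^ 2 ≤ t := by
      rw [div_mul_eq_mul_div, one_mul, div_le_iff₀ (by positivity)]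
      linarith
    have hsq : (d : ℝ) ^ 2 ≤ k ^ 2 * r ^ 2 := by
      rw [← mul_pow]
      exact pow_le_pow_left₀ (by positivity) hdr' 2
    have hquad : 1 + (d : ℝ) * (d - 1) / 2 ≤ (1 + k ^ 2 / 2) * r ^ 2 := by
      have : (1 : ℝ) ≤ r ^ 2 := one_le_pow₀ hr'
      nlinarith
    refine ⟨by linarith, hdr', hlow, htd'.trans hquad, ?_, htd'⟩
    refine le_trans ?_ hlow
    rw [div_mul_eq_mul_div, div_le_iff₀ (by positivity), mul_assoc, mul_comm (_ ^ 2) (_ + _)]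
    exact mul_le_mul_of_nonneg_left hquad (by positivity)
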